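/- Let $k$ be a field and let $A$ be a unital associative $k$-algebra such that $A\otimes_k A^{\mathrm{op}}$ is (left) Noetherian. Write $\overline A=A/(k\cdot 1)$, and let $s\overline A$ be $\overline A$ placed in degree $-1$. For $p\ge 0$ let $\Omega^p=A\otimes (s\overline A)^{\otimes p}$ be the $A$-$A$-bimodule of noncommutative differential $p$-forms, placed in degree $-p$, with left action by multiplication and right action $$(a_0\otimes s\overline a_1\otimes\cdots\otimes s\overline a_p)\blacktriangleleft a_{p+1}=\sum_{i=0}^{p}(-1)^{p-i}\,a_0\otimes s\overline a_1\otimes\cdots\otimes s\overline{a_ia_{i+1}}\otimes\cdots\otimes s\overline a_{p+1}$$ (for $i=0$ the summand is $a_0a_1\otimes s\overline a_2\otimes\cdots\otimes s\overline a_{p+1}$). Let $\mathrm{Bar}_*$ be the normalized bar resolution of $A$, with $\mathrm{Bar}_n=A\otimes (s\overline A)^{\otimes n}\otimes A$, and let $C^*(A,\Omega^p)$ be the normalized Hochschild cochain complex, $$C^m(A,\Omega^p)=\mathrm{Hom}_{A\otimes A^{\mathrm{op}}}(\mathrm{Bar}_{m+p},\Omega^p)\cong\mathrm{Hom}_k((s\overline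 A)^{\otimes (m+p)},\Omega^p)\quad(m\in\mathbb Z),\qquad \delta f=(-1)^{m+1}f\circ d .$$ Let $\theta_p\colon C^*(A,\Omega^p)\to C^*(A,\Omega^{p+1})$ be the cochain maps $f\mapsto f\otimes \mathrm{id}_{s\overline A}$, let $C_{\mathrm{sg}}^*(A,A)=\mathrm{colim}_{\theta_p}\,C^*(A,\Omega^p)$ be the singular Hochschild cochain complex, let $\mathrm{HH}^*_{\mathrm{sg}}(A,A)$ be its cohomology, and let $\rho\colon \mathrm{HH}^*(A,A)\to \mathrm{HH}^*_{\mathrm{sg}}(A,A)$ be induced by $C^*(A,A)=C^*(A,\Omega^0)\to C^*_{\mathrm{sg}}(A,A)$. For a Noetherian ring $R$ let $D^b(R)$ be the bounded derived category of finitely generated left $R$-modules and let $D_{\mathrm{sg}}(R)$ be its Verdier quotient by the perfect complexes (those isomorphic to bounded complexes of finitely generated projective modules). Then there are, for all $m\in\mathbb Z$, isomorphisms of $k$-vector spaces $$\Psi\colon \mathrm{HH}^m(A,A)\to \mathrm{Hom}_{D^b(A\otimes A^{\mathrm{op}})}(A,A[m]),\qquad \Phi\colon \mathrm{HH}^m_{\mathrm{sg}}(A,A)\to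 \mathrm{Hom}_{D_{\mathrm{sg}}(A\otimes A^{\mathrm{op}})}(A,A[m])$$ with the following properties. 1. $\Psi$ is the canonical isomorphism: it sends the class of a cocycle $f\colon \mathrm{Bar}_m\to A$ to the morphism $A\to A[m]$ in the derived category that $f$ defines through the bar resolution. 2. $\Phi\circ\rho=\rho'\circ\Psi$, where $\rho'$ is induced by the quotient functor $D^b(A\otimes A^{\mathrm{op}})\to D_{\mathrm{sg}}(A\otimes A^{\mathrm{op}})$. 3. $\Phi$ is the canonical map at every stage of the colimit: for every cocycle $f\colon \mathrm{Bar}_{m+p}\to\Omega^p$ in $C^m(A,\Omega^p)$, with $m+p\ge 0$, there are morphisms $g\colon A\to Y$ and $s\colon A[m]\to Y$ in $D^b(A\otimes A^{\mathrm{op}})$, with the cone of $s$ perfect, and a morphism $h\colon Y\to\Omega^p[p][m]$ in the derived category of all bimodules, such that $\Phi([f])=s^{-1}\circ g$, such that $h\circ g$ is the morphism $A\to\Omega^p[p+m]=\Omega^p[p][m]$ defined by $f$ through the bar resolution, and such that $h\circ s$ is the $m$-th shift of the morphism $A\to\Omega^p[p]$ defined in the same way by the canonical surjection $\mathrm{Bar}_p\to\Omega^p$,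 $\omega\otimes b\mapsto\omega\blacktriangleleft b$. (In the third property, and for shifts and morphisms, $\Omega^p$ is regarded as a bimodule in degree $0$.) -/

import Mathlib

universe u v w

namespace SingHoch

set_option linter.unusedSectionVars false

noncomputable section

open CategoryTheory TensorProduct MulOpposite

/-- The enveloping algebra `A ⊗ Aᵒᵖ`; its left modules are the `A`-`A`-bimodules (on which `k`
acts centrally), via `(a ⊗ b) • m = a m b`. -/
abbrev Env (k : Type u) (A : Type v) [Field k] [Ring A] [Algebra k A] : Type v :=
  A ⊗[k] Aᵐᵒᵖ

/-- `Ā = A / (k · 1)`. -/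
abbrev Red (k : Type u) (A : Type v) [Field k] [Ring A] [Algebra k A] : Type v :=
  A ⧸ Submodule.span k {(1 : A)}

section Bimodules

variable (k : Type u) (A : Type v) [Field k] [Ring A] [Algebra k A]

/-- The class `ā` of `a`. -/
abbrev red : A →ₗ[k] Red k A := (Submodule.span k {(1 : A)}).mkQ

variable (M : Type v) [AddCommGroup M] [Module k M] [Module (Env k A) M]
  [IsScalarTower k (Env k A) M]

/-- Left multiplications `m ↦ a m` on a bimodule. -/
def leftMul : A →ₐ[k] Module.End k M :=
  (Algebra.lsmul k k M : Env k A →ₐ[k] Module.End k M).comp Algebra.TensorProduct.includeLeft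

/-- Right multiplications `m ↦ m b` on a bimodule. -/
def rightMul : Aᵐᵒᵖ →ₐ[k] Module.End k M :=
  (Algebra.lsmul k k M : Env k A →ₐ[k] Module.End k M).comp Algebra.TensorProduct.includeRight

lemma leftMul_apply (a : A) (m : M) :
    leftMul k A M a m = (a ⊗ₜ[k] (1 : Aᵐᵒᵖ)) • m := rfl

lemma rightMul_apply (b : Aᵐᵒᵖ) (m : M) :
    rightMul k A M b m = ((1 : A) ⊗ₜ[k] b) • m := rfl

lemma smul_eq (a : A) (b : Aᵐᵒᵖ) (m : M) :
    (a ⊗ₜ[k] b : Env k A) • m = leftMul k A M a (rightMul k A M b m) := by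
  rw [leftMul_apply, rightMul_apply, smul_smul]; simp

lemma leftMul_rightMul (a : A) (b : Aᵐᵒᵖ) (m : M) :
    leftMul k A M a (rightMul k A M b m) = rightMul k A M b (leftMul k A M a m) := by
  simp only [leftMul_apply, rightMul_apply, smul_smul]; simp

/-- The bimodule with left multiplications `l` and right multiplications `r`. -/
@[reducible] def moduleOfMul {X : Type v} [AddCommGroup X] [Module k X]
    (l : A →ₐ[k] Module.End k X) (r : Aᵐᵒᵖ →ₐ[k] Module.End k X)
    (h : ∀ a b, Commute (l a) (r b)) : Module (Env k A) X :=
  Module.compHom X (Algebra.TensorProduct.lift l r h).toRingHom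

lemma moduleOfMul_smul {X : Type v} [AddCommGroup X] [Module k X]
    (l : A →ₐ[k] Module.End k X) (r : Aᵐᵒᵖ →ₐ[k] Module.End k X)
    (h : ∀ a b, Commute (l a) (r b)) (e : Env k A) (x : X) :
    letI := moduleOfMul k A l r h
    e • x = Algebra.TensorProduct.lift l r h e x := rfl

lemma moduleOfMul_left {X : Type v} [AddCommGroup X] [Module k X]
    (l : A →ₐ[k] Module.End k X) (r : Aᵐᵒᵖ →ₐ[k] Module.End k X)
    (h : ∀ a b, Commute (l a) (r b)) (a : A) (x : X) :
    letI := moduleOfMul k A l r h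
    (a ⊗ₜ[k] (1 : Aᵐᵒᵖ) : Env k A) • x = l a x := by
  rw [moduleOfMul_smul, Algebra.TensorProduct.lift_tmul, map_one, mul_one]

lemma moduleOfMul_right {X : Type v} [AddCommGroup X] [Module k X]
    (l : A →ₐ[k] Module.End k X) (r : Aᵐᵒᵖ →ₐ[k] Module.End k X)
    (h : ∀ a b, Commute (l a) (r b)) (b : Aᵐᵒᵖ) (x : X) :
    letI := moduleOfMul k A l r h
    ((1 : A) ⊗ₜ[k] b : Env k A) • x = r b x := by
  rw [moduleOfMul_smul, Algebra.TensorProduct.lift_tmul, map_one, one_mul]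

lemma moduleOfMul_isScalarTower {X : Type v} [AddCommGroup X] [Module k X]
    (l : A →ₐ[k] Module.End k X) (r : Aᵐᵒᵖ →ₐ[k] Module.End k X)
    (h : ∀ a b, Commute (l a) (r b)) :
    letI := moduleOfMul k A l r h
    IsScalarTower k (Env k A) X := by
  let _ := moduleOfMul k A l r h
  refine ⟨fun c e x ↦ ?_⟩
  rw [moduleOfMul_smul, moduleOfMul_smul, map_smul, LinearMap.smul_apply]

lemma commute_lmul_lsmul (a : A) (b : Aᵐᵒᵖ) :
    Commute (Algebra.lmul k A a) (Algebra.lsmul k k A b) := by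
  ext x; simp [mul_assoc]

/-- `A` as a bimodule over itself. -/
instance : Module (Env k A) A :=
  moduleOfMul k A (Algebra.lmul k A) (Algebra.lsmul k k A) (commute_lmul_lsmul k A)

instance : IsScalarTower k (Env k A) A :=
  moduleOfMul_isScalarTower k A _ _ (commute_lmul_lsmul k A)

/-- The `k`-module `M ⊗ sĀ` underlying the bimodule of forms of one degree higher. -/
def Forms : Type v := M ⊗[k] Red k A

instance : AddCommGroup (Forms k A M) := inferInstanceAs (AddCommGroup (M ⊗[k] Red k A))
instance : Module k (Forms k A M) := inferInstanceAs (Module k (M ⊗[k] Red k A))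

variable {M} in
/-- The element `m ⊗ s ā`. -/
def Forms.mk (m : M) (a : A) : Forms k A M := m ⊗ₜ[k] red k A a

namespace Forms

variable {M}

lemma mk_one (m : M) : mk k A m (1 : A) = 0 := by
  have : red k A 1 = 0 := by
    rw [Submodule.mkQ_apply, Submodule.Quotient.mk_eq_zero]
    exact Submodule.mem_span_singleton_self _
  rw [mk, this, TensorProduct.tmul_zero]
  rfl

lemma mk_add_left (m m' : M) (a : A) : mk k A (m + m') a = mk k A m a + mk k A m' a :=
  TensorProduct.add_tmul _ _ _

lemma mk_smul_left (c : k) (m : M) (a : A) : mk k A (c • m) a = c • mk k A m a := rfl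

lemma mk_sub_left (m m' : M) (a : A) : mk k A (m - m') a = mk k A m a - mk k A m' a :=
  TensorProduct.sub_tmul _ _ _

lemma mk_add_right (m : M) (a a' : A) : mk k A m (a + a') = mk k A m a + mk k A m a' := by
  simp only [mk, map_add]; exact TensorProduct.tmul_add _ _ _

lemma mk_smul_right (c : k) (m : M) (a : A) : mk k A m (c • a) = c • mk k A m a := by
  simp only [mk, map_smul]; exact TensorProduct.tmul_smul _ _ _

lemma hom_ext {P : Type*} [AddCommGroup P] [Module k P] {f g : Forms k A M →ₗ[k] P}
    (h : ∀ m a, f (mk k A m a) = g (mk k A m a)) : f = g := by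
  refine TensorProduct.ext' fun m x ↦ ?_
  obtain ⟨a, rfl⟩ := Submodule.mkQ_surjective _ x
  exact h m a

variable (M) in
/-- The `k`-linear map `m ↦ m ⊗ s ā`. -/
def mkₗ (a : A) : M →ₗ[k] Forms k A M where
  toFun m := mk k A m a
  map_add' m m' := mk_add_left k A m m' a
  map_smul' c m := mk_smul_left k A c m a

variable (M)

/-- `k`-linear maps out of `M ⊗ sĀ`, from `k`-bilinear maps on `A × M` vanishing on `{1} × M`. -/
def lift {P : Type*} [AddCommGroup P] [Module k P] (f : A →ₗ[k] M →ₗ[k] P)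
    (hf : f 1 = 0) : Forms k A M →ₗ[k] P :=
  TensorProduct.lift (LinearMap.flip
    ((Submodule.span k {(1 : A)}).liftQ f (by
      rw [Submodule.span_le, Set.singleton_subset_iff]; exact hf)))

@[simp] lemma lift_mk {P : Type*} [AddCommGroup P] [Module k P] (f : A →ₗ[k] M →ₗ[k] P)
    (hf : f 1 = 0) (m : M) (a : A) : lift k A M f hf (mk k A m a) = f a m := rfl

/-- Left multiplication on forms: `a (m ⊗ s ā') = (a m) ⊗ s ā'`. -/
def left : A →ₐ[k] Module.End k (Forms k A M) :=
  (show Module.End k M →ₐ[k] Module.End k (Forms k A M) from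
    Module.End.rTensorAlgHom k M (Red k A)).comp (leftMul k A M)

@[simp] lemma left_mk (a : A) (m : M) (a' : A) :
    left k A M a (mk k A m a') = mk k A (leftMul k A M a m) a' := rfl

/-- Right multiplication by `b` on forms:
`(m ⊗ s ā) ◂ b = m ⊗ s (ab)‾ - (m a) ⊗ s b̄`. -/
def rightAux (b : Aᵐᵒᵖ) : Module.End k (Forms k A M) :=
  lift k A M
    (LinearMap.mk₂ k
      (fun a m ↦ mk k A m (a * b.unop) - mk k A (rightMul k A M (op a) m) b.unop)
      (fun a a' m ↦ by
        simp only [add_mul, MulOpposite.op_add, map_add, LinearMap.add_apply, mk_add_right, mk_add_left]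
        abel)
      (fun c a m ↦ by
        simp only [smul_mul_assoc, op_smul, map_smul, LinearMap.smul_apply, mk_smul_right,
          mk_smul_left, smul_sub])
      (fun a m m' ↦ by
        simp only [map_add, mk_add_left]; abel)
      (fun c a m ↦ by
        simp only [map_smul, mk_smul_left, smul_sub]))
    (by ext m; simp)

@[simp] lemma rightAux_mk (b : Aᵐᵒᵖ) (m : M) (a : A) :
    rightAux k A M b (mk k A m a) =
      mk k A m (a * b.unop) - mk k A (rightMul k A M (op a) m) b.unop := rfl

/-- Right multiplications on forms. -/
def right : Aᵐᵒᵖ →ₐ[k] Module.End k (Forms k A M) :=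
  AlgHom.ofLinearMap
    { toFun := rightAux k A M
      map_add' := fun b b' ↦ hom_ext k A fun m a ↦ by
        simp only [rightAux_mk, LinearMap.add_apply, MulOpposite.unop_add, mul_add, mk_add_right]; abel
      map_smul' := fun c b ↦ hom_ext k A fun m a ↦ by
        simp only [rightAux_mk, LinearMap.smul_apply, unop_smul, mul_smul_comm, mk_smul_right,
          smul_sub, RingHom.id_apply] }
    (hom_ext k A fun m a ↦ by
      simp [mk_one])
    (fun b b' ↦ hom_ext k A fun m a ↦ by
      simp only [LinearMap.coe_mk, AddHom.coe_mk, rightAux_mk, Module.End.mul_apply, map_sub,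
        unop_mul, mul_assoc, op_mul, map_mul]
      simp)

@[simp] lemma right_mk (b : Aᵐᵒᵖ) (m : M) (a : A) :
    right k A M b (mk k A m a) =
      mk k A m (a * b.unop) - mk k A (rightMul k A M (op a) m) b.unop := rfl

lemma commute_left_right (a : A) (b : Aᵐᵒᵖ) : Commute (left k A M a) (right k A M b) :=
  hom_ext k A fun m a' ↦ by simp [leftMul_rightMul]

/-- The bimodule structure on `M ⊗ sĀ`. -/
instance : Module (Env k A) (Forms k A M) :=
  moduleOfMul k A (left k A M) (right k A M) (commute_left_right k A M)

instance : IsScalarTower k (Env k A) (Forms k A M) :=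
  moduleOfMul_isScalarTower k A _ _ (commute_left_right k A M)

lemma leftMul_mk (a : A) (m : M) (a' : A) :
    leftMul k A (Forms k A M) a (mk k A m a') = mk k A (leftMul k A M a m) a' := by
  exact (moduleOfMul_left k A _ _ (commute_left_right k A M) _ _).trans (by simp)

lemma rightMul_mk (b : Aᵐᵒᵖ) (m : M) (a : A) :
    rightMul k A (Forms k A M) b (mk k A m a) =
      mk k A m (a * b.unop) - mk k A (rightMul k A M (op a) m) b.unop := by
  exact (moduleOfMul_right k A _ _ (commute_left_right k A M) _ _).trans (by simp)

end Forms

/-- The `k`-module `M ⊗ A` underlying the right-free bimodule on the left module `M`. -/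
def RFree : Type v := M ⊗[k] A

instance : AddCommGroup (RFree k A M) := inferInstanceAs (AddCommGroup (M ⊗[k] A))
instance : Module k (RFree k A M) := inferInstanceAs (Module k (M ⊗[k] A))

namespace RFree

variable {M} in
/-- The element `m ⊗ b`. -/
def mk (m : M) (b : A) : RFree k A M := m ⊗ₜ[k] b

variable {M} in
lemma hom_ext {P : Type*} [AddCommGroup P] [Module k P] {f g : RFree k A M →ₗ[k] P}
    (h : ∀ m a, f (mk k A m a) = g (mk k A m a)) : f = g :=
  TensorProduct.ext' h

section
variable {M}

lemma mk_add_left (m m' : M) (a : A) : mk k A (m + m') a = mk k A m a + mk k A m' a :=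
  TensorProduct.add_tmul _ _ _

lemma mk_smul_left (c : k) (m : M) (a : A) : mk k A (c • m) a = c • mk k A m a := rfl

lemma mk_sub_left (m m' : M) (a : A) : mk k A (m - m') a = mk k A m a - mk k A m' a :=
  TensorProduct.sub_tmul _ _ _

lemma mk_add_right (m : M) (a a' : A) : mk k A m (a + a') = mk k A m a + mk k A m a' :=
  TensorProduct.tmul_add _ _ _

lemma mk_smul_right (c : k) (m : M) (a : A) : mk k A m (c • a) = c • mk k A m a :=
  TensorProduct.tmul_smul _ _ _

variable (M) in
/-- The `k`-linear map `m ↦ m ⊗ 1`. -/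
def unit : M →ₗ[k] RFree k A M where
  toFun m := mk k A m 1
  map_add' m m' := mk_add_left k A m m' 1
  map_smul' c m := mk_smul_left k A c m 1

@[simp] lemma unit_apply (m : M) : unit k A M m = mk k A m 1 := rfl

end

/-- Left multiplication: `a (m ⊗ b) = (a m) ⊗ b`. -/
def left : A →ₐ[k] Module.End k (RFree k A M) :=
  (show Module.End k M →ₐ[k] Module.End k (RFree k A M) from
    Module.End.rTensorAlgHom k M A).comp (leftMul k A M)

/-- Right multiplication: `(m ⊗ b) b' = m ⊗ (b b')`. -/
def right : Aᵐᵒᵖ →ₐ[k] Module.End k (RFree k A M) :=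
  (show Module.End k A →ₐ[k] Module.End k (RFree k A M) from
    Module.End.lTensorAlgHom k A M).comp (Algebra.lsmul k k A)

@[simp] lemma left_mk (a : A) (m : M) (b : A) :
    left k A M a (mk k A m b) = mk k A (leftMul k A M a m) b := rfl

@[simp] lemma right_mk (b' : Aᵐᵒᵖ) (m : M) (b : A) :
    right k A M b' (mk k A m b) = mk k A m (b * b'.unop) := rfl

lemma commute_left_right (a : A) (b : Aᵐᵒᵖ) : Commute (left k A M a) (right k A M b) :=
  hom_ext k A fun m a' ↦ by simp

/-- The bimodule structure on `M ⊗ A`. -/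
instance : Module (Env k A) (RFree k A M) :=
  moduleOfMul k A (left k A M) (right k A M) (commute_left_right k A M)

instance : IsScalarTower k (Env k A) (RFree k A M) :=
  moduleOfMul_isScalarTower k A _ _ (commute_left_right k A M)

lemma leftMul_mk (a : A) (m : M) (b : A) :
    leftMul k A (RFree k A M) a (mk k A m b) = mk k A (leftMul k A M a m) b := by
  exact (moduleOfMul_left k A _ _ (commute_left_right k A M) _ _).trans (by simp)

lemma rightMul_mk (b' : Aᵐᵒᵖ) (m : M) (b : A) :
    rightMul k A (RFree k A M) b' (mk k A m b) = mk k A m (b * b'.unop) := by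
  exact (moduleOfMul_right k A _ _ (commute_left_right k A M) _ _).trans (by simp)

end RFree

@[simp] lemma leftMul_self (a x : A) : leftMul k A A a x = a * x :=
  moduleOfMul_left k A _ _ (commute_lmul_lsmul k A) _ _

@[simp] lemma rightMul_self (b : Aᵐᵒᵖ) (x : A) : rightMul k A A b x = x * b.unop :=
  moduleOfMul_right k A _ _ (commute_lmul_lsmul k A) _ _

section Maps

variable {M} {N : Type v} [AddCommGroup N] [Module k N] [Module (Env k A) N]
  [IsScalarTower k (Env k A) N]

/-- A `k`-linear map commuting with left and right multiplications is a bimodule map. -/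
def bimoduleHom (f : M →ₗ[k] N) (hl : ∀ a m, f (leftMul k A M a m) = leftMul k A N a (f m))
    (hr : ∀ b m, f (rightMul k A M b m) = rightMul k A N b (f m)) : M →ₗ[Env k A] N where
  toFun := f
  map_add' := map_add f
  map_smul' e m := by
    have : f ∘ₗ (Algebra.lsmul k k M : Env k A →ₐ[k] Module.End k M).toLinearMap.flip m =
        (Algebra.lsmul k k N : Env k A →ₐ[k] Module.End k N).toLinearMap.flip (f m) :=
      TensorProduct.ext' fun a b ↦ by
        change f ((a ⊗ₜ[k] b : Env k A) • m) = (a ⊗ₜ[k] b : Env k A) • f m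
        rw [smul_eq, smul_eq, hl, hr]
    exact LinearMap.congr_fun this e

/-- Restriction of a bimodule map `f : M ⊗ A → N` to `M`, `m ↦ f (m ⊗ 1)`. -/
def RFree.restrict (f : RFree k A M →ₗ[Env k A] N) : M →ₗ[k] N :=
  (f.restrictScalars k).comp (RFree.unit k A M)

lemma RFree.restrict_apply (f : RFree k A M →ₗ[Env k A] N) (m : M) :
    RFree.restrict k A f m = f (RFree.mk k A m 1) := rfl

lemma RFree.restrict_leftMul (f : RFree k A M →ₗ[Env k A] N) (a : A) (m : M) :
    RFree.restrict k A f (leftMul k A M a m) = leftMul k A N a (RFree.restrict k A f m) := by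
  rw [restrict_apply, restrict_apply, ← RFree.leftMul_mk, leftMul_apply, map_smul, leftMul_apply]

/-- The `k`-linear map `m ⊗ b ↦ φ(m) b`. -/
def RFree.extendAux (φ : M →ₗ[k] N) : RFree k A M →ₗ[k] N :=
  TensorProduct.lift (LinearMap.mk₂ k (fun m b ↦ rightMul k A N (op b) (φ m))
    (fun m m' b ↦ by simp only [map_add])
    (fun c m b ↦ by simp only [map_smul])
    (fun m b b' ↦ by simp only [MulOpposite.op_add, map_add, LinearMap.add_apply])
    (fun c m b ↦ by simp only [op_smul, map_smul, LinearMap.smul_apply]))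

lemma RFree.extendAux_mk (φ : M →ₗ[k] N) (m : M) (b : A) :
    RFree.extendAux k A φ (RFree.mk k A m b) = rightMul k A N (op b) (φ m) := rfl

lemma RFree.extendAux_left (φ : M →ₗ[k] N)
    (hφ : ∀ a m, φ (leftMul k A M a m) = leftMul k A N a (φ m)) (a : A) (x : RFree k A M) :
    RFree.extendAux k A φ (leftMul k A _ a x) = leftMul k A N a (RFree.extendAux k A φ x) := by
  have : (RFree.extendAux k A φ).comp (leftMul k A _ a) =
      (leftMul k A N a).comp (RFree.extendAux k A φ) := RFree.hom_ext k A fun m b ↦ by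
    rw [LinearMap.comp_apply, LinearMap.comp_apply, RFree.leftMul_mk, RFree.extendAux_mk,
      RFree.extendAux_mk, hφ, leftMul_rightMul]
  exact LinearMap.congr_fun this x

lemma RFree.extendAux_right (φ : M →ₗ[k] N) (b : Aᵐᵒᵖ) (x : RFree k A M) :
    RFree.extendAux k A φ (rightMul k A _ b x) = rightMul k A N b (RFree.extendAux k A φ x) := by
  have : (RFree.extendAux k A φ).comp (rightMul k A _ b) =
      (rightMul k A N b).comp (RFree.extendAux k A φ) := RFree.hom_ext k A fun m b' ↦ by
    rw [LinearMap.comp_apply, LinearMap.comp_apply, RFree.rightMul_mk, RFree.extendAux_mk,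
      RFree.extendAux_mk, op_mul, op_unop, map_mul, Module.End.mul_apply]
  exact LinearMap.congr_fun this x

/-- Extension of a left linear map `φ : M → N` to the bimodule map `M ⊗ A → N`,
`m ⊗ b ↦ φ(m) b`. -/
def RFree.extend (φ : M →ₗ[k] N) (hφ : ∀ a m, φ (leftMul k A M a m) = leftMul k A N a (φ m)) :
    RFree k A M →ₗ[Env k A] N :=
  bimoduleHom k A (RFree.extendAux k A φ) (RFree.extendAux_left k A φ hφ)
    (RFree.extendAux_right k A φ)

@[simp] lemma RFree.extend_mk (φ : M →ₗ[k] N)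
    (hφ : ∀ a m, φ (leftMul k A M a m) = leftMul k A N a (φ m)) (m : M) (b : A) :
    SingHoch.RFree.extend k A φ hφ (RFree.mk k A m b) = rightMul k A N (op b) (φ m) := rfl

lemma RFree.bimodule_hom_ext {f g : RFree k A M →ₗ[Env k A] N}
    (h : ∀ m, f (RFree.mk k A m 1) = g (RFree.mk k A m 1)) : f = g := by
  have key : f.restrictScalars k = g.restrictScalars k := RFree.hom_ext k A fun m b ↦ by
    have := RFree.rightMul_mk k A M (op b) m 1
    rw [unop_op, one_mul, rightMul_apply] at this
    simp only [LinearMap.coe_restrictScalars, ← this, map_smul, h]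
  exact LinearMap.ext fun x ↦ LinearMap.congr_fun key x

variable (M) in
/-- The multiplication map `M ⊗ A → M`, `m ⊗ b ↦ m b`. -/
def act : RFree k A M →ₗ[Env k A] M := SingHoch.RFree.extend k A LinearMap.id (fun _ _ ↦ rfl)

@[simp] lemma act_mk (m : M) (b : A) :
    act k A M (RFree.mk k A m b) = rightMul k A M (op b) m := rfl

variable (M) in
/-- The `k`-linear map underlying `incl`. -/
def inclAux : Forms k A M →ₗ[k] RFree k A M :=
  Forms.lift k A M
    (LinearMap.mk₂ k
      (fun a m ↦ RFree.mk k A m a - RFree.mk k A (rightMul k A M (op a) m) 1)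
      (fun a a' m ↦ by
        simp only [MulOpposite.op_add, map_add, LinearMap.add_apply, RFree.mk_add_left,
          RFree.mk_add_right]
        abel)
      (fun c a m ↦ by
        simp only [op_smul, map_smul, LinearMap.smul_apply, RFree.mk_smul_left,
          RFree.mk_smul_right, smul_sub])
      (fun a m m' ↦ by
        simp only [map_add, RFree.mk_add_left]
        abel)
      (fun c a m ↦ by
        simp only [map_smul, RFree.mk_smul_left, smul_sub]))
    (by ext m; simp)

lemma inclAux_mk (m : M) (a : A) :
    inclAux k A M (Forms.mk k A m a) =
      RFree.mk k A m a - RFree.mk k A (rightMul k A M (op a) m) 1 := rfl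

lemma inclAux_left (a : A) (x : Forms k A M) :
    inclAux k A M (leftMul k A _ a x) = leftMul k A _ a (inclAux k A M x) := by
  have : (inclAux k A M).comp (leftMul k A _ a) = (leftMul k A _ a).comp (inclAux k A M) :=
    Forms.hom_ext k A fun m a' ↦ by
      simp only [LinearMap.comp_apply, Forms.leftMul_mk, inclAux_mk, map_sub, RFree.leftMul_mk,
        leftMul_rightMul]
  exact LinearMap.congr_fun this x

lemma inclAux_right (b : Aᵐᵒᵖ) (x : Forms k A M) :
    inclAux k A M (rightMul k A _ b x) = rightMul k A _ b (inclAux k A M x) := by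
  have : (inclAux k A M).comp (rightMul k A _ b) = (rightMul k A _ b).comp (inclAux k A M) :=
    Forms.hom_ext k A fun m a' ↦ by
      simp only [LinearMap.comp_apply, Forms.rightMul_mk, inclAux_mk, map_sub, RFree.rightMul_mk,
        op_mul, op_unop, map_mul, Module.End.mul_apply, one_mul]
      abel
  exact LinearMap.congr_fun this x

variable (M) in
/-- The bimodule map `M ⊗ sĀ → M ⊗ A`, `m ⊗ s ā ↦ m ⊗ a - m a ⊗ 1`. -/
def incl : Forms k A M →ₗ[Env k A] RFree k A M :=
  bimoduleHom k A (inclAux k A M) (inclAux_left k A) (inclAux_right k A)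

@[simp] lemma incl_mk (m : M) (a : A) :
    incl k A M (Forms.mk k A m a) =
      RFree.mk k A m a - RFree.mk k A (rightMul k A M (op a) m) 1 := rfl

variable (M) in
/-- The `k`-linear projection `M ⊗ A → M ⊗ sĀ`. -/
def proj : RFree k A M →ₗ[k] Forms k A M := LinearMap.lTensor M (red k A)

@[simp] lemma proj_mk (m : M) (a : A) : proj k A M (RFree.mk k A m a) = Forms.mk k A m a := rfl

lemma proj_incl (x : Forms k A M) : proj k A M (incl k A M x) = x := by
  have : (proj k A M).comp ((incl k A M).restrictScalars k) = LinearMap.id :=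
    Forms.hom_ext k A fun m a ↦ by simp [Forms.mk_one]
  exact LinearMap.congr_fun this x

lemma incl_injective : Function.Injective (incl k A M) :=
  Function.LeftInverse.injective (proj_incl k A)

lemma incl_proj (x : RFree k A M) :
    incl k A M (proj k A M x) = x - RFree.unit k A M (act k A M x) := by
  have : ((incl k A M).restrictScalars k).comp (proj k A M) =
      LinearMap.id - (RFree.unit k A M).comp ((act k A M).restrictScalars k) :=
    RFree.hom_ext k A fun m a ↦ by
      simp only [LinearMap.comp_apply, proj_mk, LinearMap.coe_restrictScalars, incl_mk,
        LinearMap.sub_apply, LinearMap.id_apply, act_mk, RFree.unit_apply]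
  exact LinearMap.congr_fun this x

lemma act_surjective : Function.Surjective (act k A M) := fun m ↦
  ⟨RFree.mk k A m 1, by simp⟩

lemma act_incl (x : Forms k A M) : act k A M (incl k A M x) = 0 := by
  have : ((act k A M).restrictScalars k).comp ((incl k A M).restrictScalars k) = 0 :=
    Forms.hom_ext k A fun m a ↦ by simp
  exact LinearMap.congr_fun this x

lemma exact_incl_act : Function.Exact (incl k A M) (act k A M) := fun x ↦ by
  refine ⟨fun hx ↦ ⟨proj k A M x, ?_⟩, ?_⟩
  · rw [incl_proj, hx, map_zero, sub_zero]
  · rintro ⟨y, rfl⟩; exact act_incl k A y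

/-- `φ ⊗ id : M ⊗ sĀ → N ⊗ sĀ`. -/
def Forms.map (φ : M →ₗ[k] N) : Forms k A M →ₗ[k] Forms k A N := LinearMap.rTensor (Red k A) φ

@[simp] lemma Forms.map_mk (φ : M →ₗ[k] N) (m : M) (a : A) :
    Forms.map k A φ (Forms.mk k A m a) = Forms.mk k A (φ m) a := rfl

lemma Forms.map_leftMul (φ : M →ₗ[k] N)
    (hφ : ∀ a m, φ (leftMul k A M a m) = leftMul k A N a (φ m)) (a : A) (x : Forms k A M) :
    Forms.map k A φ (leftMul k A _ a x) = leftMul k A _ a (Forms.map k A φ x) := by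
  have : (Forms.map k A φ).comp (leftMul k A _ a) = (leftMul k A _ a).comp (Forms.map k A φ) :=
    Forms.hom_ext k A fun m a' ↦ by simp [Forms.leftMul_mk, hφ]
  exact LinearMap.congr_fun this x

/-- `f ↦ f ⊗ id_{sĀ}`: for `f : M ⊗ A → N`, i.e. for the left linear map
`m ↦ f (m ⊗ 1)`, the bimodule map `(M ⊗ sĀ) ⊗ A → N ⊗ sĀ` extending `m ⊗ s ā ↦ f (m ⊗ 1) ⊗ s ā`. -/
def tensorId (f : RFree k A M →ₗ[Env k A] N) :
    RFree k A (Forms k A M) →ₗ[Env k A] Forms k A N :=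
  SingHoch.RFree.extend k A (Forms.map k A (RFree.restrict k A f))
    (Forms.map_leftMul k A _ (RFree.restrict_leftMul k A f))

lemma tensorId_mk (f : RFree k A M →ₗ[Env k A] N) (m : M) (a b : A) :
    tensorId k A f (RFree.mk k A (Forms.mk k A m a) b) =
      rightMul k A _ (op b) (Forms.mk k A (f (RFree.mk k A m 1)) a) := rfl

lemma tensorId_mk_one (f : RFree k A M →ₗ[Env k A] N) (m : M) (a : A) :
    tensorId k A f (RFree.mk k A (Forms.mk k A m a) 1) =
      Forms.mk k A (f (RFree.mk k A m 1)) a := by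
  rw [tensorId_mk]; simp

lemma map_mk_eq (f : RFree k A M →ₗ[Env k A] N) (m : M) (b : A) :
    f (RFree.mk k A m b) = rightMul k A N (op b) (f (RFree.mk k A m 1)) := by
  rw [rightMul_apply, ← map_smul, ← rightMul_apply, RFree.rightMul_mk, one_mul, unop_op]

lemma Forms.hom_ext₂ {P : Type*} [AddCommGroup P] [Module k P]
    {f g : Forms k A (Forms k A M) →ₗ[k] P}
    (h : ∀ m a a', f (mk k A (mk k A m a) a') = g (mk k A (mk k A m a) a')) : f = g := by
  refine hom_ext k A fun y a' ↦ ?_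
  have : f.comp (mkₗ k A (Forms k A M) a') = g.comp (mkₗ k A (Forms k A M) a') :=
    hom_ext k A fun m a ↦ h m a a'
  exact LinearMap.congr_fun this y

lemma tensorId_comp (f : RFree k A M →ₗ[Env k A] N) :
    tensorId k A (f ∘ₗ incl k A M ∘ₗ act k A (Forms k A M)) =
      -(tensorId k A f ∘ₗ incl k A (Forms k A M) ∘ₗ act k A (Forms k A (Forms k A M))) := by
  have : RFree.restrict k A (tensorId k A (f ∘ₗ incl k A M ∘ₗ act k A (Forms k A M))) =
      RFree.restrict k A (-(tensorId k A f ∘ₗ incl k A (Forms k A M) ∘ₗ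
        act k A (Forms k A (Forms k A M)))) := by
    refine Forms.hom_ext₂ k A fun m a a' ↦ ?_
    simp only [RFree.restrict_apply, LinearMap.comp_apply, LinearMap.neg_apply,
      act_mk, op_one, map_one, Module.End.one_apply, incl_mk, map_sub, tensorId_mk,
      Forms.rightMul_mk, unop_op, map_mk_eq k A f m a, RFree.mk_sub_left, Forms.mk_sub_left]
    abel
  exact RFree.bimodule_hom_ext k A fun x ↦ LinearMap.congr_fun this x

end Maps

end Bimodules

section BarConstruction

variable (k : Type u) (A : Type v) [Field k] [Ring A] [Algebra k A]

/-- Bundled bimodules, with their underlying `k`-module recorded. -/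
structure Bimod where
  /-- the underlying type -/
  X : Type v
  [addCommGroup : AddCommGroup X]
  [module : Module k X]
  [bimodule : Module (Env k A) X]
  [isScalarTower : IsScalarTower k (Env k A) X]

attribute [instance] Bimod.addCommGroup Bimod.module Bimod.bimodule Bimod.isScalarTower

/-- The bimodule `A ⊗ (sĀ)^{⊗ p}` of noncommutative differential `p`-forms, as the iterated tensor
product `(⋯ ((A ⊗ sĀ) ⊗ sĀ) ⋯) ⊗ sĀ`. Unfolding the recursion
`(ω ⊗ s ā) ◂ b = ω ⊗ s (ab)‾ - (ω ◂ a) ⊗ s b̄` of the right action gives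
`(a₀ ⊗ s ā₁ ⊗ ⋯ ⊗ s ā_p) ◂ b = ∑ᵢ (-1)^(p-i) a₀ ⊗ ⋯ ⊗ s (aᵢ aᵢ₊₁)‾ ⊗ ⋯ ⊗ s ā_{p+1}`, `a_{p+1} = b`. -/
def formsBimod : ℕ → Bimod k A
  | 0 => ⟨A⟩
  | p + 1 => ⟨Forms k A (formsBimod p).X⟩

/-- The bimodule `Ω^p` of noncommutative differential `p`-forms. -/
abbrev Ω (p : ℕ) : ModuleCat.{v} (Env k A) := ModuleCat.of (Env k A) (formsBimod k A p).X

/-- The bimodule `A ⊗ (sĀ)^{⊗ n} ⊗ A`. -/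
abbrev Bar (n : ℕ) : ModuleCat.{v} (Env k A) :=
  ModuleCat.of (Env k A) (RFree k A (formsBimod k A n).X)

/-- The bimodule map `Ω^{n+1} → A ⊗ (sĀ)^{⊗ n} ⊗ A`, `ω ⊗ s ā ↦ ω ⊗ a - (ω ◂ a) ⊗ 1`. -/
def barIncl (n : ℕ) : Ω k A (n + 1) ⟶ Bar k A n := ModuleCat.ofHom (incl k A (formsBimod k A n).X)

/-- The bimodule map `A ⊗ (sĀ)^{⊗ n} ⊗ A → Ω^n`, `ω ⊗ b ↦ ω ◂ b`. -/
def barAct (n : ℕ) : Bar k A n ⟶ Ω k A n := ModuleCat.ofHom (act k A (formsBimod k A n).X)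

lemma barIncl_barAct (n : ℕ) : barIncl k A n ≫ barAct k A n = 0 := by
  ext x
  exact act_incl k A x

lemma barIncl_injective (n : ℕ) : Function.Injective (barIncl k A n).hom := incl_injective k A

lemma barAct_surjective (n : ℕ) : Function.Surjective (barAct k A n).hom := act_surjective k A

lemma exact_barIncl_barAct (n : ℕ) : Function.Exact (barIncl k A n).hom (barAct k A n).hom :=
  exact_incl_act k A

/-- The differential of the normalized bar complex; see `barD_mk` for its values: it is the usual
`a₀ ⊗ ⋯ ⊗ aₙ₊₂ ↦ ∑ᵢ (-1)^i a₀ ⊗ ⋯ ⊗ aᵢ aᵢ₊₁ ⊗ ⋯ ⊗ aₙ₊₂`. -/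
def barD (n : ℕ) : Bar k A (n + 1) ⟶ Bar k A n :=
  ((-1 : ℤ) ^ (n + 1)) • (barAct k A (n + 1) ≫ barIncl k A n)

lemma barD_comp (n : ℕ) : barD k A (n + 1) ≫ barD k A n = 0 := by
  have : barIncl k A (n + 1) ≫ barAct k A (n + 1) ≫ barIncl k A n = 0 := by
    rw [← Category.assoc, barIncl_barAct, Limits.zero_comp]
  simp only [barD, Preadditive.zsmul_comp, Preadditive.comp_zsmul, Category.assoc, this,
    Limits.comp_zero, smul_zero]

/-- The normalized bar complex, `A ⊗ (sĀ)^{⊗ n} ⊗ A` in degree `n`. -/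
def barComplex : ChainComplex (ModuleCat.{v} (Env k A)) ℕ :=
  ChainComplex.of (Bar k A) (barD k A) (barD_comp k A)

lemma barComplex_d (n : ℕ) : (barComplex k A).d (n + 1) n = barD k A n :=
  ChainComplex.of_d _ _ _

lemma barD_apply (n : ℕ) (x : Bar k A (n + 1)) :
    (barD k A n).hom x = ((-1 : ℤ) ^ (n + 1)) • (barIncl k A n).hom ((barAct k A (n + 1)).hom x) :=
  rfl

lemma barD_mk (n : ℕ) (ω : (formsBimod k A n).X) (a b : A) :
    (barD k A n).hom (RFree.mk k A (Forms.mk k A ω a) b) = ((-1 : ℤ) ^ (n + 1)) •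
      (RFree.mk k A ω (a * b) - RFree.mk k A (rightMul k A _ (op a) ω) b) := by
  refine (barD_apply k A n _).trans (congrArg _ ?_)
  change incl k A _ (act k A _ (RFree.mk k A (Forms.mk k A ω a) b)) = _
  rw [act_mk, Forms.rightMul_mk, map_sub, incl_mk, incl_mk]
  simp only [op_mul, unop_op, map_mul, Module.End.mul_apply]
  abel

lemma neg_one_pow_smul_smul {V : Type*} [AddCommGroup V] (n : ℕ) (x : V) :
    ((-1 : ℤ) ^ n) • ((-1 : ℤ) ^ n) • x = x := by
  rw [smul_smul, ← mul_pow]; simp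

lemma exact_barD_barAct (n : ℕ) : Function.Exact (barD k A n).hom (barAct k A n).hom := by
  intro x
  rw [exact_barIncl_barAct k A n x]
  constructor
  · rintro ⟨y, rfl⟩
    obtain ⟨z, rfl⟩ := barAct_surjective k A (n + 1) y
    refine ⟨((-1 : ℤ) ^ (n + 1)) • z, ?_⟩
    rw [barD_apply, map_zsmul, map_zsmul, neg_one_pow_smul_smul]
  · rintro ⟨z, rfl⟩
    refine ⟨((-1 : ℤ) ^ (n + 1)) • (barAct k A (n + 1)).hom z, ?_⟩
    rw [map_zsmul, barD_apply]

lemma exact_barD_barD (n : ℕ) : Function.Exact (barD k A (n + 1)).hom (barD k A n).hom := by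
  intro x
  rw [← exact_barD_barAct k A (n + 1) x, barD_apply]
  constructor
  · intro h
    have := congrArg (((-1 : ℤ) ^ (n + 1)) • ·) h
    simp only [neg_one_pow_smul_smul, smul_zero] at this
    exact barIncl_injective k A n (this.trans (map_zero _).symm)
  · intro h
    rw [h, map_zero, smul_zero]

lemma barD_barAct (n : ℕ) : barD k A n ≫ barAct k A n = 0 := by
  ext x
  exact (exact_barD_barAct k A n _).2 ⟨x, rfl⟩

lemma barComplex_exactAt (n : ℕ) : (barComplex k A).ExactAt (n + 1) := by
  rw [HomologicalComplex.exactAt_iff' _ (n + 1 + 1) (n + 1) n (by simp) (by simp),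
    ShortComplex.ShortExact.moduleCat_exact_iff_function_exact]
  have h₁ := barComplex_d k A (n + 1)
  have h₂ := barComplex_d k A n
  change Function.Exact ((barComplex k A).d (n + 1 + 1) (n + 1)).hom
    ((barComplex k A).d (n + 1) n).hom
  rw [h₁, h₂]
  exact exact_barD_barD k A n

/-- Projectivity of `M` as a left `A`-module, as a lifting property for left linear maps against
surjective bimodule maps. -/
def LeftProj (M : Type v) [AddCommGroup M] [Module k M] [Module (Env k A) M]
    [IsScalarTower k (Env k A) M] : Prop :=
  ∀ (N P : Bimod.{u, v} k A) (g : N.X →ₗ[Env k A] P.X) (_ : Function.Surjective g)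
    (φ : M →ₗ[k] P.X) (_ : ∀ a m, φ (leftMul k A M a m) = leftMul k A P.X a (φ m)),
    ∃ (ψ : M →ₗ[k] N.X) (_ : ∀ a m, ψ (leftMul k A M a m) = leftMul k A N.X a (ψ m)),
      ∀ m, g (ψ m) = φ m

lemma leftProj_self : LeftProj k A A := by
  intro N P g hg φ hφ
  obtain ⟨n, hn⟩ := hg (φ 1)
  refine ⟨(leftMul k A N.X).toLinearMap.flip n, fun a m ↦ ?_, fun m ↦ ?_⟩
  · simp
  · have := hφ m 1
    rw [leftMul_self, mul_one] at this
    rw [this, ← hn, leftMul_apply, ← map_smul]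
    rfl

lemma leftProj_forms (M : Type v) [AddCommGroup M] [Module k M] [Module (Env k A) M]
    [IsScalarTower k (Env k A) M] (hM : LeftProj k A M) : LeftProj k A (Forms k A M) := by
  intro N P g hg φ hφ
  let b := Module.Basis.ofVectorSpace k (Red k A)
  choose r hr using fun i ↦ Submodule.mkQ_surjective _ (b i)
  have h : ∀ i, ∃ (ψ : M →ₗ[k] N.X) (_ : ∀ a m, ψ (leftMul k A M a m) = leftMul k A N.X a (ψ m)),
      ∀ m, g (ψ m) = φ (Forms.mk k A m (r i)) := fun i ↦
    hM N P g hg (φ.comp (Forms.mkₗ k A M (r i))) (fun a m ↦ by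
      rw [LinearMap.comp_apply, LinearMap.comp_apply, ← hφ]
      exact congrArg φ (Forms.leftMul_mk k A M a m (r i)).symm)
  choose ψ hψ hgψ using h
  let Ψ : Forms k A M →ₗ[k] N.X := TensorProduct.lift (b.constr k ψ).flip
  have hΨ : ∀ i m, Ψ (Forms.mk k A m (r i)) = ψ i m := fun i m ↦ by
    change b.constr k ψ (red k A (r i)) m = _
    rw [show red k A (r i) = b i from hr i, b.constr_basis]
  have ext : ∀ (Q : Bimod.{u, v} k A) (f f' : Forms k A M →ₗ[k] Q.X),
      (∀ i m, f (Forms.mk k A m (r i)) = f' (Forms.mk k A m (r i))) → f = f' := by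
    intro Q f f' hf
    refine TensorProduct.ext (LinearMap.ext fun m ↦ b.ext fun i ↦ ?_)
    have := hf i m
    unfold Forms.mk at this
    rw [show red k A (r i) = b i from hr i] at this
    exact this
  refine ⟨Ψ, fun a x ↦ ?_, fun x ↦ ?_⟩
  · have : Ψ.comp (leftMul k A _ a) = (leftMul k A _ a).comp Ψ := ext N _ _ fun i m ↦ by
      rw [LinearMap.comp_apply, LinearMap.comp_apply, Forms.leftMul_mk, hΨ, hΨ, hψ]
    exact LinearMap.congr_fun this x
  · have : (g.restrictScalars k).comp Ψ = φ := ext P _ _ fun i m ↦ by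
      rw [LinearMap.comp_apply, hΨ, LinearMap.coe_restrictScalars, hgψ]
    exact LinearMap.congr_fun this x

lemma leftProj_formsBimod (n : ℕ) : LeftProj k A (formsBimod k A n).X := by
  induction n with
  | zero => exact leftProj_self k A
  | succ n ih => exact leftProj_forms k A _ ih

section

open scoped ModuleCat

instance (n : ℕ) : Projective (Bar k A n) where
  factors {E X} f e he := by
    have := (ModuleCat.epi_iff_surjective e).1 he
    obtain ⟨ψ, hψ, h⟩ := leftProj_formsBimod k A n ⟨E⟩ ⟨X⟩ e.hom this
      (RFree.restrict k A f.hom) (RFree.restrict_leftMul k A f.hom)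
    refine ⟨ModuleCat.ofHom (SingHoch.RFree.extend k A ψ hψ), ModuleCat.hom_ext ?_⟩
    refine RFree.bimodule_hom_ext k A fun m ↦ ?_
    rw [ModuleCat.hom_comp, LinearMap.comp_apply, ModuleCat.hom_ofHom, RFree.extend_mk, op_one,
      map_one, Module.End.one_apply]
    exact h m

end

instance (n : ℕ) : Projective ((barComplex k A).X n) := inferInstanceAs (Projective (Bar k A n))

/-- The augmentation `A ⊗ A → A`, from the bar complex to `A`. -/
def barAugmentation : (barComplex k A).X 0 ⟶ Ω k A 0 := barAct k A 0

lemma barAugmentation_eq : barAugmentation k A = barAct k A 0 := rfl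

lemma d_barAugmentation : (barComplex k A).d 1 0 ≫ barAugmentation k A = 0 := by
  have := barD_barAct k A 0
  rw [← barComplex_d] at this
  exact this

lemma exact_d_barAugmentation :
    (ShortComplex.mk _ _ (d_barAugmentation k A)).Exact := by
  rw [ShortComplex.ShortExact.moduleCat_exact_iff_function_exact]
  have h := barComplex_d k A 0
  change Function.Exact ((barComplex k A).d (0 + 1) 0).hom (barAct k A 0).hom
  rw [h]
  exact exact_barD_barAct k A 0

instance : Epi (barAugmentation k A) :=
  (ModuleCat.epi_iff_surjective _).2 (barAct_surjective k A 0)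

/-- The normalized bar resolution of the bimodule `A`. -/
def barResolution : ProjectiveResolution (Ω k A 0) where
  complex := barComplex k A
  π := (ChainComplex.toSingle₀Equiv _ _).symm ⟨barAugmentation k A, d_barAugmentation k A⟩
  quasiIso := ⟨fun n => by
    cases n
    · rw [ChainComplex.quasiIsoAt₀_iff, ShortComplex.quasiIso_iff_of_zeros']
      · refine (ShortComplex.exact_and_epi_g_iff_of_iso ?_).2
          ⟨exact_d_barAugmentation k A, by dsimp; infer_instance⟩
        exact ShortComplex.isoMk (Iso.refl _) (Iso.refl _) (Iso.refl _)
          ((Category.id_comp _).trans (Category.comp_id _).symm)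
          ((Category.id_comp _).trans (Category.comp_id _).symm)
      all_goals rfl
    · rw [quasiIsoAt_iff_exactAt']
      · apply barComplex_exactAt
      · apply ChainComplex.exactAt_succ_single_obj⟩

end BarConstruction

section Cochains
variable (k : Type u) (A : Type v) [Field k] [Ring A] [Algebra k A]

/-- The `k`-module of bimodule maps `A ⊗ (sĀ)^{⊗ n} ⊗ A → Ω^p`, which is the module of `k`-linear
maps `(sĀ)^{⊗ n} → Ω^p`. -/
def BarHom (n p : ℕ) : Type v := Bar k A n ⟶ Ω k A p

instance (n p : ℕ) : AddCommGroup (BarHom k A n p) :=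
  inferInstanceAs (AddCommGroup (Bar k A n ⟶ Ω k A p))

instance (n p : ℕ) : Module k (BarHom k A n p) :=
  Linear.homModule (R := k) (C := ModuleCat.{v} (Env k A)) (Bar k A n) (Ω k A p)

variable {k A} in
/-- The underlying bimodule map. -/
def BarHom.hom {n p : ℕ} (f : BarHom k A n p) : Bar k A n ⟶ Ω k A p := f

lemma BarHom.add_apply {n p : ℕ} (f g : BarHom k A n p) (x : Bar k A n) :
    (f + g).hom.hom x = f.hom.hom x + g.hom.hom x := rfl

lemma BarHom.smul_apply {n p : ℕ} (c : k) (f : BarHom k A n p) (x : Bar k A n) :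
    (c • f).hom.hom x = c • f.hom.hom x :=
  algebraMap_smul (Env k A) c (f.hom.hom x)

lemma BarHom.ext_mk_one {n p : ℕ} {f g : BarHom k A (n + 1) p}
    (h : ∀ ω a, f.hom.hom (RFree.mk k A (Forms.mk k A ω a) 1) =
      g.hom.hom (RFree.mk k A (Forms.mk k A ω a) 1)) : f = g := by
  refine ModuleCat.hom_ext (RFree.bimodule_hom_ext k A fun y ↦ ?_)
  have : RFree.restrict k A f.hom.hom = RFree.restrict k A g.hom.hom := Forms.hom_ext k A h
  exact LinearMap.congr_fun this y

/-- The map underlying `barTensorId`. -/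
def tensorHom {n p : ℕ} (f : BarHom k A n p) : BarHom k A (n + 1) (p + 1) :=
  ModuleCat.ofHom (tensorId k A f.hom.hom)

lemma tensorHom_apply {n p : ℕ} (f : BarHom k A n p) (ω : (formsBimod k A n).X) (a : A) :
    (tensorHom k A f).hom.hom (RFree.mk k A (Forms.mk k A ω a) 1) =
      Forms.mk k A (f.hom.hom (RFree.mk k A ω 1)) a :=
  tensorId_mk_one k A f.hom.hom ω a

/-- `f ↦ f ⊗ id_{sĀ}`, sending `f` to the bimodule map with
`(ω ⊗ s ā) ⊗ 1 ↦ f (ω ⊗ 1) ⊗ s ā`. -/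
def barTensorId (n p : ℕ) : BarHom k A n p →ₗ[k] BarHom k A (n + 1) (p + 1) where
  toFun f := tensorHom k A f
  map_add' f g := BarHom.ext_mk_one k A fun ω a ↦ by
    rw [BarHom.add_apply, tensorHom_apply, tensorHom_apply, tensorHom_apply, BarHom.add_apply]
    exact Forms.mk_add_left k A _ _ a
  map_smul' c f := BarHom.ext_mk_one k A fun ω a ↦ by
    rw [RingHom.id_apply, BarHom.smul_apply, tensorHom_apply, tensorHom_apply, BarHom.smul_apply]
    exact Forms.mk_smul_left k A c _ a

/-- Precomposition with the differential of the bar complex. -/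
def barPrecomp (n p : ℕ) : BarHom k A n p →ₗ[k] BarHom k A (n + 1) p :=
  Linear.leftComp k (Ω k A p) (barD k A n)

lemma barPrecomp_apply (n p : ℕ) (f : BarHom k A n p) (x : Bar k A (n + 1)) :
    (barPrecomp k A n p f).hom.hom x = f.hom.hom ((barD k A n).hom x) := rfl

lemma barPrecomp_barPrecomp (n p : ℕ) (f : BarHom k A n p) :
    barPrecomp k A (n + 1) p (barPrecomp k A n p f) = 0 :=
  (Category.assoc (barD k A (n + 1)) (barD k A n) f.hom).symm.trans
    ((congrArg (· ≫ f.hom) (barD_comp k A n)).trans Limits.zero_comp)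

/-- Precomposition with the differential of the bar complex, without its sign. -/
def precompInclAct {n p : ℕ} (f : BarHom k A n p) : BarHom k A (n + 1) p :=
  barAct k A (n + 1) ≫ barIncl k A n ≫ f.hom

lemma barPrecomp_eq {n p : ℕ} (f : BarHom k A n p) :
    barPrecomp k A n p f = ((-1 : ℤ) ^ (n + 1)) • precompInclAct k A f :=
  (Preadditive.zsmul_comp (barAct k A (n + 1) ≫ barIncl k A n) f.hom ((-1 : ℤ) ^ (n + 1))).trans
    (congrArg (((-1 : ℤ) ^ (n + 1)) • ·)
      (Category.assoc (barAct k A (n + 1)) (barIncl k A n) f.hom))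

lemma tensorHom_precompInclAct {n p : ℕ} (f : BarHom k A n p) :
    tensorHom k A (precompInclAct k A f) = -precompInclAct k A (tensorHom k A f) :=
  ModuleCat.hom_ext (tensorId_comp k A f.hom.hom)

lemma barTensorId_barPrecomp (n p : ℕ) (f : BarHom k A n p) :
    barTensorId k A (n + 1) p (barPrecomp k A n p f) =
      barPrecomp k A (n + 1) (p + 1) (barTensorId k A n p f) := by
  have h : barTensorId k A (n + 1) p (precompInclAct k A f) =
      -precompInclAct k A (barTensorId k A n p f) := tensorHom_precompInclAct k A f
  rw [barPrecomp_eq, barPrecomp_eq, map_zsmul, h, pow_succ _ (n + 1), mul_neg_one, neg_smul,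
    smul_neg]

/-- The `k`-module `C^m(A, Ω^p)` of normalized Hochschild cochains of degree `m` with coefficients
in `Ω^p`, which is placed in degree `-p`: it consists of the bimodule maps
`A ⊗ (sĀ)^{⊗ n} ⊗ A → Ω^p` with `n = m + p`, i.e. of the `k`-linear maps `(sĀ)^{⊗ n} → Ω^p`
(there are none but zero if `m + p < 0`). -/
abbrev Cochains (p : ℕ) (m : ℤ) : Type v :=
  ∀ n : {n : ℕ // (n : ℤ) = m + p}, BarHom k A n.1 p

/-- The component of a cochain. -/
def Cochains.eval (p : ℕ) (m : ℤ) (n : ℕ) (hn : (n : ℤ) = m + p) :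
    Cochains k A p m →ₗ[k] BarHom k A n p :=
  LinearMap.proj (φ := fun n : {n : ℕ // (n : ℤ) = m + p} ↦ BarHom k A n.1 p) ⟨n, hn⟩

/-- The components of `cochainsD`. -/
def cochainsDAux (p : ℕ) (m m' : ℤ) (h : m + 1 = m') :
    ∀ n : ℕ, (n : ℤ) = m' + p → (Cochains k A p m →ₗ[k] BarHom k A n p)
  | 0, _ => 0
  | n + 1, hn => (m'.negOnePow : ℤ) •
      (barPrecomp k A n p).comp (Cochains.eval k A p m n (by push_cast at hn; lia))

/-- The differential `δ f = (-1)^{m+1} f ∘ d` of `C^*(A, Ω^p)`, with `m' = m + 1`. -/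
def cochainsD (p : ℕ) (m m' : ℤ) (h : m + 1 = m') : Cochains k A p m →ₗ[k] Cochains k A p m' :=
  LinearMap.pi fun n ↦ cochainsDAux k A p m m' h n.1 n.2

lemma cochainsD_succ (p : ℕ) (m m' : ℤ) (h : m + 1 = m') (f : Cochains k A p m)
    (n : ℕ) (hn : (n : ℤ) = m + p) (hn' : ((n + 1 : ℕ) : ℤ) = m' + p) :
    cochainsD k A p m m' h f ⟨n + 1, hn'⟩ =
      (m'.negOnePow : ℤ) • barPrecomp k A n p (f ⟨n, hn⟩) := rfl

lemma cochainsD_zero (p : ℕ) (m m' : ℤ) (h : m + 1 = m') (f : Cochains k A p m)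
    (hn' : ((0 : ℕ) : ℤ) = m' + p) : cochainsD k A p m m' h f ⟨0, hn'⟩ = 0 := rfl

lemma cochainsD_comp (p : ℕ) (m m' m'' : ℤ) (h : m + 1 = m') (h' : m' + 1 = m'')
    (f : Cochains k A p m) : cochainsD k A p m' m'' h' (cochainsD k A p m m' h f) = 0 := by
  funext ⟨n, hn⟩
  match n, hn with
  | 0, hn => rfl
  | 1, hn =>
    rw [cochainsD_succ _ _ _ _ _ _ _ 0 (by lia), cochainsD_zero, map_zero, smul_zero]
    rfl
  | n + 2, hn =>
    rw [cochainsD_succ _ _ _ _ _ _ _ (n + 1) (by lia), cochainsD_succ _ _ _ _ _ _ _ n (by lia),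
      map_zsmul, barPrecomp_barPrecomp, smul_zero, smul_zero]
    rfl

/-- The normalized Hochschild cochain complex `C^*(A, Ω^p)`; for `p = 0` this is `C^*(A, A)`. -/
def hochComplex (p : ℕ) : CochainComplex (ModuleCat.{v} k) ℤ where
  X m := ModuleCat.of k (Cochains k A p m)
  d m m' := if h : m + 1 = m' then ModuleCat.ofHom (cochainsD k A p m m' h) else 0
  shape m m' h := dif_neg h
  d_comp_d' m m' m'' h h' := by
    have h : m + 1 = m' := h
    have h' : m' + 1 = m'' := h'
    rw [dif_pos h, dif_pos h']
    ext f : 2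
    exact cochainsD_comp k A p m m' m'' h h' f

/-- The components of `thetaMap`. -/
def thetaAux (p : ℕ) (m : ℤ) :
    ∀ n : ℕ, (n : ℤ) = m + (p + 1 : ℕ) → (Cochains k A p m →ₗ[k] BarHom k A n (p + 1))
  | 0, _ => 0
  | n + 1, hn => (barTensorId k A n p).comp (Cochains.eval k A p m n (by push_cast at hn; lia))

/-- The map `θ_p : C^m(A, Ω^p) → C^m(A, Ω^{p+1})`, `f ↦ f ⊗ id_{sĀ}`. -/
def thetaMap (p : ℕ) (m : ℤ) : Cochains k A p m →ₗ[k] Cochains k A (p + 1) m :=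
  LinearMap.pi fun n ↦ thetaAux k A p m n.1 n.2

lemma thetaMap_succ (p : ℕ) (m : ℤ) (f : Cochains k A p m)
    (n : ℕ) (hn : (n : ℤ) = m + p) (hn' : ((n + 1 : ℕ) : ℤ) = m + (p + 1 : ℕ)) :
    thetaMap k A p m f ⟨n + 1, hn'⟩ = barTensorId k A n p (f ⟨n, hn⟩) := rfl

lemma thetaMap_zero (p : ℕ) (m : ℤ) (f : Cochains k A p m)
    (hn' : ((0 : ℕ) : ℤ) = m + (p + 1 : ℕ)) : thetaMap k A p m f ⟨0, hn'⟩ = 0 := rfl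

lemma thetaMap_cochainsD (p : ℕ) (m m' : ℤ) (h : m + 1 = m') (f : Cochains k A p m) :
    cochainsD k A (p + 1) m m' h (thetaMap k A p m f) =
      thetaMap k A p m' (cochainsD k A p m m' h f) := by
  funext ⟨n, hn⟩
  match n, hn with
  | 0, hn => rfl
  | 1, hn =>
    rw [cochainsD_succ _ _ _ _ _ _ _ 0 (by lia), thetaMap_succ _ _ _ _ _ 0 (by lia),
      cochainsD_zero, thetaMap_zero, map_zero, smul_zero, map_zero]
  | n + 2, hn =>
    rw [cochainsD_succ _ _ _ _ _ _ _ (n + 1) (by lia), thetaMap_succ _ _ _ _ _ n (by lia),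
      thetaMap_succ _ _ _ _ _ (n + 1) (by lia), cochainsD_succ _ _ _ _ _ _ _ n (by lia),
      map_zsmul, barTensorId_barPrecomp]

/-- The chain map `θ_p : C^*(A, Ω^p) ⟶ C^*(A, Ω^{p+1})`, `f ↦ f ⊗ id_{sĀ}`. -/
def theta (p : ℕ) : hochComplex k A p ⟶ hochComplex k A (p + 1) where
  f m := ModuleCat.ofHom (thetaMap k A p m)
  comm' m m' h := by
    have h : m + 1 = m' := h
    dsimp only [hochComplex]
    rw [dif_pos h, dif_pos h]
    ext f : 2
    exact thetaMap_cochainsD k A p m m' h f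

/-- The singular Hochschild cochain complex of `A`: the colimit of
`C^*(A, A) → C^*(A, Ω^1) → C^*(A, Ω^2) → ⋯` along the maps `θ_p`. -/
def singCochainComplex : CochainComplex (ModuleCat.{v} k) ℤ :=
  Limits.colimit (Functor.ofSequence (theta k A))

/-- The Hochschild cohomology `HH^m(A, Ω^p)`; for `p = 0` this is `HH^m(A, A)`. -/
abbrev HH (p : ℕ) (m : ℤ) : ModuleCat.{v} k := (hochComplex k A p).homology m
/-- The cohomology `HH_sg^m(A, A)` of the singular Hochschild cochain complex. -/
abbrev HHsg (m : ℤ) : ModuleCat.{v} k := (singCochainComplex k A).homology m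

/-- The structure map `C^*(A, Ω^p) → C_sg^*(A, A)` of the colimit. -/
def toSingCochainComplex (p : ℕ) : hochComplex k A p ⟶ singCochainComplex k A :=
  Limits.colimit.ι (Functor.ofSequence (theta k A)) p

/-- The map `HH^m(A, Ω^p) → HH_sg^m(A, A)`; for `p = 0` this is the natural map
`ρ : HH^m(A, A) → HH_sg^m(A, A)`. -/
def toHHsg (p : ℕ) (m : ℤ) : HH k A p m ⟶ HHsg k A m :=
  HomologicalComplex.homologyMap (toSingCochainComplex k A p) m

end Cochains

section Sing

open Pretriangulated DerivedCategory Limits ZeroObject CochainComplex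

variable (R : Type v) [Ring R] [HasDerivedCategory.{w} (ModuleCat.{v} R)]

/-- The objects of the derived category of left `R`-modules with bounded and degreewise finitely
generated cohomology. For `R` Noetherian they form the bounded derived category of finitely
generated left `R`-modules. -/
def dbProp : ObjectProperty (DerivedCategory (ModuleCat.{v} R)) := fun X ↦
  (∃ a b : ℤ, ∀ n : ℤ, (n < a ∨ b < n) →
    Limits.IsZero ((homologyFunctor (ModuleCat.{v} R) n).obj X)) ∧
  ∀ n : ℤ, Module.Finite R ((homologyFunctor (ModuleCat.{v} R) n).obj X)

/-- The perfect complexes: those isomorphic in the derived category to a bounded complex of finitely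
generated projective modules. -/
def perf : ObjectProperty (DerivedCategory (ModuleCat.{v} R)) := fun X ↦
  ∃ K : CochainComplex (ModuleCat.{v} R) ℤ, Nonempty (X ≅ Q.obj K) ∧
    (∃ a b : ℤ, K.IsStrictlyGE a ∧ K.IsStrictlyLE b) ∧
    ∀ n : ℤ, Module.Projective R (K.X n) ∧ Module.Finite R (K.X n)

instance : (dbProp R).IsClosedUnderIsomorphisms where
  of_iso e h := by
    obtain ⟨⟨a, b, h₁⟩, h₂⟩ := h
    refine ⟨⟨a, b, fun n hn ↦ (h₁ n hn).of_iso ((homologyFunctor _ n).mapIso e.symm)⟩, fun n ↦ ?_⟩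
    have := h₂ n
    exact Module.Finite.equiv ((homologyFunctor (ModuleCat.{v} R) n).mapIso e).toLinearEquiv

instance : (perf R).IsClosedUnderIsomorphisms where
  of_iso e h := by
    obtain ⟨K, ⟨i⟩, h⟩ := h
    exact ⟨K, ⟨e.symm ≪≫ i⟩, h⟩

instance : (perf R).ContainsZero where
  exists_zero := by
    have h : ∀ n, IsZero ((0 : CochainComplex (ModuleCat.{v} R) ℤ).X n) := fun n ↦
      (HomologicalComplex.eval (ModuleCat.{v} R) (.up ℤ) n).map_isZero (isZero_zero _)
    refine ⟨Q.obj 0, Functor.map_isZero _ (isZero_zero _), 0, ⟨Iso.refl _⟩, ⟨0, 0, ?_, ?_⟩,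
      fun n ↦ ?_⟩
    · rw [CochainComplex.isStrictlyGE_iff]
      exact fun i _ ↦ h i
    · rw [CochainComplex.isStrictlyLE_iff]
      exact fun i _ ↦ h i
    · have := ModuleCat.subsingleton_of_isZero (h n)
      exact ⟨inferInstance, inferInstance⟩

instance : (perf R).IsStableUnderShift ℤ where
  isStableUnderShiftBy n := ⟨fun X h ↦ by
    obtain ⟨K, ⟨i⟩, ⟨a, b, ha, hb⟩, h⟩ := h
    refine ⟨K⟦n⟧, ⟨(CategoryTheory.shiftFunctor _ n).mapIso i ≪≫ ((Q.commShiftIso n).app K).symm⟩,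
      ⟨a - n, b - n, K.isStrictlyGE_shift a n _ (by lia), K.isStrictlyLE_shift b n _ (by lia)⟩,
      fun m ↦ h (m + n)⟩⟩

instance : (perf R).IsTriangulatedClosed₃ := .mk' fun T hT h₁ h₂ ↦ by
  obtain ⟨K, ⟨i⟩, ⟨a, b, ha, hb⟩, hK⟩ := h₁
  obtain ⟨L, ⟨j⟩, ⟨a', b', ha', hb'⟩, hL⟩ := h₂
  have (n : ℤ) : Projective (K.X n) := by
    have := (hK n).1
    infer_instance
  have := isKProjective_of_projective K b
  obtain ⟨ψ, hψ⟩ := (IsKProjective.Qh_map_bijective K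
    ((HomotopyCategory.quotient _ _).obj L)).surjective
    ((quotientCompQhIso _).hom.app K ≫ i.inv ≫ T.mor₁ ≫ j.hom ≫ (quotientCompQhIso _).inv.app L)
  obtain ⟨φ, rfl⟩ := (HomotopyCategory.quotient _ _).map_surjective ψ
  have hφ : Q.map φ = i.inv ≫ T.mor₁ ≫ j.hom := by
    have h := (quotientCompQhIso (ModuleCat.{v} R)).inv.naturality φ
    dsimp only [Functor.comp_map] at h
    rw [hψ] at h
    rw [← cancel_mono ((quotientCompQhIso (ModuleCat.{v} R)).inv.app L), h]
    simp
  obtain ⟨e, -⟩ := exists_iso_of_arrow_iso T (Q.mapTriangle.obj (mappingCone.triangle φ)) hT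
    (mappingCone_triangle_distinguished φ)
    (Arrow.isoMk i j (by
      change i.hom ≫ Q.map φ = T.mor₁ ≫ j.hom
      rw [hφ, Iso.hom_inv_id_assoc]))
  refine ⟨mappingCone φ, ⟨Triangle.π₃.mapIso e⟩, ⟨min (a - 1) a', max (b - 1) b', ?_, ?_⟩,
    fun n ↦ ?_⟩
  · rw [isStrictlyGE_iff]
    intro n hn
    rw [mappingCone.isZero_X_iff]
    exact ⟨K.isZero_of_isStrictlyGE a _ (by lia), L.isZero_of_isStrictlyGE a' _ (by lia)⟩
  · rw [isStrictlyLE_iff]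
    intro n hn
    rw [mappingCone.isZero_X_iff]
    exact ⟨K.isZero_of_isStrictlyLE b _ (by lia), L.isZero_of_isStrictlyLE b' _ (by lia)⟩
  · let e : (mappingCone φ).X n ≅ ModuleCat.of R (K.X (n + 1) × L.X n) :=
      HomologicalComplex.homotopyCofiber.XIsoBiprod φ n (n + 1) rfl ≪≫ ModuleCat.biprodIsoProd _ _
    obtain ⟨_, _⟩ := hK (n + 1)
    obtain ⟨_, _⟩ := hL n
    exact ⟨Module.Projective.of_equiv e.toLinearEquiv.symm, Module.Finite.equiv e.toLinearEquiv.symm⟩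

instance : (perf R).IsTriangulated where
  toIsTriangulatedClosed₂ := .of_isTriangulatedClosed₃

instance : (dbProp R).ContainsZero where
  exists_zero := by
    have h : ∀ n, IsZero ((homologyFunctor (ModuleCat.{v} R) n).obj 0) := fun n ↦
      Functor.map_isZero _ (isZero_zero _)
    refine ⟨0, isZero_zero _, ⟨0, 0, fun n _ ↦ h n⟩, fun n ↦ ?_⟩
    have := ModuleCat.subsingleton_of_isZero (h n)
    infer_instance

instance : (dbProp R).IsStableUnderShift ℤ where
  isStableUnderShiftBy n := ⟨fun X h ↦ by
    obtain ⟨⟨a, b, h₁⟩, h₂⟩ := h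
    have e (m : ℤ) : (homologyFunctor (ModuleCat.{v} R) m).obj (X⟦n⟧) ≅
        (homologyFunctor (ModuleCat.{v} R) (n + m)).obj X :=
      ((homologyFunctor (ModuleCat.{v} R) 0).shiftIso n m (n + m) rfl).app X
    refine ⟨⟨a - n, b - n, fun m hm ↦ (h₁ (n + m) (by lia)).of_iso (e m)⟩, fun m ↦ ?_⟩
    have := h₂ (n + m)
    exact Module.Finite.equiv (e m).symm.toLinearEquiv⟩

instance [IsNoetherianRing R] : (dbProp R).IsTriangulatedClosed₂ := .mk' fun T hT h₁ h₃ ↦ by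
  have ex := fun n ↦ HomologySequence.exact₂ T hT n
  obtain ⟨⟨a, b, h₁⟩, h₁'⟩ := h₁
  obtain ⟨⟨a', b', h₃⟩, h₃'⟩ := h₃
  refine ⟨⟨min a a', max b b', fun n hn ↦ (ex n).isZero_X₂ ((h₁ n (by lia)).eq_of_src _ _)
    ((h₃ n (by lia)).eq_of_tgt _ _)⟩, fun n ↦ ?_⟩
  have := h₁' n
  have := h₃' n
  have := isNoetherian_of_range_eq_ker _ _ (ex n).moduleCat_range_eq_ker
  infer_instance

instance [IsNoetherianRing R] : (dbProp R).IsTriangulated where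

end Sing

section Sing
open Pretriangulated DerivedCategory

variable (R : Type v) [Ring R] [IsNoetherianRing R] [HasDerivedCategory.{w} (ModuleCat.{v} R)]

/-- The bounded derived category `D^b(R)` of finitely generated left `R`-modules. -/
abbrev Db : Type _ := (dbProp R).FullSubcategory
/-- The perfect complexes in `D^b(R)`. -/
abbrev DbPerf : ObjectProperty (Db R) := (perf R).inverseImage (dbProp R).ι
/-- The singularity category of `R`: the Verdier quotient of `D^b(R)` by the perfect complexes, i.e.
the localization at the morphisms whose cone is perfect. -/
abbrev Dsg : Type _ := (DbPerf R).trW.Localization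
/-- The quotient functor from `D^b(R)` to the singularity category. -/
abbrev Qsg : Db R ⥤ Dsg R := (DbPerf R).trW.Q

end Sing

section Classes
open Abelian DerivedCategory
variable (k : Type u) (A : Type v) [Field k] [Ring A] [Algebra k A]

lemma hochComplex_d (p : ℕ) (m m' : ℤ) (h : m + 1 = m') :
    (hochComplex k A p).d m m' = ModuleCat.ofHom (cochainsD k A p m m' h) := dif_pos h

variable {k A} in
/-- The cochain underlying a cocycle in `C^m(A, Ω^p)`. -/
def cocycleCochain {p : ℕ} {m : ℤ} (z : (hochComplex k A p).cycles m) : Cochains k A p m :=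
  ((hochComplex k A p).iCycles m).hom z

lemma cochainsD_cocycleCochain {p : ℕ} {m : ℤ} (z : (hochComplex k A p).cycles m) :
    cochainsD k A p m (m + 1) rfl (cocycleCochain z) = 0 := by
  have h : (hochComplex k A p).iCycles m ≫ (hochComplex k A p).d m (m + 1) = 0 :=
    (hochComplex k A p).iCycles_d m (m + 1)
  rw [hochComplex_d k A p m (m + 1) rfl] at h
  exact LinearMap.congr_fun (congrArg ModuleCat.Hom.hom h) z

variable {k A} in
/-- The component `A ⊗ (sĀ)^{⊗ n} ⊗ A → Ω^p`, `n = m + p`, of a cocycle in `C^m(A, Ω^p)`. -/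
def cocycleHom {p : ℕ} {m : ℤ} (z : (hochComplex k A p).cycles m) (n : ℕ) (hn : (n : ℤ) = m + p) :
    BarHom k A n p :=
  cocycleCochain z ⟨n, hn⟩

lemma barPrecomp_cocycleHom {p : ℕ} {m : ℤ} (z : (hochComplex k A p).cycles m) (n : ℕ)
    (hn : (n : ℤ) = m + p) : barPrecomp k A n p (cocycleHom z n hn) = 0 := by
  have h := congrFun (cochainsD_cocycleCochain k A z) ⟨n + 1, by push_cast; lia⟩
  rw [cochainsD_succ k A p m (m + 1) rfl _ n hn] at h
  exact ((m + 1).negOnePow.isUnit.smul_eq_zero).1 h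

lemma d_cocycleHom {p : ℕ} {m : ℤ} (z : (hochComplex k A p).cycles m) (n : ℕ) (hn : (n : ℤ) = m + p) :
    (barResolution k A).complex.d (n + 1) n ≫ (cocycleHom z n hn).hom = 0 := by
  have h := barComplex_d k A n
  change (barComplex k A).d (n + 1) n ≫ _ = 0
  rw [h]
  exact barPrecomp_cocycleHom k A z n hn

lemma finite_self : Module.Finite (Env k A) A := by
  refine Module.Finite.of_surjective (LinearMap.toSpanSingleton (Env k A) A 1) fun a ↦ ⟨a ⊗ₜ 1, ?_⟩
  rw [LinearMap.toSpanSingleton_apply]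
  exact (leftMul_self k A a 1).trans (mul_one a)

variable [HasDerivedCategory.{w} (ModuleCat.{v} (Env k A))]

/-- `X` as a complex concentrated in degree `0`, in the derived category. -/
abbrev single (X : ModuleCat.{v} (Env k A)) : DerivedCategory (ModuleCat.{v} (Env k A)) :=
  (singleFunctor _ 0).obj X

/-- The morphism `A → Ω^p[n]` in the derived category given, through the bar resolution of `A`, by
a cocycle in `C^m(A, Ω^p)`, where `n = m + p`. -/
def cocycleClass {p : ℕ} {m : ℤ} (z : (hochComplex k A p).cycles m) (n : ℕ) (hn : (n : ℤ) = m + p) :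
    single k A (Ω k A 0) ⟶ (single k A (Ω k A p))⟦(n : ℤ)⟧ :=
  ((barResolution k A).extMk (cocycleHom z n hn).hom (n + 1) rfl (d_cocycleHom k A z n hn)).hom

/-- The morphism `A → Ω^p[p]` in the derived category which is given by the surjection from the
`p`-th term of the bar resolution onto its `p`-th syzygy bimodule `Ω^p`. -/
def syzygyClass (p : ℕ) : single k A (Ω k A 0) ⟶ (single k A (Ω k A p))⟦(p : ℤ)⟧ :=
  ((barResolution k A).extMk (barAct k A p) (p + 1) rfl (by
    have := barComplex_d k A p
    change (barComplex k A).d (p + 1) p ≫ _ = 0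
    rw [this]
    exact barD_barAct k A p)).hom

lemma dbProp_single (X : ModuleCat.{v} (Env k A)) [Module.Finite (Env k A) X] :
    dbProp (Env k A) (single k A X) := by
  have e (n : ℤ) : (homologyFunctor (ModuleCat.{v} (Env k A)) n).obj (single k A X) ≅
      ((HomologicalComplex.single (ModuleCat.{v} (Env k A)) (.up ℤ) 0).obj X).homology n :=
    (homologyFunctor _ n).mapIso ((singleFunctorIsoCompQ _ 0).app X) ≪≫
      (homologyFunctorFactors _ n).app _
  have h₀ (n : ℤ) (hn : n ≠ 0) :
      Limits.IsZero ((homologyFunctor (ModuleCat.{v} (Env k A)) n).obj (single k A X)) :=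
    (HomologicalComplex.isZero_single_obj_homology _ _ _ _ hn).of_iso (e n)
  refine ⟨⟨0, 0, fun n hn ↦ h₀ n (by lia)⟩, fun n ↦ ?_⟩
  by_cases hn : n = 0
  · subst hn
    exact Module.Finite.equiv
      (e 0 ≪≫ HomologicalComplex.singleObjHomologySelfIso _ _ _).symm.toLinearEquiv
  · have := ModuleCat.subsingleton_of_isZero (h₀ n hn)
    infer_instance

/-- The bimodule `A`, as an object of the bounded derived category of f.g. bimodules. -/
def diag : Db (Env k A) :=
  ⟨single k A (Ω k A 0), by
    have : Module.Finite (Env k A) (Ω k A 0) := finite_self k A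
    exact dbProp_single k A (Ω k A 0)⟩

variable [IsNoetherianRing (Env k A)]

/-- `Ext^m(A, A)` over `A ⊗ Aᵒᵖ`: the morphisms `A → A[m]` in `D^b(A ⊗ Aᵒᵖ)`. -/
abbrev ExtGrp (m : ℤ) : Type _ := ShiftedHom (diag k A) (diag k A) m

/-- The Tate-Hochschild cohomology of `A` in degree `m`: the morphisms `A → A[m]` in the singularity
category of `A ⊗ Aᵒᵖ`. -/
abbrev TateExt (m : ℤ) : Type _ :=
  ShiftedHom ((Qsg (Env k A)).obj (diag k A)) ((Qsg (Env k A)).obj (diag k A)) m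

/-- The class of a cocycle in `C^m(A, Ω^p)`, as a morphism `A → Ω^p[p][m]`. -/
def shiftedClass {p : ℕ} {m : ℤ} (z : (hochComplex k A p).cycles m) (n : ℕ) (hn : (n : ℤ) = m + p) :
    single k A (Ω k A 0) ⟶ (single k A (Ω k A p))⟦(p : ℤ)⟧⟦m⟧ :=
  cocycleClass k A z n hn ≫
    (shiftFunctorAdd' (DerivedCategory (ModuleCat.{v} (Env k A))) (p : ℤ) m (n : ℤ)
      (by lia)).hom.app (single k A (Ω k A p))

/-- A morphism `φ : A → A[m]` of the singularity category is given by a cocycle `z` in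
`C^m(A, Ω^p)`: one has `φ = s⁻¹ ∘ g` for morphisms `s : A[m] → Y` with perfect cone and
`g : A → Y` in `D^b(A ⊗ Aᵒᵖ)` which a morphism `h : Y → Ω^p[p][m]` of the derived category
takes to, respectively, the `m`-th shift of the syzygy class `A → Ω^p[p]` and the class
`A → Ω^p[p][m]` of `z`. (The cone of the syzygy class is a bounded complex of projective
bimodules; but `Ω^p` need not be finitely generated, so it is not itself an object of `D^b`.) -/
def Represents {p : ℕ} {m : ℤ} (z : (hochComplex k A p).cycles m) (n : ℕ) (hn : (n : ℤ) = m + p)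
    (φ : TateExt k A m) : Prop :=
  ∃ (Y : Db (Env k A)) (s : (diag k A)⟦m⟧ ⟶ Y) (_ : (DbPerf (Env k A)).trW s) (g : diag k A ⟶ Y)
    (h : (dbProp (Env k A)).ι.obj Y ⟶ (single k A (Ω k A p))⟦(p : ℤ)⟧⟦m⟧),
    ((dbProp (Env k A)).ι.commShiftIso m).inv.app (diag k A) ≫ (dbProp (Env k A)).ι.map s ≫ h =
      (syzygyClass k A p)⟦m⟧' ∧
    (dbProp (Env k A)).ι.map g ≫ h = shiftedClass k A z n hn ∧
    φ ≫ ((Qsg (Env k A)).commShiftIso m).inv.app (diag k A) ≫ (Qsg (Env k A)).map s =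
      (Qsg (Env k A)).map g

end Classes

end

end SingHoch

/-! Both sides are colimits of the same groups. The sequences 0 → Ω^{p+1} → Bar_p → Ω^p → 0 are
exact with Bar_p projective, and their extension classes give morphisms Ω^p[p] → Ω^{p+1}[p+1] in the
derived category, whose composite from A = Ω^0 is the syzygy class A → Ω^p[p]. Through the bar
resolution, HH^m(A, Ω^p) is Hom(A, Ω^p[p][m]) (`exists_cohomology_equiv`), and θ_p becomes
composition with the extension class (`BarHom.extMk_comp_barExt`): f ⊗ id is the map which a cocycle
f induces on the next syzygies, and the sign of the bar differential cancels that of the connecting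
morphism. As cohomology commutes with sequential colimits, HH_sg^m(A, A) is the colimit of the
groups Hom(A, Ω^p[p][m]).

It remains to see that the morphisms A → A[m] in the singularity category are this colimit too. If
the Bar_p were finitely generated, the syzygy classes would have perfect cones and Ω^p[p] would be
isomorphic to A in D_sg. But Ā may be infinite dimensional, and then Ω^p need not lie in D^b.
Perfection of the cone is therefore weakened to `factorProp`: every morphism to the cone from an
object of a class S factors through a perfect complex. Here S is `finApprox`, the objects whose
morphisms to shifts of a free module land in a finitely generated free part. It contains the perfect
complexes and, by dimension shifting over the Noetherian ring A ⊗ Aᵒᵖ, the finitely generated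
modules, in particular A. Projective modules satisfy `factorProp`, being retracts of free ones, and
`factorProp` is stable under extensions (`factorProp_ext₂`); so it holds for the cones of the syzygy
classes.

Consequently a morphism c : A → Ω^p[p][m] comes from a roof A → Y ← A[m] in D^b, with Y lying over
Ω^p[p][m] and A[m] → Y of perfect cone (`exists_trW_of_trW_factorProp`). Conversely, a perfect
complex has no nonzero morphism to Ω^p[p][m] for large p, so a morphism to the tower extends along
any morphism with perfect cone once p is increased. Hence every roof comes from some c, and
ambiguities disappear at a finite stage. The relation `SyzygyTower.Rep` between c and the roof thus
induces a linear bijection on the colimit (`SyzygyTower.exists_linearEquiv`). Its definition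
contains the third property; the first two are read off at p = 0, where the syzygy class is an
isomorphism. -/

namespace SingHoch

open CategoryTheory CochainComplex HomComplex Abelian Localization

/-! ### Connecting morphisms and Ext classes given by cocycles on a projective resolution -/

section
universe w' v' u'
variable {C : Type u'} [Category.{v'} C] [Preadditive C] [Limits.HasBinaryBiproducts C]

/-- The boundary morphism from the mapping cone of `φ : F ⟶ G` to `F⟦1⟧`. -/
noncomputable def coneδ {F G : CochainComplex C ℤ} (φ : F ⟶ G) :
    ShiftedHom (mappingCone φ) F (1 : ℤ) :=
  Cocycle.homOf ((-mappingCone.fst φ).rightShift 1 0 (zero_add 1))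

/-- The boundary `coneδ` is minus the first projection of the cone, and the first component of the
lifted cocycle is `α`. -/
lemma equivHomShift_symm_liftCocycle_comp {K F G : CochainComplex C ℤ} (φ : F ⟶ G) {n m : ℤ}
    (α : Cocycle K F m) (β : Cochain K G n) (h : n + 1 = m)
    (eq : δ n m β + α.1.comp (Cochain.ofHom φ) (add_zero m) = 0) :
    ShiftedHom.comp (X := K) (Y := mappingCone φ)
      (Cocycle.equivHomShift.symm (mappingCone.liftCocycle φ α β h eq))
      (coneδ φ) (show 1 + n = m by lia) = Cocycle.equivHomShift.symm (-α) := by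
  ext p
  have h1 := mappingCone.liftCochain_v_fst_v φ α.1 β h p (p + n) (p + m) rfl (by lia)
  simp only [ShiftedHom.comp, coneδ, Cocycle.equivHomShift_symm_apply,
    Cochain.rightShift_v _ n 0 (zero_add n) p p (add_zero p) (p + n) rfl,
    Cochain.rightShift_v _ m 0 (zero_add m) p p (add_zero p) (p + m) rfl,
    Cochain.rightShift_v _ 1 0 (zero_add 1) (p + n) (p + n) (add_zero _) (p + m) (by lia),
    CochainComplex.shiftFunctorAdd'_inv_app_f', shiftFunctorObjXIso, HomologicalComplex.comp_f,
    Cocycle.homOf_f, Cocycle.rightShift_coe, Cocycle.coe_neg, Cochain.neg_v, mappingCone.liftCocycle_coe,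
    CochainComplex.shiftFunctor_map_f', Preadditive.neg_comp,
    HomologicalComplex.XIsoOfEq_rfl, Iso.refl_inv]
  erw [Category.comp_id, Category.comp_id, ← h1]
  -- Here `e` and `e'` stand for the mutually inverse identifications of shifted terms; the sign is
  -- the one in `coneδ`.
  have aux {a b c d : C} (x : a ⟶ b) (y : b ⟶ c) (e : c ⟶ d) (e' : d ⟶ c) (he : e ≫ e' = 𝟙 c) :
      x ≫ (-(y ≫ e)) ≫ e' = -(x ≫ y) := by
    simp [he]
  exact aux _ _ _ _ (by simp)

end

section
universe w' v' u'
variable {C : Type u'} [Category.{v'} C] [Abelian C] [HasDerivedCategory.{w'} C]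

-- The snake lemma at the level of cochains: lift `γ` to a cochain `β` with values in `G`; its
-- coboundary comes from `F`, and it represents the image of `γ` under the connecting morphism.
open DerivedCategory in
lemma map_equivHomShift_symm_comp_triangleOfSESδ {F G H : CochainComplex C ℤ} (f : F ⟶ G)
    (g : G ⟶ H) (w : f ≫ g = 0) (hS : (ShortComplex.mk f g w).ShortExact)
    {K : CochainComplex C ℤ} {n m : ℤ} (γ : Cocycle K H n)
    (α : Cocycle K F m) (β : Cochain K G n) (h : n + 1 = m)
    (eq : δ n m β + α.1.comp (Cochain.ofHom f) (add_zero m) = 0)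
    (hβ : β.comp (Cochain.ofHom g) (add_zero n) = γ.1) :
    ShiftedHom.comp (X := Q.obj K) (Y := Q.obj H) (Z := Q.obj F)
      (ShiftedHom.map (Cocycle.equivHomShift.symm γ) Q)
      (triangleOfSESδ hS) (show 1 + n = m by lia) =
      ShiftedHom.map (Cocycle.equivHomShift.symm (-α)) Q := by
  let d : mappingCone f ⟶ H := mappingCone.descShortComplex (ShortComplex.mk f g w)
  have hd : d = mappingCone.desc f 0 g (by simp [w]) := rfl
  -- The pair (`α`, `β`) is a cocycle with values in the cone of `f`, and the map from the cone to
  -- `H`, zero on `F` and `g` on `G`, sends it to `γ`. On the cone the connecting morphism is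
  -- `coneδ`.
  have hγ : γ = (mappingCone.liftCocycle f α β h eq).postcomp d := by
    ext : 1
    simp only [Cocycle.postcomp_coe, mappingCone.liftCocycle_coe, hd,
      mappingCone.ofHom_desc, mappingCone.liftCochain_descCochain, ← hβ]
    simp
  have hδ : Q.map d ≫ triangleOfSESδ hS = (coneδ f).map Q :=
    descShortComplex_triangleOfSESδ hS
  rw [← equivHomShift_symm_liftCocycle_comp f α β h eq, ShiftedHom.map_comp, hγ,
    Cocycle.equivHomShift_symm_postcomp, ← ShiftedHom.comp_mk₀ _ 0 rfl, ShiftedHom.map_comp,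
    ShiftedHom.comp_assoc _ _ _ (zero_add _) (add_zero _) (by lia), ShiftedHom.map_mk₀,
    ShiftedHom.mk₀_comp, hδ]

end

section
universe w' v' u'
variable {C : Type u'} [Category.{v'} C] [Abelian C] [HasExt.{w'} C]

/-- Yoneda product with an extension, computed on a projective resolution: lift `f` to `g`, then
restrict along the differential to get `h`. The sign in `hh` is that of the differential of a
cochain of degree `n` into a single complex. -/
lemma extMk_comp_extClass {X : C} (R : ProjectiveResolution X) {S : ShortComplex C}
    (hS : S.ShortExact) {n : ℕ} (f : R.complex.X n ⟶ S.X₃) (hf : R.complex.d (n + 1) n ≫ f = 0)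
    (g : R.complex.X n ⟶ S.X₂) (hg : g ≫ S.g = f) (h : R.complex.X (n + 1) ⟶ S.X₁)
    (hh : h ≫ S.f = ((-1 : ℤ) ^ (n + 1)) • R.complex.d (n + 1) n ≫ g)
    (hdh : R.complex.d (n + 2) (n + 1) ≫ h = 0) :
    (R.extMk f (n + 1) rfl hf).comp hS.extClass rfl = R.extMk h (n + 2) rfl hdh := by
  have := HasDerivedCategory.standard C
  ext
  rw [Ext.comp_hom, hS.extClass_hom, R.extMk_hom, R.extMk_hom]
  have hdh' : R.cochainComplex.d (-(n + 2 : ℕ)) (-(n + 1 : ℕ)) ≫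
      (R.cochainComplexXIso (-(n + 1 : ℕ)) (n + 1) rfl).hom ≫ h = 0 := by
    rw [R.cochainComplex_d (-(n + 2 : ℕ)) (-(n + 1 : ℕ)) (n + 2) (n + 1) rfl rfl]
    simp [hdh]
  have hdf' : R.cochainComplex.d (-(n + 1 : ℕ)) (-(n : ℕ)) ≫
      (R.cochainComplexXIso (-n) n rfl).hom ≫ f = 0 := by
    rw [R.cochainComplex_d (-(n + 1 : ℕ)) (-n) (n + 1) n rfl rfl]
    simp [hf]
  have hsign (x : Cochain R.cochainComplex ((singleFunctor C 0).obj S.X₂) (n + 1 : ℕ)) :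
      ((n + 1 : ℕ) : ℤ).negOnePow • x = ((-1 : ℤ) ^ (n + 1)) • x := by
    rw [Units.smul_def, Int.negOnePow_def, zpow_natCast]
    simp
  -- The snake cocycle `α` is taken to be `-h`, so that the sign in the conclusion of the snake
  -- lemma gives back `h`.
  have key := map_equivHomShift_symm_comp_triangleOfSESδ
    ((singleFunctor C 0).map S.f) ((singleFunctor C 0).map S.g)
    (by rw [← Functor.map_comp, S.zero, Functor.map_zero])
    (hS.map_of_exact (HomologicalComplex.single C (ComplexShape.up ℤ) 0))
    (K := R.cochainComplex) (n := n) (m := (n + 1 : ℕ))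
    (Cocycle.toSingleMk ((R.cochainComplexXIso (-n) n rfl).hom ≫ f) (by simp) (-(n + 1 : ℕ))
            (by lia) hdf')
    (-Cocycle.toSingleMk ((R.cochainComplexXIso (-(n + 1 : ℕ)) (n + 1) rfl).hom ≫ h) (by simp)
      (-(n + 2 : ℕ)) (by lia) hdh')
    (Cochain.toSingleMk ((R.cochainComplexXIso (-n) n rfl).hom ≫ g) (by simp)) (by simp)
    (by
      rw [Cochain.δ_toSingleMk _ _ _ (-(n + 1 : ℕ)) (by simp),
        R.cochainComplex_d (-(n + 1 : ℕ)) (-n) (n + 1) n rfl rfl, Cocycle.coe_neg,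
        Cochain.neg_comp, Cocycle.toSingleMk_coe, ← Cochain.toSingleMk_postcomp, hsign]
      simp only [Category.assoc, hh]
      simp only [Iso.inv_hom_id_assoc]
      rcases neg_one_pow_eq_or ℤ (n + 1) with h | h <;> rw [h] <;> simp)
    (by
      rw [Cocycle.toSingleMk_coe, ← Cochain.toSingleMk_postcomp, Category.assoc, hg])
  rw [neg_neg] at key
  -- The isomorphisms by which `singleδ` differs from the connecting morphism of complexes have
  -- identity components.
  have hδ : hS.singleδ = DerivedCategory.triangleOfSESδ
      (hS.map_of_exact (HomologicalComplex.single C (ComplexShape.up ℤ) 0)) := by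
    let δ' : DerivedCategory.Q.obj ((singleFunctor C 0).obj S.X₃) ⟶
        (DerivedCategory.Q.obj ((singleFunctor C 0).obj S.X₁))⟦(1 : ℤ)⟧ :=
      DerivedCategory.triangleOfSESδ
        (hS.map_of_exact (HomologicalComplex.single C (ComplexShape.up ℤ) 0))
    have : 𝟙 _ ≫ δ' ≫ (𝟙 _)⟦(1 : ℤ)⟧' = δ' := by
      rw [CategoryTheory.Functor.map_id, Category.comp_id, Category.id_comp]
    have ha (Y : C) : (((SingleFunctors.evaluation _ _ 0).mapIso
        (DerivedCategory.singleFunctorsPostcompQIso C)).hom.app Y) =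
        𝟙 (DerivedCategory.Q.obj ((singleFunctor C 0).obj Y)) :=
      congrArg (fun t ↦ NatTrans.app t Y)
        (DerivedCategory.singleFunctorsPostcompQIso_hom_hom C 0)
    have hb (Y : C) : (((SingleFunctors.evaluation _ _ 0).mapIso
        (DerivedCategory.singleFunctorsPostcompQIso C)).inv.app Y) =
        𝟙 (DerivedCategory.Q.obj ((singleFunctor C 0).obj Y)) :=
      congrArg (fun t ↦ NatTrans.app t Y)
        (DerivedCategory.singleFunctorsPostcompQIso_inv_hom C 0)
    unfold ShortComplex.ShortExact.singleδ
    rw [ha, hb]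
    exact this
  have h₁ (Y : C) : (DerivedCategory.singleFunctorIsoCompQ C 0).inv.app Y =
    𝟙 (DerivedCategory.Q.obj ((singleFunctor C 0).obj Y)) := rfl
  rw [hδ, h₁, h₁]
  refine (ShiftedHom.comp_assoc _ _ _ (add_zero _) (show 1 + (n : ℤ) = (n + 1 : ℕ) by push_cast; lia)
    (show 1 + (n : ℤ) + 0 = (n + 1 : ℕ) by push_cast; lia)).trans ?_
  congr 1
  refine (congrArg (fun x ↦ ShiftedHom.comp x _ _) (ShiftedHom.comp_mk₀_id _ 0 rfl)).trans ?_
  exact key.trans (ShiftedHom.comp_mk₀_id _ 0 rfl).symm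

end
end SingHoch

namespace SingHoch

open CategoryTheory CochainComplex HomComplex Abelian Localization
section
universe v' u' w'
variable {C : Type u'} [Category.{v'} C] [Preadditive C]

/-- The degree is a variable `a` with `a = 0` because the application has the cast `((0 : ℕ) : ℤ)`.
-/
lemma equivHomShift_symm_eq_mk₀ {K L : CochainComplex C ℤ} {a : ℤ} (ha : a = 0) (z : Cocycle K L a)
    (φ : K ⟶ L) (h : ∀ p, z.1.v p p (by lia) = φ.f p) :
    Cocycle.equivHomShift.symm z = ShiftedHom.mk₀ a ha φ := by
  subst ha
  ext p
  simp only [Cocycle.equivHomShift_symm_apply, Cocycle.homOf_f, Cocycle.rightShift_coe,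
    Cochain.rightShift_v _ 0 0 (zero_add 0) p p (add_zero p) p (add_zero p),
    ShiftedHom.mk₀, HomologicalComplex.comp_f]
  rw [h]
  congr 1
  simp [CategoryTheory.shiftFunctorZero', CochainComplex.shiftFunctorZero_inv_app_f, shiftFunctorObjXIso]
  rfl

end
section
universe v' u' w'
variable {C : Type u'} [Category.{v'} C] [Abelian C] [HasExt.{w'} C]

/-- In the derived category `extMk` is the inverse of the quasi-isomorphism `R.π'` followed by the
cocycle, and here the cocycle is `R.π'` itself. -/
lemma extMk_augmentation {X : C} (R : ProjectiveResolution X) (f : R.complex.X 0 ⟶ X)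
    (hf : R.complex.d 1 0 ≫ f = 0) (hf' : R.π.f 0 = f) :
    R.extMk f 1 rfl hf = Ext.mk₀ (𝟙 X) := by
  have := HasDerivedCategory.standard C
  ext
  rw [R.extMk_hom, Ext.mk₀_hom, equivHomShift_symm_eq_mk₀ rfl _ R.π']
  erw [ShiftedHom.map_mk₀]
  erw [ShiftedHom.mk₀_comp_mk₀ _ _ _ rfl rfl, ShiftedHom.mk₀_comp_mk₀ _ _ _ rfl rfl]
  · congr 1
    rw [Category.assoc, IsIso.inv_hom_id_assoc, Iso.hom_inv_id_app]
    exact ((DerivedCategory.singleFunctor C 0).map_id X).symm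
  · intro p
    by_cases hp : p = 0
    · subst hp
      refine (Cochain.toSingleMk_v _ _).trans ?_
      rw [R.π'_f_zero, hf']
      exact Category.assoc _ _ _
    · exact (HomologicalComplex.isZero_single_obj_X _ _ _ _ hp).eq_of_tgt _ _
end
end SingHoch

/-! ### Morphisms factoring through a triangulated subcategory -/

namespace SingHoch

open CategoryTheory Limits Pretriangulated ZeroObject

set_option linter.unusedSectionVars false

section Factor

universe v' u'
variable {C : Type u'} [Category.{v'} C]

/-- `f` factors through an object satisfying `P`. -/
def FactorsThrough (P : ObjectProperty C) {X Y : C} (f : X ⟶ Y) : Prop :=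
  ∃ (K : C) (_ : P K) (u : X ⟶ K) (v : K ⟶ Y), u ≫ v = f

/-- The objects `Z` such that all morphisms from objects in `S` to `Z` factor through `P`. -/
def factorProp (P S : ObjectProperty C) : ObjectProperty C := fun Z ↦
  ∀ (X : C) (_ : S X) (f : X ⟶ Z), FactorsThrough P f

variable {P : ObjectProperty C}

lemma FactorsThrough.comp_right {X Y Z : C} {f : X ⟶ Y} (h : FactorsThrough P f) (g : Y ⟶ Z) :
    FactorsThrough P (f ≫ g) := by
  obtain ⟨K, hK, u, v, rfl⟩ := h
  exact ⟨K, hK, u, v ≫ g, by simp⟩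

lemma le_factorProp (S : ObjectProperty C) : P ≤ factorProp P S := fun Z hZ X _ f ↦
  ⟨Z, hZ, f, 𝟙 Z, by simp⟩

lemma factorProp_of_retract {S : ObjectProperty C} {Z F : C} (hF : factorProp P S F)
    (i : Z ⟶ F) (r : F ⟶ Z) (h : i ≫ r = 𝟙 Z) : factorProp P S Z := fun X hX f ↦ by
  have := (hF X hX (f ≫ i)).comp_right r
  rwa [Category.assoc, h, Category.comp_id] at this

variable [HasZeroObject C] [HasShift C ℤ] [Preadditive C] [∀ n : ℤ, (shiftFunctor C n).Additive]
  [Pretriangulated C]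

lemma FactorsThrough.add [P.IsTriangulated] [P.IsClosedUnderIsomorphisms] {X Y : C} {f g : X ⟶ Y}
    (hf : FactorsThrough P f) (hg : FactorsThrough P g) : FactorsThrough P (f + g) := by
  obtain ⟨K, hK, u, v, rfl⟩ := hf
  obtain ⟨K', hK', u', v', rfl⟩ := hg
  refine ⟨K ⊞ K', ?_, biprod.lift u u', biprod.desc v v', by simp⟩
  exact P.ext_of_isTriangulatedClosed₂ _ (binaryBiproductTriangle_distinguished K K') hK hK'

variable (S : ObjectProperty C) [S.IsStableUnderShift ℤ]

instance [P.IsClosedUnderIsomorphisms] : (factorProp P S).IsClosedUnderIsomorphisms where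
  of_iso e h := factorProp_of_retract h e.inv e.hom (by simp)

instance [P.IsStableUnderShift ℤ] : (factorProp P S).IsStableUnderShift ℤ where
  isStableUnderShiftBy n := ⟨fun Z hZ X hX f ↦ by
    let adj := (shiftEquiv C n).symm.toAdjunction
    obtain ⟨K, hK, u, v, h⟩ := hZ _ (S.le_shift (-n) _ hX) ((adj.homEquiv _ _).symm f)
    refine ⟨_, P.le_shift n _ hK, adj.homEquiv _ _ u, v⟦n⟧', ?_⟩
    exact (adj.homEquiv_naturality_right u v).symm.trans
      ((congrArg (adj.homEquiv _ _) h).trans (Equiv.apply_symm_apply _ _))⟩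

variable {S}

/-- Objects which receive only morphisms factoring through `P` are closed under extensions. -/
lemma factorProp_ext₂ [P.IsTriangulated] [P.IsClosedUnderIsomorphisms] (hPS : P ≤ S)
    (hS : ∀ T ∈ distTriang C, S T.obj₁ → P T.obj₂ → S T.obj₃) (T : Triangle C)
    (hT : T ∈ distTriang C) (h₁ : factorProp P S T.obj₁) (h₃ : factorProp P S T.obj₃) :
    factorProp P S T.obj₂ := fun X hX f ↦ by
  obtain ⟨K, hK, u, v, huv⟩ := h₃ X hX (f ≫ T.mor₂)
  -- The obstruction to lifting `v` to `T.obj₂` is `v ≫ T.mor₃`; its source `K` lies in `P ≤ S`, so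
  -- it factors through `P`.
  obtain ⟨L, hL, w, l, hwl⟩ := (factorProp P S).le_shift (1 : ℤ) _ h₁ K (hPS _ hK) (v ≫ T.mor₃)
  -- The fibre of `w` would kill the obstruction but need not receive `u`: only `u ≫ w ≫ l`
  -- vanishes, not `u ≫ w`. So `l` is pushed to the cone `c` of `u ≫ w`, which lies in `S`, and
  -- factored through `P` once more. The fibre `V` of `K ⟶ L'` receives `u`, and on it the
  -- obstruction vanishes.
  obtain ⟨c, i, j, hc⟩ := distinguished_cocone_triangle (u ≫ w)
  have hc₀ : (u ≫ w) ≫ i = 0 := comp_distTriang_mor_zero₁₂ _ hc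
  obtain ⟨l', hl'⟩ : ∃ l' : c ⟶ _, l = i ≫ l' := Triangle.yoneda_exact₂ _ hc l (by
    change (u ≫ w) ≫ l = 0
    rw [Category.assoc, hwl, reassoc_of% huv, comp_distTriang_mor_zero₂₃ _ hT, comp_zero])
  obtain ⟨L', hL', w', m, hm⟩ := (factorProp P S).le_shift (1 : ℤ) _ h₁ c (hS _ hc hX hL) l'
  obtain ⟨V, a, b, hV⟩ := distinguished_cocone_triangle₁ (w ≫ i ≫ w')
  obtain ⟨u', hu'⟩ : ∃ u' : X ⟶ V, u = u' ≫ a := Triangle.coyoneda_exact₂ _ hV u (by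
    change u ≫ w ≫ i ≫ w' = 0
    simpa using hc₀ =≫ w')
  have hV' : P V := P.ext_of_isTriangulatedClosed₁ _ hV hK hL'
  have hV₀ : a ≫ w ≫ i ≫ w' = 0 := comp_distTriang_mor_zero₁₂ _ hV
  obtain ⟨y, hy⟩ := Triangle.coyoneda_exact₃ T hT (a ≫ v) (by
    rw [Category.assoc, ← hwl, hl', ← hm, ← Category.assoc i, ← Category.assoc w,
      ← Category.assoc a, hV₀, zero_comp])
  obtain ⟨r, hr⟩ := Triangle.coyoneda_exact₂ T hT (f - u' ≫ y) (by
    rw [Preadditive.sub_comp, Category.assoc, ← hy, ← Category.assoc u', ← hu', huv, sub_self])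
  rw [sub_eq_iff_eq_add] at hr
  rw [hr]
  exact ((h₁ X hX r).comp_right _).add ⟨V, hV', u', y, rfl⟩

/-- This makes the class of morphisms with cone in `factorProp P S` stable under composition, so
that it can be checked one syzygy step at a time. -/
lemma factorProp_isTriangulated [P.IsTriangulated] [P.IsClosedUnderIsomorphisms] (hPS : P ≤ S)
    (hS : ∀ T ∈ distTriang C, S T.obj₁ → P T.obj₂ → S T.obj₃) :
    (factorProp P S).IsTriangulated where
  exists_zero := ⟨0, isZero_zero C, le_factorProp S _ P.prop_zero⟩
  toIsTriangulatedClosed₂ := .mk' (factorProp_ext₂ hPS hS)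

/-- Given `σ : B ⟶ Z` whose cone only receives morphisms factoring through `P` from objects of
`S`, any morphism `φ : X ⟶ Z` with `X` in `S` lifts along some `h : Y ⟶ Z`, where `Y` is an
extension of an object of `P` by `B`. -/
lemma exists_trW_of_trW_factorProp [P.IsClosedUnderIsomorphisms]
    {B Z X : C} (σ : B ⟶ Z) (hσ : (factorProp P S).trW σ) (hX : S X) (φ : X ⟶ Z) :
    ∃ (Y K : C) (s : B ⟶ Y) (b : Y ⟶ K) (δ : K ⟶ B⟦(1 : ℤ)⟧) (g : X ⟶ Y) (h : Y ⟶ Z),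
      Triangle.mk s b δ ∈ distTriang C ∧ P K ∧ s ≫ h = σ ∧ g ≫ h = φ := by
  obtain ⟨D, π, δ, hD, hD'⟩ := hσ
  obtain ⟨K, hK, u, v, huv⟩ := hD' X hX (φ ≫ π)
  -- `Y` plays the role of the homotopy pullback of `π` and `v`.
  obtain ⟨Y, s, b, hY⟩ := distinguished_cocone_triangle₂ (v ≫ δ)
  have hπδ : π ≫ δ = 0 := comp_distTriang_mor_zero₂₃ _ hD
  obtain ⟨h, hsh, hbv⟩ : ∃ h : Y ⟶ Z, s ≫ h = σ ∧ b ≫ v = h ≫ π := by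
    obtain ⟨h, h₁, h₂⟩ := complete_distinguished_triangle_morphism₂ _ _ hY hD (𝟙 B) v (by
      change (v ≫ δ) ≫ (𝟙 B)⟦(1 : ℤ)⟧' = v ≫ δ
      rw [CategoryTheory.Functor.map_id, Category.comp_id])
    exact ⟨h, h₁.trans (Category.id_comp _), h₂⟩
  obtain ⟨g', hg'⟩ : ∃ g' : X ⟶ Y, u = g' ≫ b := Triangle.coyoneda_exact₃ _ hY u (by
    change u ≫ v ≫ δ = 0
    rw [reassoc_of% huv, hπδ, comp_zero])
  -- `g' ≫ h` and `φ` agree only after `π`; the difference comes from `B` and is added to `g'` along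
  -- `s`.
  obtain ⟨r, hr⟩ : ∃ r : X ⟶ B, φ - g' ≫ h = r ≫ σ :=
      Triangle.coyoneda_exact₂ _ hD (φ - g' ≫ h : X ⟶ Z) (by
    change (φ - g' ≫ h : X ⟶ Z) ≫ π = 0
    rw [Preadditive.sub_comp, Category.assoc, ← hbv, ← reassoc_of% hg', huv, sub_self])
  refine ⟨Y, K, s, b, v ≫ δ, g' + r ≫ s, h, hY, hK, hsh, ?_⟩
  rw [Preadditive.add_comp, Category.assoc, hsh, ← hr, add_sub_cancel]

/-- If the cone of `h : Y ⟶ Z` only receives morphisms factoring through `P` from objects of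
`S`, then any morphism `X ⟶ Y` with `X` in `S` killed by `h` factors through `P`. -/
lemma factorsThrough_of_comp_eq_zero [P.IsClosedUnderIsomorphisms] [P.IsStableUnderShift ℤ]
    {X Y Z : C} (h : Y ⟶ Z) (hh : (factorProp P S).trW h) (hX : S X) (g : X ⟶ Y)
    (hg : g ≫ h = 0) : FactorsThrough P g := by
  rw [ObjectProperty.trW_iff'] at hh
  obtain ⟨D, i, δ, hD, hD'⟩ := hh
  obtain ⟨g', rfl⟩ : ∃ g' : X ⟶ D, g = g' ≫ i := Triangle.coyoneda_exact₂ _ hD g hg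
  exact (hD' X hX g').comp_right i

end Factor
end SingHoch

/-! ### Finite approximation of morphisms to free modules, and perfect complexes -/

namespace SingHoch

open CategoryTheory Limits Pretriangulated DerivedCategory CochainComplex Abelian

section

variable (R : Type v) [Ring R]

/-- The free module on `I`. -/
noncomputable abbrev freeMod (I : Type v) : ModuleCat.{v} R := ModuleCat.of R (I →₀ R)

open scoped Classical in
/-- The projection of a free module onto the submodule spanned by a finite part of the basis. -/
noncomputable def freeProj {I : Type v} (J : Finset I) : freeMod R I ⟶ freeMod R I :=
  ModuleCat.ofHom ((Finsupp.supported R R (J : Set I)).subtype ∘ₗ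
    Finsupp.restrictDom R R (J : Set I))

variable {R}

open scoped Classical in
lemma freeProj_apply {I : Type v} (J : Finset I) (x : freeMod R I)
    (hx : x ∈ Finsupp.supported R R (J : Set I)) : (freeProj R J).hom x = x := by
  change ((Finsupp.restrictDom R R (J : Set I) x : Finsupp.supported R R (J : Set I)) : I →₀ R) = x
  exact congrArg Subtype.val (LinearMap.congr_fun (Finsupp.restrictDom_comp_subtype _) (⟨x, hx⟩ :
      Finsupp.supported R R (J : Set I)))

open scoped Classical in
lemma freeProj_mem {I : Type v} (J : Finset I) (x : freeMod R I) :
    (freeProj R J).hom x ∈ Finsupp.supported R R (J : Set I) :=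
  (Finsupp.restrictDom R R (J : Set I) x).2

lemma freeProj_comp {I : Type v} {J J' : Finset I} (h : J ⊆ J') :
    freeProj R J ≫ freeProj R J' = freeProj R J := by
  refine ModuleCat.hom_ext (LinearMap.ext fun x ↦ ?_)
  exact freeProj_apply J' _ (Finsupp.supported_mono (by exact_mod_cast h) (freeProj_mem J x))

lemma exists_comp_freeProj {I : Type v} (M : ModuleCat.{v} R) [Module.Finite R M]
    (f : M ⟶ freeMod R I) : ∃ J : Finset I, f ≫ freeProj R J = f := by
  classical
  obtain ⟨s, hs⟩ := (Module.Finite.fg_top : (⊤ : Submodule R M).FG)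
  refine ⟨s.biUnion fun m ↦ (f.hom m).support, ?_⟩
  refine ModuleCat.hom_ext (LinearMap.ext_on_range (v := ((↑) : s → M)) (by simpa using hs) ?_)
  rintro ⟨m, hm⟩
  refine freeProj_apply _ _ ?_
  rw [Finsupp.mem_supported]
  intro i hi
  simp only [Finset.coe_biUnion, Set.mem_iUnion]
  exact ⟨m, hm, hi⟩

/-- Dimension shifting: `Ext (n + 1)` of `M` is a quotient of `Ext n` of the kernel of a finite free
cover of `M`, and this kernel is again finitely generated because `R` is Noetherian. In degree 0
only the supports of the images of finitely many generators matter. -/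
lemma ext_exists_comp_freeProj [IsNoetherianRing R] {I : Type v} (n : ℕ) :
    ∀ (M : ModuleCat.{v} R) [Module.Finite R M] (x : Ext M (freeMod R I) n),
    ∃ J : Finset I, x.comp (Ext.mk₀ (freeProj R J)) (add_zero n) = x := by
  induction n with
  | zero =>
    intro M _ x
    obtain ⟨f, rfl⟩ := (Ext.mk₀_bijective M (freeMod R I)).2 x
    obtain ⟨J, hJ⟩ := exists_comp_freeProj M f
    exact ⟨J, by rw [Ext.mk₀_comp_mk₀, hJ]⟩
  | succ n ih =>
    intro M _ x
    obtain ⟨r, π, hπ⟩ := Module.Finite.exists_fin' R M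
    -- The basis is lifted to the universe `v` of the modules.
    let e : (ULift.{v} (Fin r) → R) ≃ₗ[R] (Fin r → R) := LinearEquiv.funCongrLeft R R Equiv.ulift.symm
    let π' := π ∘ₗ e.toLinearMap
    have hS := LinearMap.shortExact_shortComplexKer (f := π') (hπ.comp e.surjective)
    have : Projective π'.shortComplexKer.X₂ :=
      ModuleCat.projective_of_free (Pi.basisFun R (ULift.{v} (Fin r)))
    obtain ⟨y, rfl⟩ := precomp_extClass_surjective_of_projective_X₂ (freeMod R I) hS n x
    obtain ⟨J, hJ⟩ := ih π'.shortComplexKer.X₁ y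
    refine ⟨J, ?_⟩
    change (hS.extClass.comp y (add_comm 1 n)).comp _ _ = hS.extClass.comp y (add_comm 1 n)
    rw [Ext.comp_assoc _ _ _ _ (add_zero n) (by lia), hJ]

end

section

variable {R : Type v} [Ring R] [HasDerivedCategory.{w} (ModuleCat.{v} R)]

variable (R) in
/-- The objects `X` such that any morphism from `X` to a shift of a free module has image in
a finitely generated free module. -/
def finApprox : ObjectProperty (DerivedCategory (ModuleCat.{v} R)) := fun X ↦
  ∀ (I : Type v) (n : ℤ) (f : X ⟶ ((DerivedCategory.singleFunctor _ 0).obj (freeMod R I))⟦n⟧),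
    ∃ J : Finset I, f ≫ ((DerivedCategory.singleFunctor _ 0).map (freeProj R J))⟦n⟧' = f

instance : (finApprox R).IsStableUnderShift ℤ where
  isStableUnderShiftBy a := ⟨fun X hX I n f ↦ by
    let adj := (shiftEquiv (DerivedCategory (ModuleCat.{v} R)) a).toAdjunction
    let F := (DerivedCategory.singleFunctor _ 0).obj (freeMod R I)
    let f' : X ⟶ F⟦n⟧⟦-a⟧ := adj.homEquiv _ _ f
    obtain ⟨J, hJ⟩ := hX I (n + -a) (f' ≫ (CategoryTheory.shiftFunctorAdd' _ n (-a) _ rfl).inv.app F)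
    refine ⟨J, (adj.homEquiv _ _).injective ?_⟩
    refine (adj.homEquiv_naturality_right _ _).trans ?_
    rw [Category.assoc, ← NatTrans.naturality, ← Category.assoc, cancel_mono] at hJ
    exact hJ⟩

lemma finApprox_ext₃ (T : Triangle (DerivedCategory (ModuleCat.{v} R))) (hT : T ∈ distTriang _)
    (h₁ : finApprox R T.obj₁) (h₂ : finApprox R T.obj₂) : finApprox R T.obj₃ := by
  classical
  intro I n f
  let e (J : Finset I) := ((DerivedCategory.singleFunctor _ 0).map (freeProj R J))⟦n⟧'
  have he {J J' : Finset I} (h : J ⊆ J') : e J ≫ e J' = e J := by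
    simp only [e, ← Functor.map_comp, freeProj_comp h]
  obtain ⟨J, hJ⟩ := h₂ I n (T.mor₂ ≫ f)
  -- The part of `f` not seen by `J` vanishes on `T.obj₂`, hence comes from `T.obj₁⟦1⟧`, where a
  -- second finite set `J'` suffices.
  obtain ⟨g, hg⟩ := Triangle.yoneda_exact₃ T hT (f - f ≫ e J) (by
    rw [Preadditive.comp_sub, sub_eq_zero, ← Category.assoc]
    exact hJ.symm)
  obtain ⟨J', hJ'⟩ := (finApprox R).le_shift (1 : ℤ) _ h₁ I n g
  have h' : (f - f ≫ e J) ≫ e J' = f - f ≫ e J := by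
    rw [hg, Category.assoc]
    exact congrArg _ hJ'
  refine ⟨J ∪ J', ?_⟩
  change f ≫ e (J ∪ J') = f
  have : f = (f - f ≫ e J) ≫ e J' + f ≫ e J := by rw [h']; abel
  rw [this, Preadditive.add_comp, Category.assoc, Category.assoc, he Finset.subset_union_left,
    he Finset.subset_union_right]

lemma exists_Q_map_eq (K L : CochainComplex (ModuleCat.{v} R) ℤ) [K.IsKProjective]
    (f : Q.obj K ⟶ Q.obj L) : ∃ φ : K ⟶ L, Q.map φ = f := by
  obtain ⟨ψ, hψ⟩ := (IsKProjective.Qh_map_bijective K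
    ((HomotopyCategory.quotient _ _).obj L)).surjective
    ((quotientCompQhIso _).hom.app K ≫ f ≫ (quotientCompQhIso _).inv.app L)
  obtain ⟨φ, rfl⟩ := (HomotopyCategory.quotient _ _).map_surjective ψ
  refine ⟨φ, ?_⟩
  have h := (quotientCompQhIso (ModuleCat.{v} R)).inv.naturality φ
  dsimp only [Functor.comp_map] at h
  rw [hψ] at h
  rw [← cancel_mono ((quotientCompQhIso (ModuleCat.{v} R)).inv.app L), h]
  simp

open HomComplex

/-- A morphism in the derived category from a `K`-projective complex `K` to the shift of a module
is given by a morphism on one component of `K`. -/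
lemma exists_toSingleMk (K : CochainComplex (ModuleCat.{v} R) ℤ) [K.IsKProjective]
    (X : ModuleCat.{v} R) (n : ℤ)
    (f : ShiftedHom (Q.obj K) (Q.obj ((CochainComplex.singleFunctor _ 0).obj X)) n) :
    ∃ (g : K.X (-n) ⟶ X) (hg : K.d (-n - 1) (-n) ≫ g = 0),
      f = ShiftedHom.map (Cocycle.equivHomShift.symm
        (Cocycle.toSingleMk g (n := n) (by simp) (-n - 1) (by simp) hg)) Q := by
  obtain ⟨φ, hφ⟩ := exists_Q_map_eq K (((CochainComplex.singleFunctor _ 0).obj X)⟦n⟧)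
    (f ≫ (Q.commShiftIso n).inv.app ((CochainComplex.singleFunctor _ 0).obj X))
  obtain ⟨g, hg, h⟩ := Cocycle.toSingleMk_surjective (Cocycle.equivHomShift φ) (-n) (by simp)
    (-n - 1) (by simp)
  refine ⟨g, hg, ?_⟩
  rw [h, AddEquiv.symm_apply_apply, ShiftedHom.map, hφ, Category.assoc, Iso.inv_hom_id_app]
  exact (Category.comp_id _).symm

/-- A morphism from a bounded complex of finitely generated projectives to `F⟦n⟧` is given by a map
on the single term in degree `-n`, which is finitely generated. -/
lemma perf_le_finApprox : perf R ≤ finApprox R := by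
  rintro X ⟨K, ⟨i⟩, ⟨a, b, ha, hb⟩, hK⟩ I n f
  have (n : ℤ) : Projective (K.X n) := by
    have := (hK n).1
    infer_instance
  have := isKProjective_of_projective K b
  obtain ⟨g, hg, h⟩ := exists_toSingleMk K (freeMod R I) n (i.inv ≫ f)
  have := (hK (-n)).2
  obtain ⟨J, hJ⟩ := exists_comp_freeProj (K.X (-n)) g
  refine ⟨J, ?_⟩
  rw [← cancel_epi i.inv]
  have h₁ : Cocycle.toSingleMk g (n := n) (by simp) (-n - 1) (by simp) hg =
      (Cocycle.toSingleMk g (n := n) (by simp) (-n - 1) (by simp) hg).postcomp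
        ((CochainComplex.singleFunctor _ 0).map (freeProj R J)) := by
    rw [← Cocycle.toSingleMk_postcomp]
    congr 1
    exact hJ.symm
  have h₂ := congrArg (fun x ↦ ShiftedHom.map (Cocycle.equivHomShift.symm x) Q) h₁
  simp only [Cocycle.equivHomShift_symm_postcomp] at h₂
  rw [← ShiftedHom.comp_mk₀ _ 0 rfl, ShiftedHom.map_comp, ← h, ShiftedHom.map_mk₀,
    ShiftedHom.comp_mk₀] at h₂
  rw [← Category.assoc]
  exact h₂.symm

/-- There are no morphisms from a perfect complex to modules placed in low degrees. -/
lemma perf_hom_eq_zero {X : DerivedCategory (ModuleCat.{v} R)} (hX : perf R X) :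
    ∃ N : ℤ, ∀ (n : ℤ) (_ : N ≤ n) (M : ModuleCat.{v} R)
      (f : X ⟶ ((DerivedCategory.singleFunctor _ 0).obj M)⟦n⟧), f = 0 := by
  obtain ⟨K, ⟨i⟩, ⟨a, b, ha, hb⟩, hK⟩ := hX
  have (n : ℤ) : Projective (K.X n) := by
    have := (hK n).1
    infer_instance
  have := isKProjective_of_projective K b
  -- For `n ≥ -a + 1` the degree `-n` lies below `a`, where `K` vanishes.
  refine ⟨-a + 1, fun n hn M f ↦ ?_⟩
  obtain ⟨g, hg, h⟩ := exists_toSingleMk K M n (i.inv ≫ f)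
  have hg : g = 0 := (K.isZero_of_isStrictlyGE a _ (by lia)).eq_of_src _ _
  subst hg
  have h₀ : Cocycle.toSingleMk (0 : K.X (-n) ⟶ M) (n := n) (q := 0) (by simp) (-n - 1) (by simp) hg = 0 := by
    ext : 1
    simp
  rw [h₀, map_zero, ShiftedHom.map, Functor.map_zero, zero_comp] at h
  rw [← cancel_epi i.inv, comp_zero]
  exact h

lemma singleFunctor_hom_eq_zero (M N : ModuleCat.{v} R) (n : ℤ) (hn : n < 0)
    (f : (DerivedCategory.singleFunctor _ 0).obj M ⟶
      ((DerivedCategory.singleFunctor _ 0).obj N)⟦n⟧) : f = 0 := by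
  have h := TStructure.t.isGE_shift ((DerivedCategory.singleFunctor _ 0).obj N) 0 n (-n) (by lia)
  exact TStructure.t.zero_of_isLE_of_isGE f 0 (-n) (by lia) inferInstance h

lemma finApprox_single [IsNoetherianRing R] (M : ModuleCat.{v} R) [Module.Finite R M] :
    finApprox R ((DerivedCategory.singleFunctor _ 0).obj M) := by
  intro I n f
  rcases lt_or_ge n 0 with hn | hn
  · exact ⟨∅, by rw [singleFunctor_hom_eq_zero _ _ n hn f, zero_comp]⟩
  · obtain ⟨n, rfl⟩ := Int.eq_ofNat_of_zero_le hn
    obtain ⟨x, hx⟩ := (Ext.homEquiv (X := M) (Y := freeMod R I)).surjective f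
    obtain ⟨J, hJ⟩ := ext_exists_comp_freeProj n M x
    refine ⟨J, ?_⟩
    have := congrArg Ext.hom hJ
    rw [Ext.comp_hom, Ext.mk₀_hom, ShiftedHom.comp_mk₀] at this
    rw [← hx]
    exact this

lemma perf_single (M : ModuleCat.{v} R) [Module.Projective R M] [Module.Finite R M] :
    perf R ((DerivedCategory.singleFunctor _ 0).obj M) := by
  refine ⟨(CochainComplex.singleFunctor _ 0).obj M, ⟨(singleFunctorIsoCompQ _ 0).app M⟩,
    ⟨0, 0, inferInstance, inferInstance⟩, fun n ↦ ?_⟩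
  by_cases hn : n = 0
  · subst hn
    have e : ((CochainComplex.singleFunctor (ModuleCat.{v} R) 0).obj M).X 0 ≅ M :=
      HomologicalComplex.singleObjXSelf (.up ℤ) 0 M
    exact ⟨Module.Projective.of_equiv e.symm.toLinearEquiv, Module.Finite.equiv e.symm.toLinearEquiv⟩
  · have := ModuleCat.subsingleton_of_isZero
      (HomologicalComplex.isZero_single_obj_X (.up ℤ) 0 M n hn)
    exact ⟨inferInstanceAs (Module.Projective R (((HomologicalComplex.single _ (.up ℤ) 0).obj M).X n)),
      inferInstanceAs (Module.Finite R (((HomologicalComplex.single _ (.up ℤ) 0).obj M).X n))⟩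

-- A projective module is a retract of the free module on its elements, and a morphism from an
-- object of `finApprox` to that free module factors through a finite free summand. No finiteness of
-- `P` is needed, which is what allows Bar_p to be infinitely generated.
open scoped Classical in
lemma factorProp_single (P : ModuleCat.{v} R) [hP : Module.Projective R P] :
    factorProp (perf R) (finApprox R) ((DerivedCategory.singleFunctor _ 0).obj P) := by
  obtain ⟨i, hi⟩ := hP.out
  refine factorProp_of_retract (F := (DerivedCategory.singleFunctor _ 0).obj (freeMod R P)) ?_
    ((DerivedCategory.singleFunctor _ 0).map (ModuleCat.ofHom i))
    ((DerivedCategory.singleFunctor _ 0).map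
      (ModuleCat.ofHom (Finsupp.linearCombination R (id : P → P)))) ?_
  · intro X hX f
    obtain ⟨J, hJ⟩ := hX P 0
      (f ≫ (CategoryTheory.shiftFunctorZero (DerivedCategory (ModuleCat.{v} R)) ℤ).inv.app
        ((DerivedCategory.singleFunctor _ 0).obj (freeMod R P)))
    have nat := (CategoryTheory.shiftFunctorZero (DerivedCategory (ModuleCat.{v} R)) ℤ).inv.naturality
      ((DerivedCategory.singleFunctor _ 0).map (freeProj R J))
    replace hJ : f ≫ (DerivedCategory.singleFunctor _ 0).map (freeProj R J) = f := by
      refine (cancel_mono ((CategoryTheory.shiftFunctorZero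
        (DerivedCategory (ModuleCat.{v} R)) ℤ).inv.app
          ((DerivedCategory.singleFunctor _ 0).obj (freeMod R P)))).1 ?_
      refine Eq.trans ?_ hJ
      refine (Category.assoc _ _ _).trans (Eq.trans ?_ (Category.assoc _ _ _).symm)
      exact congrArg (f ≫ ·) nat
    have : Module.Finite R (Finsupp.supported R R (J : Set P)) :=
      Module.Finite.equiv (Finsupp.supportedEquivFinsupp (J : Set P)).symm
    have : Module.Projective R (Finsupp.supported R R (J : Set P)) :=
      Module.Projective.of_equiv (Finsupp.supportedEquivFinsupp (J : Set P)).symm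
    refine ⟨_, perf_single (ModuleCat.of R (Finsupp.supported R R (J : Set P))),
      f ≫ (DerivedCategory.singleFunctor _ 0).map
        (ModuleCat.ofHom (Finsupp.restrictDom R R (J : Set P))),
      (DerivedCategory.singleFunctor _ 0).map (ModuleCat.ofHom (Submodule.subtype _)), ?_⟩
    rw [Category.assoc, ← Functor.map_comp]
    exact hJ
  · rw [← Functor.map_comp, ← CategoryTheory.Functor.map_id]
    congr 1
    ext x : 2
    exact hi x

lemma perf_le_dbProp [IsNoetherianRing R] : perf R ≤ dbProp R := by
  rintro X ⟨K, ⟨i⟩, ⟨a, b, ha, hb⟩, hK⟩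
  have e (n : ℤ) : (DerivedCategory.homologyFunctor _ n).obj (Q.obj K) ≅ K.homology n :=
    (homologyFunctorFactors _ n).app K
  refine (dbProp R).prop_of_iso i.symm ⟨⟨a, b, fun n hn ↦ ?_⟩, fun n ↦ ?_⟩
  · refine IsZero.of_iso ?_ (e n)
    have h₀ : IsZero (K.X n) := by
      rcases hn with hn | hn
      · exact K.isZero_of_isStrictlyGE a n hn
      · exact K.isZero_of_isStrictlyLE b n hn
    exact (HomologicalComplex.exactAt_iff_isZero_homology _ _).1
      (ShortComplex.exact_of_isZero_X₂ _ h₀)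
  · have := (hK n).2
    have h₁ : Function.Injective (K.iCycles n).hom := (ModuleCat.mono_iff_injective _).1 inferInstance
    have h₂ : Function.Surjective (K.homologyπ n).hom := (ModuleCat.epi_iff_surjective _).1 inferInstance
    have := isNoetherian_of_injective _ h₁
    have := Module.Finite.of_surjective _ h₂
    exact Module.Finite.equiv (e n).symm.toLinearEquiv

end

end SingHoch

/-! ### The bar extensions and the maps θ_p -/

namespace SingHoch

open CategoryTheory Limits Pretriangulated DerivedCategory Abelian TensorProduct MulOpposite

section

variable (k : Type u) (A : Type v) [Field k] [Ring A] [Algebra k A]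

/-- The short exact sequence `0 → Ω^{p+1} → Bar_p → Ω^p → 0`. -/
noncomputable def barShortComplex (p : ℕ) : ShortComplex (ModuleCat.{v} (Env k A)) :=
  ShortComplex.mk (barIncl k A p) (barAct k A p) (barIncl_barAct k A p)

lemma barShortComplex_shortExact (p : ℕ) : (barShortComplex k A p).ShortExact where
  exact := (ShortComplex.ShortExact.moduleCat_exact_iff_function_exact _).2
    (exact_barIncl_barAct k A p)
  mono_f := (ModuleCat.mono_iff_injective _).2 (barIncl_injective k A p)
  epi_g := (ModuleCat.epi_iff_surjective _).2 (barAct_surjective k A p)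

/-- On elements `ω ⊗ 1` the map `barAct` is the identity, and a bimodule map from the bar term is
determined there. Hence θ_p carries one syzygy class to the next. -/
lemma tensorHom_barAct (p : ℕ) : tensorHom k A (barAct k A p : BarHom k A p p) = barAct k A (p + 1) := by
  refine BarHom.ext_mk_one k A fun ω a ↦ ?_
  refine (tensorHom_apply k A (barAct k A p) ω a).trans ?_
  have h₁ : (barAct k A p).hom (RFree.mk k A ω 1) = ω := by
    refine (act_mk k A ω 1).trans ?_
    rw [op_one, map_one, Module.End.one_apply]
  have h₂ : (barAct k A (p + 1)).hom (RFree.mk k A (Forms.mk k A ω a) 1) = Forms.mk k A ω a := by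
    refine (act_mk k A (Forms.mk k A ω a) 1).trans ?_
    rw [op_one, map_one, Module.End.one_apply]
  exact (congrArg (fun x ↦ Forms.mk k A x a) h₁).trans h₂.symm

variable {k A}

/-- The lift of `f : Bar_n → Ω^p` along `Bar_p → Ω^p` with `ω ⊗ 1 ↦ f (ω ⊗ 1) ⊗ 1`. -/
noncomputable def BarHom.lift {n p : ℕ} (f : BarHom k A n p) : Bar k A n ⟶ Bar k A p :=
  ModuleCat.ofHom (RFree.extend k A ((RFree.unit k A _).comp (RFree.restrict k A f.hom.hom))
    fun a m ↦ by
      rw [LinearMap.comp_apply, LinearMap.comp_apply, RFree.restrict_leftMul, RFree.unit_apply,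
        RFree.unit_apply, RFree.leftMul_mk])

lemma BarHom.lift_mk {n p : ℕ} (f : BarHom k A n p) (ω : (formsBimod k A n).X) (b : A) :
    f.lift.hom (RFree.mk k A ω b) = RFree.mk k A (f.hom.hom (RFree.mk k A ω 1)) b := by
  change rightMul k A (RFree k A (formsBimod k A p).X) (op b)
    (RFree.mk k A (f.hom.hom (RFree.mk k A ω 1)) 1) = _
  rw [RFree.rightMul_mk, one_mul, unop_op]

lemma BarHom.lift_barAct {n p : ℕ} (f : BarHom k A n p) : f.lift ≫ barAct k A p = f.hom := by
  refine ModuleCat.hom_ext (RFree.bimodule_hom_ext k A fun ω ↦ ?_)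
  refine (congrArg (barAct k A p).hom (f.lift_mk ω 1)).trans ?_
  refine (act_mk k A _ 1).trans ?_
  rw [op_one, map_one, Module.End.one_apply]

/-- At (ω ⊗ sā) ⊗ 1, with f(ω) standing for f(ω ⊗ 1), the two sides are f(ω) ⊗ a - f(ω)a ⊗ 1 and
f(ω) ⊗ a - f(ωa) ⊗ 1. The cocycle condition says that f(ω)a = f(ωa). -/
lemma BarHom.tensorHom_barIncl {n p : ℕ} (f : BarHom k A n p)
    (hf : barAct k A (n + 1) ≫ barIncl k A n ≫ f.hom = 0) :
    (tensorHom k A f).hom ≫ barIncl k A p = barAct k A (n + 1) ≫ barIncl k A n ≫ f.lift := by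
  refine ModuleCat.hom_ext (RFree.bimodule_hom_ext k A fun y ↦ ?_)
  have key : RFree.restrict k A ((tensorHom k A f).hom ≫ barIncl k A p).hom =
      RFree.restrict k A (barAct k A (n + 1) ≫ barIncl k A n ≫ f.lift).hom := by
    refine Forms.hom_ext k A fun ω a ↦ ?_
    have h₁ : (barAct k A (n + 1)).hom (RFree.mk k A (Forms.mk k A ω a) 1) = Forms.mk k A ω a := by
      refine (act_mk k A (Forms.mk k A ω a) 1).trans ?_
      rw [op_one, map_one, Module.End.one_apply]
    have h₂ : f.hom.hom (RFree.mk k A ω a - RFree.mk k A (rightMul k A _ (op a) ω) 1) = 0 := by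
      have := LinearMap.congr_fun (congrArg ModuleCat.Hom.hom hf)
        (RFree.mk k A (Forms.mk k A ω a) 1)
      refine Eq.trans ?_ this
      exact congrArg (fun x ↦ f.hom.hom ((barIncl k A n).hom x)) h₁.symm
    rw [map_sub, sub_eq_zero] at h₂
    have h₃ : f.hom.hom (RFree.mk k A ω a) = rightMul k A _ (op a) (f.hom.hom (RFree.mk k A ω 1)) :=
      map_mk_eq k A f.hom.hom ω a
    have h₄ : (barAct k A (n + 1) ≫ barIncl k A n ≫ f.lift).hom
        (RFree.mk k A (Forms.mk k A ω a) 1) =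
        f.lift.hom (RFree.mk k A ω a - RFree.mk k A (rightMul k A _ (op a) ω) 1) :=
      congrArg (fun x ↦ f.lift.hom ((barIncl k A n).hom x)) h₁
    have h₅ : ((tensorHom k A f).hom ≫ barIncl k A p).hom
        (RFree.mk k A (Forms.mk k A ω a) 1) =
        RFree.mk k A (f.hom.hom (RFree.mk k A ω 1)) a -
          RFree.mk k A (rightMul k A _ (op a) (f.hom.hom (RFree.mk k A ω 1))) 1 :=
      congrArg (barIncl k A p).hom (tensorHom_apply k A f ω a)
    refine h₅.trans (Eq.trans ?_ h₄.symm)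
    rw [map_sub, f.lift_mk, f.lift_mk, ← h₂, h₃]
  exact LinearMap.congr_fun key y

lemma barD_comp_eq (n : ℕ) {X : ModuleCat.{v} (Env k A)} (g : Bar k A n ⟶ X) :
    barD k A n ≫ g = ((-1 : ℤ) ^ (n + 1)) • (barAct k A (n + 1) ≫ barIncl k A n ≫ g) := by
  rw [barD, Preadditive.zsmul_comp, Category.assoc]

lemma barResolution_d_comp (n : ℕ) {X : ModuleCat.{v} (Env k A)} (g : Bar k A n ⟶ X) :
    (barResolution k A).complex.d (n + 1) n ≫ g = barD k A n ≫ g := by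
  have h := barComplex_d k A n
  change (barComplex k A).d (n + 1) n ≫ g = _
  rw [h]
  rfl

lemma barAct_barIncl_comp {n : ℕ} {X : ModuleCat.{v} (Env k A)} (f : Bar k A n ⟶ X)
    (hf : (barResolution k A).complex.d (n + 1) n ≫ f = 0) :
    barAct k A (n + 1) ≫ barIncl k A n ≫ f = 0 := by
  have h := (barD_comp_eq n f).symm.trans ((barResolution_d_comp n f).symm.trans hf)
  have := congrArg (((-1 : ℤ) ^ (n + 1)) • ·) h
  refine (neg_one_pow_smul_smul (n + 1) _).symm.trans (this.trans ?_)
  exact smul_zero (A := Bar k A (n + 1) ⟶ X) ((-1 : ℤ) ^ (n + 1))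

lemma BarHom.d_tensorHom {n p : ℕ} (f : BarHom k A n p)
    (hf : (barResolution k A).complex.d (n + 1) n ≫ f.hom = 0) :
    (barResolution k A).complex.d (n + 2) (n + 1) ≫ (tensorHom k A f).hom = 0 := by
  refine (barResolution_d_comp (n + 1) (tensorHom k A f).hom).trans ?_
  refine (barTensorId_barPrecomp k A n p f).symm.trans ?_
  exact (congrArg (barTensorId k A (n + 1) p) ((barResolution_d_comp n f.hom).symm.trans hf)).trans
    (map_zero _)

variable (k A) in
/-- The class of the extension `0 → Ω^{p+1} → Bar_p → Ω^p → 0`. -/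
noncomputable abbrev barExt (p : ℕ) : Ext (Ω k A p) (Ω k A (p + 1)) 1 :=
  (barShortComplex_shortExact k A p).extClass

/-- This is where θ_p becomes the connecting morphism of 0 → Ω^{p+1} → Bar_p → Ω^p → 0. No sign
appears because `barD` carries the same factor `(-1) ^ (n + 1)` as the formula for the Yoneda
product. -/
lemma BarHom.extMk_comp_barExt {n p : ℕ} (f : BarHom k A n p)
    (hf : (barResolution k A).complex.d (n + 1) n ≫ f.hom = 0) :
    ((barResolution k A).extMk f.hom (n + 1) rfl hf).comp (barExt k A p) rfl =
      (barResolution k A).extMk (tensorHom k A f).hom (n + 2) rfl (f.d_tensorHom hf) := by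
  refine extMk_comp_extClass (barResolution k A) (barShortComplex_shortExact k A p) f.hom hf f.lift
    f.lift_barAct (tensorHom k A f).hom ?_ (f.d_tensorHom hf)
  refine (f.tensorHom_barIncl (barAct_barIncl_comp f.hom hf)).trans ?_
  refine Eq.trans ?_ (congrArg (((-1 : ℤ) ^ (n + 1)) • ·) (barResolution_d_comp n f.lift)).symm
  change _ = ((-1 : ℤ) ^ (n + 1)) • barD k A n ≫ f.lift
  rw [barD_comp_eq, neg_one_pow_smul_smul]

end

section

variable (k : Type u) (A : Type v) [Field k] [Ring A] [Algebra k A]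
  [HasDerivedCategory.{w} (ModuleCat.{v} (Env k A))]

/-- `Ω^p[p]` in the derived category. -/
noncomputable abbrev shiftedForms (p : ℕ) : DerivedCategory (ModuleCat.{v} (Env k A)) :=
  (single k A (Ω k A p))⟦(p : ℤ)⟧

/-- The morphism `Ω^p[p] → Ω^{p+1}[p+1]` given by the extension
`0 → Ω^{p+1} → Bar_p → Ω^p → 0`. -/
noncomputable def syzygyStep (p : ℕ) : shiftedForms k A p ⟶ shiftedForms k A (p + 1) :=
  (barExt k A p).hom⟦(p : ℤ)⟧' ≫
    (shiftFunctorAdd' (DerivedCategory (ModuleCat.{v} (Env k A))) ((1 : ℕ) : ℤ) (p : ℤ)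
      ((p + 1 : ℕ) : ℤ) (by lia)).inv.app (single k A (Ω k A (p + 1)))

lemma extMk_hom_comp_syzygyStep {p : ℕ} (f : BarHom k A p p)
    (hf : (barResolution k A).complex.d (p + 1) p ≫ f.hom = 0) :
    ((barResolution k A).extMk f.hom (p + 1) rfl hf).hom ≫ syzygyStep k A p =
      ((barResolution k A).extMk (tensorHom k A f).hom (p + 2) rfl (f.d_tensorHom hf)).hom := by
  rw [← f.extMk_comp_barExt hf, Ext.comp_hom]
  rfl

lemma syzygyClass_comp_syzygyStep (p : ℕ) :
    syzygyClass k A p ≫ syzygyStep k A p = syzygyClass k A (p + 1) := by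
  refine (extMk_hom_comp_syzygyStep k A (barAct k A p) _).trans ?_
  have h := tensorHom_barAct k A p
  rw [syzygyClass]
  congr 2

end

section
variable {k : Type u} {A : Type v} [Field k] [Ring A] [Algebra k A]

/-- The image of a cocycle in `C^m(A, Ω^p)` under `θ_p`. -/
noncomputable abbrev thetaCycle {p : ℕ} {m : ℤ} (z : (hochComplex k A p).cycles m) :
    (hochComplex k A (p + 1)).cycles m :=
  (HomologicalComplex.cyclesMap (theta k A p) m).hom z

lemma cocycleHom_thetaCycle {p : ℕ} {m : ℤ} (z : (hochComplex k A p).cycles m) (n : ℕ)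
    (hn : (n : ℤ) = m + p) :
    cocycleHom (thetaCycle z) (n + 1) (by push_cast; lia) = tensorHom k A (cocycleHom z n hn) := by
  have h := HomologicalComplex.cyclesMap_i (theta k A p) m
  have h' := LinearMap.congr_fun (congrArg ModuleCat.Hom.hom h) z
  exact congrFun h' ⟨n + 1, by push_cast; lia⟩

variable [HasDerivedCategory.{w} (ModuleCat.{v} (Env k A))]

lemma shiftedClass_comp_syzygyStep {p : ℕ} {m : ℤ} (z : (hochComplex k A p).cycles m) (n : ℕ)
    (hn : (n : ℤ) = m + p) :
    shiftedClass k A z n hn ≫ (syzygyStep k A p)⟦m⟧' =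
      shiftedClass k A (thetaCycle z) (n + 1) (by push_cast; lia) := by
  have h₁ : cocycleClass k A (thetaCycle z) (n + 1) (by push_cast; lia) =
      cocycleClass k A z n hn ≫ (barExt k A p).hom⟦(n : ℤ)⟧' ≫
        (shiftFunctorAdd' (DerivedCategory (ModuleCat.{v} (Env k A))) ((1 : ℕ) : ℤ) (n : ℤ)
          ((n + 1 : ℕ) : ℤ) (by lia)).inv.app (single k A (Ω k A (p + 1))) := by
    have := (cocycleHom z n hn).extMk_comp_barExt (d_cocycleHom k A z n hn)
    have h := congrArg Ext.hom this
    rw [Ext.comp_hom] at h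
    refine Eq.trans ?_ h.symm
    have h' := cocycleHom_thetaCycle z n hn
    rw [cocycleClass]
    congr 2

  -- What remains is to compare the shift by 1 followed by `n` with the shifts by 1, `p` and `m` in
  -- turn: naturality moves the extension class past the splitting of `n`, and associativity of the
  -- shift does the rest.
  rw [shiftedClass, shiftedClass, h₁, syzygyStep, Functor.map_comp]
  simp only [Category.assoc]
  congr 1
  have nat := (shiftFunctorAdd' (DerivedCategory (ModuleCat.{v} (Env k A))) (p : ℤ) m (n : ℤ)
      (by lia)).hom.naturality (barExt k A p).hom
  refine (Category.assoc _ _ _).symm.trans ?_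
  refine (congrArg (· ≫ _) nat.symm).trans ?_
  refine (Category.assoc _ _ _).trans ?_
  congr 1
  have ass := shiftFunctorAdd'_assoc_hom_app (C := DerivedCategory (ModuleCat.{v} (Env k A)))
    ((1 : ℕ) : ℤ) p m ((p + 1 : ℕ) : ℤ) (n : ℤ) ((n + 1 : ℕ) : ℤ) (by lia) (by lia) (by lia)
    (single k A (Ω k A (p + 1)))
  rw [← cancel_epi ((shiftFunctorAdd' (DerivedCategory (ModuleCat.{v} (Env k A))) ((1 : ℕ) : ℤ) (n : ℤ)
          ((n + 1 : ℕ) : ℤ) (by lia)).hom.app (single k A (Ω k A (p + 1)))),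
    Iso.hom_inv_id_app_assoc, ← reassoc_of% ass]
  rw [← Functor.map_comp, Iso.hom_inv_id_app, CategoryTheory.Functor.map_id]
  exact Category.comp_id _

end

end SingHoch

/-! ### Morphisms in a Verdier quotient as a colimit along a tower -/

namespace SingHoch

open CategoryTheory Limits Pretriangulated ZeroObject

set_option linter.unusedSectionVars false

section Tower

universe v' u' x

variable {C : Type u'} [Category.{v'} C] [HasZeroObject C] [HasShift C ℤ] [Preadditive C]
  [∀ n : ℤ, (shiftFunctor C n).Additive] [Pretriangulated C] [IsTriangulated C]

/-- By the octahedral axiom the cone of `g` is the third vertex of a triangle on the cones of `f`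
and `f ≫ g`. -/
lemma trW_of_comp_left {P : ObjectProperty C} [P.IsTriangulated] [P.IsClosedUnderIsomorphisms]
    {X Y Z : C} (f : X ⟶ Y) (g : Y ⟶ Z) (hf : P.trW f) (hfg : P.trW (f ≫ g)) : P.trW g := by
  obtain ⟨K, a, b, h, hK⟩ := hf
  obtain ⟨L, c, d, h', hL⟩ := hfg
  obtain ⟨M, m, n, h''⟩ := distinguished_cocone_triangle g
  exact ⟨M, m, n, h'', P.ext_of_isTriangulatedClosed₃ _ (Triangulated.someOctahedron rfl h h'' h').mem
    hK hL⟩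

/-- A sequence of objects `G 0 ⟶ G 1 ⟶ ⋯` under an object `X₁` of the triangulated subcategory `B`,
such that `X₁ ⟶ G p` is an isomorphism modulo `P` from the point of view of objects in `S`, and
such that objects satisfying `P` have no morphisms to `G p` for large `p`. -/
structure SyzygyTower (P S B : ObjectProperty C) (X₀ X₁ : B.FullSubcategory) where
  /-- the sequence -/
  G : ℕ ⥤ C
  /-- the morphisms to the sequence -/
  σ (p : ℕ) : B.ι.obj X₁ ⟶ G.obj p
  σ_map {p q : ℕ} (h : p ≤ q) : σ p ≫ G.map (homOfLE h) = σ q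
  σ_trW (p : ℕ) : (factorProp P S).trW (σ p)
  hom_eq_zero {K : C} (hK : P K) : ∃ N : ℕ, ∀ p : ℕ, N ≤ p → ∀ f : K ⟶ G.obj p, f = 0
  mem : S (B.ι.obj X₀)

variable {P S B : ObjectProperty C} [P.IsTriangulated] [P.IsClosedUnderIsomorphisms]
  [S.IsStableUnderShift ℤ] [B.IsTriangulated] [B.IsClosedUnderIsomorphisms]
  {X₀ X₁ : B.FullSubcategory} (T : SyzygyTower P S B X₀ X₁)

namespace SyzygyTower

/-- The obstruction to extending `h` is its restriction to the fibre of `t`; this fibre lies in `P`,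
so the obstruction dies far enough along the tower. -/
lemma exists_extension {Y Y' : C} (t : Y ⟶ Y') (ht : P.trW t) {p : ℕ} (h : Y ⟶ T.G.obj p) :
    ∃ (q : ℕ) (hpq : p ≤ q) (h' : Y' ⟶ T.G.obj q), t ≫ h' = h ≫ T.G.map (homOfLE hpq) := by
  rw [P.trW_iff'] at ht
  obtain ⟨K, i, δ, hT, hK⟩ := ht
  obtain ⟨N, hN⟩ := T.hom_eq_zero hK
  obtain ⟨h', hh'⟩ := Triangle.yoneda_exact₂ _ hT
    (h ≫ T.G.map (homOfLE (le_max_left p N)) : Y ⟶ T.G.obj (max p N))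
    (hN _ (le_max_right _ _) _)
  exact ⟨max p N, le_max_left _ _, h', hh'.symm⟩

/-- Such an `h` factors through the cone of `t`, which lies in `P` and has no morphisms to late
stages. This makes the extension along `t` unique up to increasing the stage. -/
lemma exists_map_eq_zero {Y Y' : C} (t : Y ⟶ Y') (ht : P.trW t) {p : ℕ} (h : Y' ⟶ T.G.obj p)
    (hth : t ≫ h = 0) : ∃ (q : ℕ) (hpq : p ≤ q), h ≫ T.G.map (homOfLE hpq) = 0 := by
  obtain ⟨K, i, δ, hT, hK⟩ := ht
  obtain ⟨N, hN⟩ := T.hom_eq_zero hK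
  obtain ⟨h', hh'⟩ : ∃ h' : K ⟶ T.G.obj p, h = i ≫ h' := Triangle.yoneda_exact₂ _ hT h hth
  refine ⟨max p N, le_max_left _ _, ?_⟩
  rw [hh', Category.assoc, hN _ (le_max_right p N) (h' ≫ _), comp_zero]

/-- The morphism `ψ` of the Verdier quotient by `P` is given by the morphism `c : X₀ ⟶ G p`. -/
def Rep (p : ℕ) (c : B.ι.obj X₀ ⟶ T.G.obj p)
    (ψ : (P.inverseImage B.ι).trW.Q.obj X₀ ⟶ (P.inverseImage B.ι).trW.Q.obj X₁) : Prop :=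
  ∃ (Y : B.FullSubcategory) (s : X₁ ⟶ Y) (_ : (P.inverseImage B.ι).trW s) (g : X₀ ⟶ Y)
    (h : B.ι.obj Y ⟶ T.G.obj p), B.ι.map s ≫ h = T.σ p ∧ B.ι.map g ≫ h = c ∧
      ψ ≫ (P.inverseImage B.ι).trW.Q.map s = (P.inverseImage B.ι).trW.Q.map g

variable {T}

lemma Rep.map {p : ℕ} {c : B.ι.obj X₀ ⟶ T.G.obj p}
    {ψ : (P.inverseImage B.ι).trW.Q.obj X₀ ⟶ (P.inverseImage B.ι).trW.Q.obj X₁}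
    (hψ : T.Rep p c ψ) {q : ℕ} (hpq : p ≤ q) : T.Rep q (c ≫ T.G.map (homOfLE hpq)) ψ := by
  obtain ⟨Y, s, hs, g, h, h₁, rfl, h₂⟩ := hψ
  refine ⟨Y, s, hs, g, h ≫ T.G.map (homOfLE hpq), ?_, (Category.assoc _ _ _).symm, h₂⟩
  rw [← T.σ_map hpq, ← h₁]
  exact (Category.assoc _ _ _).symm

lemma Rep.smul {k : Type x} [Ring k] [Linear k C]
    {p : ℕ} {c : B.ι.obj X₀ ⟶ T.G.obj p}
    {ψ : (P.inverseImage B.ι).trW.Q.obj X₀ ⟶ (P.inverseImage B.ι).trW.Q.obj X₁}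
    (hψ : T.Rep p c ψ) (a : k) : T.Rep p (a • c) (a • ψ) := by
  obtain ⟨Y, s, hs, g, h, h₁, rfl, h₂⟩ := hψ
  refine ⟨Y, s, hs, a • g, h, h₁, ?_, ?_⟩
  · rw [Functor.map_smul, Linear.smul_comp]
  · rw [Functor.map_smul, Linear.smul_comp, h₂]

lemma Rep.add {p : ℕ} {c c' : B.ι.obj X₀ ⟶ T.G.obj p}
    {ψ ψ' : (P.inverseImage B.ι).trW.Q.obj X₀ ⟶ (P.inverseImage B.ι).trW.Q.obj X₁}
    (hψ : T.Rep p c ψ) (hψ' : T.Rep p c' ψ') :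
    ∃ (q : ℕ) (hpq : p ≤ q), T.Rep q ((c + c') ≫ T.G.map (homOfLE hpq)) (ψ + ψ') := by
  obtain ⟨Y, s, hs, g, h, h₁, rfl, h₂⟩ := hψ
  obtain ⟨Y', s', hs', g', h', h₁', rfl, h₂'⟩ := hψ'
  -- A common denominator `Z` for the two roofs, by the Ore condition.
  obtain ⟨Z, f, t, ht, hf⟩ : ∃ (Z : B.FullSubcategory) (f : Y ⟶ Z) (t : Y' ⟶ Z)
      (_ : (P.inverseImage B.ι).trW t), s ≫ f = s' ≫ t := by
    obtain ⟨φ, hφ⟩ := (MorphismProperty.RightFraction.mk s hs s').exists_leftFraction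
    exact ⟨_, φ.f, φ.s, φ.hs, hφ.symm⟩
  obtain ⟨q, hpq, e, he⟩ := T.exists_extension _ ((P.inverseImage_trW_iff B.ι t).1 ht) h'
  have hf' : B.ι.map s ≫ B.ι.map f = B.ι.map s' ≫ B.ι.map t := by
    rw [← Functor.map_comp, hf, Functor.map_comp]
  -- The extension `e` of `h'` to `Z` is compatible with `h` only after precomposition with `s`; a
  -- second increase of the stage makes it compatible on `Y`.
  obtain ⟨r, hqr, hr⟩ := T.exists_map_eq_zero _ ((P.inverseImage_trW_iff B.ι s).1 hs)
    (B.ι.map f ≫ e - h ≫ T.G.map (homOfLE hpq) : B.ι.obj Y ⟶ _) (by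
      rw [Preadditive.comp_sub, reassoc_of% hf', he, reassoc_of% h₁', reassoc_of% h₁, sub_self])
  rw [Preadditive.sub_comp, sub_eq_zero] at hr
  refine ⟨r, hpq.trans hqr, Z, s' ≫ t, (P.inverseImage B.ι).trW.comp_mem _ _ hs' ht, g ≫ f + g' ≫ t,
    e ≫ T.G.map (homOfLE hqr), ?_, ?_, ?_⟩
  · rw [Functor.map_comp, Category.assoc, reassoc_of% he, reassoc_of% h₁', ← Functor.map_comp]
    exact T.σ_map _
  · rw [Functor.map_add, Functor.map_comp, Functor.map_comp, Preadditive.add_comp,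
      Category.assoc, Category.assoc, reassoc_of% he,
      ← Category.assoc (B.ι.map f), hr, Preadditive.add_comp]
    simp only [Category.assoc, ← Functor.map_comp, homOfLE_comp]
  · rw [Preadditive.add_comp, Functor.map_add, Functor.map_comp (P.inverseImage B.ι).trW.Q g',
      ← h₂', Functor.map_comp (P.inverseImage B.ι).trW.Q g, ← h₂, Category.assoc, Category.assoc,
      ← Functor.map_comp, hf, Functor.map_comp]

/-- The cone of `h` is in `factorProp P S`, by two out of three from `s` and `T.σ p`. So `g`, which
`h` kills, factors through an object of `P` and vanishes in the quotient. -/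
lemma Rep.eq_zero (hPS : P ≤ S) (hPB : P ≤ B)
    (hS : ∀ T ∈ distTriang C, S T.obj₁ → P T.obj₂ → S T.obj₃) {p : ℕ}
    {ψ : (P.inverseImage B.ι).trW.Q.obj X₀ ⟶ (P.inverseImage B.ι).trW.Q.obj X₁}
    (hψ : T.Rep p 0 ψ) : ψ = 0 := by
  obtain ⟨Y, s, hs, g, h, h₁, h₁', h₂⟩ := hψ
  have := factorProp_isTriangulated hPS hS
  have hh : (factorProp P S).trW h := trW_of_comp_left (B.ι.map s) h
    (ObjectProperty.trW_monotone (le_factorProp S) _ ((P.inverseImage_trW_iff B.ι s).1 hs))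
    (h₁ ▸ T.σ_trW p)
  obtain ⟨K, hK, u, v, huv⟩ := factorsThrough_of_comp_eq_zero h hh T.mem _ h₁'
  let K' : B.FullSubcategory := ⟨K, hPB _ hK⟩
  have hg : g = B.fullyFaithfulι.preimage (Y := K') u ≫ B.fullyFaithfulι.preimage (X := K') v := by
    refine B.ι.map_injective ?_
    rw [Functor.map_comp, Functor.FullyFaithful.map_preimage, Functor.FullyFaithful.map_preimage, huv]
  -- The cone of `0 ⟶ K'` is `K'`, so `K'` becomes a zero object in the quotient.
  have ht : (P.inverseImage B.ι).trW (0 : 0 ⟶ K') :=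
    ⟨_, _, _, contractible_distinguished₁ K', hK⟩
  have := Localization.inverts (P.inverseImage B.ι).trW.Q _ _ ht
  have := Localization.inverts (P.inverseImage B.ι).trW.Q _ _ hs
  have hv : (P.inverseImage B.ι).trW.Q.map (B.fullyFaithfulι.preimage (X := K') v) = 0 := by
    rw [← cancel_epi ((P.inverseImage B.ι).trW.Q.map (0 : 0 ⟶ K')), ← Functor.map_comp, zero_comp,
      Functor.map_zero, comp_zero]
  rw [← cancel_mono ((P.inverseImage B.ι).trW.Q.map s), h₂, hg, Functor.map_comp, hv, comp_zero,
    zero_comp]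

/-- If the roof is zero in the quotient, `g` is killed by some `t` with cone in `P`; extending `h`
along `t` kills `c` at a later stage. -/
lemma Rep.map_eq_zero {p : ℕ} {c : B.ι.obj X₀ ⟶ T.G.obj p} (hc : T.Rep p c 0) :
    ∃ (q : ℕ) (hpq : p ≤ q), c ≫ T.G.map (homOfLE hpq) = 0 := by
  obtain ⟨Y, s, hs, g, h, h₁, rfl, h₂⟩ := hc
  rw [zero_comp, ← Functor.map_zero, MorphismProperty.map_eq_iff_postcomp _
    (P.inverseImage B.ι).trW] at h₂
  obtain ⟨Z, t, ht, hgt⟩ := h₂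
  rw [zero_comp] at hgt
  obtain ⟨q, hpq, e, he⟩ := T.exists_extension _ ((P.inverseImage_trW_iff B.ι t).1 ht) h
  refine ⟨q, hpq, ?_⟩
  rw [Category.assoc, ← he, ← Category.assoc, ← Functor.map_comp, ← hgt, Functor.map_zero, zero_comp]

variable (T)

lemma exists_rep (hPB : P ≤ B) (p : ℕ) (c : B.ι.obj X₀ ⟶ T.G.obj p) : ∃ ψ, T.Rep p c ψ := by
  obtain ⟨Y, K, s, b, δ, g, h, hT, hK, h₁, h₂⟩ :=
    exists_trW_of_trW_factorProp (T.σ p) (T.σ_trW p) T.mem c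
  -- `Y` stays in `B` although `T.G.obj p` need not: it is an extension of `K`, in `P ≤ B`, by `X₁`.
  let Y' : B.FullSubcategory := ⟨Y, B.ext_of_isTriangulatedClosed₂ _ hT X₁.property (hPB _ hK)⟩
  let s' : X₁ ⟶ Y' := B.fullyFaithfulι.preimage s
  have hs' : (P.inverseImage B.ι).trW s' := (P.inverseImage_trW_iff B.ι s').2 ⟨_, _, _, hT, hK⟩
  have := Localization.inverts (P.inverseImage B.ι).trW.Q _ s' hs'
  exact ⟨(P.inverseImage B.ι).trW.Q.map (B.fullyFaithfulι.preimage g : X₀ ⟶ Y') ≫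
    inv ((P.inverseImage B.ι).trW.Q.map s'), Y', s', hs', _, h, h₁, h₂, by
      rw [Category.assoc, IsIso.inv_hom_id]
      exact Category.comp_id _⟩

lemma exists_rep_of_hom (ψ : (P.inverseImage B.ι).trW.Q.obj X₀ ⟶ (P.inverseImage B.ι).trW.Q.obj X₁) :
    ∃ p c, T.Rep p c ψ := by
  obtain ⟨φ, hφ⟩ := Localization.exists_leftFraction (P.inverseImage B.ι).trW.Q
    (P.inverseImage B.ι).trW ψ
  -- The structure map `T.σ 0` is extended along the denominator of the fraction; its composite with
  -- the numerator is the required `c`.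
  obtain ⟨q, hpq, e, he⟩ := T.exists_extension _ ((P.inverseImage_trW_iff B.ι φ.s).1 φ.hs) (T.σ 0)
  refine ⟨q, B.ι.map φ.f ≫ e, _, φ.s, φ.hs, φ.f, e, he.trans (T.σ_map _), rfl, ?_⟩
  rw [hφ]
  simp

/-- The morphisms `X₀ ⟶ X₁` of the Verdier quotient by `P` are the colimit of the groups of
morphisms `X₀ ⟶ G p`. -/
theorem exists_linearEquiv {k : Type x} [Ring k] [Linear k C] (hPS : P ≤ S) (hPB : P ≤ B)
    (hS : ∀ T ∈ distTriang C, S T.obj₁ → P T.obj₂ → S T.obj₃) {M : Type*} [AddCommGroup M]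
    [Module k M] (j : ∀ p, (B.ι.obj X₀ ⟶ T.G.obj p) →ₗ[k] M)
    (hj : ∀ {p q : ℕ} (h : p ≤ q) (c : B.ι.obj X₀ ⟶ T.G.obj p),
      j q (c ≫ T.G.map (homOfLE h)) = j p c)
    (hsurj : ∀ x, ∃ p c, j p c = x)
    (hker : ∀ (p : ℕ) (c : B.ι.obj X₀ ⟶ T.G.obj p), j p c = 0 →
      ∃ (q : ℕ) (h : p ≤ q), c ≫ T.G.map (homOfLE h) = 0) :
    ∃ Φ : M ≃ₗ[k] ((P.inverseImage B.ι).trW.Q.obj X₀ ⟶ (P.inverseImage B.ι).trW.Q.obj X₁),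
      ∀ p c ψ, T.Rep p c ψ ↔ Φ (j p c) = ψ := by
  have uniq {p p' : ℕ} {c : B.ι.obj X₀ ⟶ T.G.obj p} {c' : B.ι.obj X₀ ⟶ T.G.obj p'}
      {ψ ψ' : (P.inverseImage B.ι).trW.Q.obj X₀ ⟶ (P.inverseImage B.ι).trW.Q.obj X₁}
      (h : T.Rep p c ψ) (h' : T.Rep p' c' ψ') (hc : j p c = j p' c') : ψ = ψ' := by
    -- The difference `ψ - ψ'` is represented by the difference of `c` and `c'`, which by `hker`
    -- vanishes at a later stage, so that `Rep.eq_zero` applies.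
    obtain ⟨q, hq, H⟩ := (h.map (le_max_left p p')).add
      ((h'.map (le_max_right p p')).smul (-1 : k))
    obtain ⟨r, hr, hr'⟩ := hker q ((c ≫ T.G.map (homOfLE (le_max_left p p')) +
        (-1 : k) • c' ≫ T.G.map (homOfLE (le_max_right p p'))) ≫ T.G.map (homOfLE hq)) (by
      rw [hj, map_add, map_smul, hj, hj, hc, neg_one_smul, add_neg_cancel])
    have h₀ := H.map hr
    rw [hr'] at h₀
    have := h₀.eq_zero hPS hPB hS
    rwa [neg_one_smul, add_neg_eq_zero] at this
  have ex (x : M) : ∃ p c ψ, j p c = x ∧ T.Rep p c ψ := by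
    obtain ⟨p, c, hc⟩ := hsurj x
    obtain ⟨ψ, hψ⟩ := T.exists_rep hPB p c
    exact ⟨p, c, ψ, hc, hψ⟩
  choose p c f hc hf using ex
  let Φ : M →ₗ[k] ((P.inverseImage B.ι).trW.Q.obj X₀ ⟶ (P.inverseImage B.ι).trW.Q.obj X₁) :=
    { toFun := f
      map_add' := fun x y ↦ by
        obtain ⟨q, hq, H⟩ := ((hf x).map (le_max_left _ (p y))).add
          ((hf y).map (le_max_right (p x) _))
        exact uniq (hf _) H (by rw [hj, map_add, hj, hj, hc, hc, hc])
      map_smul' := fun a x ↦ uniq (hf _) ((hf x).smul a) (by rw [map_smul, hc, hc]) }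
  have hΦ (q : ℕ) (d) : T.Rep q d (Φ (j q d)) := by
    obtain ⟨ψ, hψ⟩ := T.exists_rep hPB q d
    rw [show Φ (j q d) = ψ from uniq (hf _) hψ (hc _)]
    exact hψ
  refine ⟨LinearEquiv.ofBijective Φ ⟨?_, fun ψ ↦ ?_⟩, fun q d ψ ↦
    ⟨fun h ↦ uniq (hΦ q d) h rfl, fun h ↦ h ▸ hΦ q d⟩⟩
  · rw [← LinearMap.ker_eq_bot, LinearMap.ker_eq_bot']
    intro x hx
    have H : T.Rep (p x) (c x) 0 := hx ▸ hf x
    obtain ⟨q, hq, H⟩ := H.map_eq_zero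
    rw [← hc x, ← hj hq, H, map_zero]
  · obtain ⟨q, d, H⟩ := T.exists_rep_of_hom ψ
    exact ⟨j q d, uniq (hΦ q d) H rfl⟩

end SyzygyTower
end Tower
end SingHoch

/-! ### Cohomology of sequential colimits of complexes -/

namespace SingHoch

open CategoryTheory Limits

section
variable {k : Type u} [Ring k]

lemma homologyπ_eq_zero_iff {ι : Type*} {c : ComplexShape ι} (K : HomologicalComplex (ModuleCat.{v} k) c)
    (i j : ι) (hij : c.prev j = i) (z : K.cycles j) :
    (K.homologyπ j).hom z = 0 ↔ ∃ y : K.X i, (K.d i j).hom y = (K.iCycles j).hom z := by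
  have hex : (ShortComplex.mk _ _ (K.toCycles_comp_homologyπ i j)).Exact :=
    ShortComplex.exact_of_g_is_cokernel _ (K.homologyIsCokernel i j hij)
  rw [ShortComplex.ShortExact.moduleCat_exact_iff_function_exact] at hex
  rw [show (K.homologyπ j).hom z = 0 ↔ _ from hex z]
  have hi : Function.Injective (K.iCycles j).hom := (ModuleCat.mono_iff_injective _).1 inferInstance
  have h (y : K.X i) : (K.iCycles j).hom ((K.toCycles i j).hom y) = (K.d i j).hom y :=
    LinearMap.congr_fun (congrArg ModuleCat.Hom.hom (K.toCycles_i i j)) y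
  exact exists_congr fun y ↦ by
    rw [← h]
    exact hi.eq_iff.symm

lemma exists_iCycles_eq {ι : Type*} {c : ComplexShape ι} (K : HomologicalComplex (ModuleCat.{v} k) c)
    (i j : ι) (hij : c.next i = j) (x : K.X i) (hx : (K.d i j).hom x = 0) :
    ∃ z : K.cycles i, (K.iCycles i).hom z = x := by
  have hex : (ShortComplex.mk _ _ (K.iCycles_d i j)).Exact :=
    ShortComplex.exact_of_f_is_kernel _ (K.cyclesIsKernel i j hij)
  rw [ShortComplex.ShortExact.moduleCat_exact_iff_function_exact] at hex
  exact (hex x).1 hx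

lemma homologyπ_surjective {ι : Type*} {c : ComplexShape ι}
    (K : HomologicalComplex (ModuleCat.{v} k) c) (i : ι) :
    Function.Surjective (K.homologyπ i).hom :=
  (ModuleCat.epi_iff_surjective _).1 inferInstance

lemma iCycles_injective {ι : Type*} {c : ComplexShape ι}
    (K : HomologicalComplex (ModuleCat.{v} k) c) (i : ι) :
    Function.Injective (K.iCycles i).hom :=
  (ModuleCat.mono_iff_injective _).1 inferInstance

/-- Colimits over ℕ are indexed in universe 0, whereas the groups live in universe `v`. -/
instance : PreservesFilteredColimitsOfSize.{0, 0} (forget AddCommGrpCat.{v}) :=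
  preservesSmallestFilteredColimits_of_preservesFilteredColimits _

variable (F : ℕ ⥤ CochainComplex (ModuleCat.{v} k) ℤ)

lemma colimit_X_exists_rep (i : ℤ) (x : (colimit F).X i) :
    ∃ (p : ℕ) (y : (F.obj p).X i), ((colimit.ι F p).f i).hom y = x := by
  obtain ⟨p, y, h⟩ := Concrete.isColimit_exists_rep
    (F ⋙ HomologicalComplex.eval (ModuleCat.{v} k) (.up ℤ) i ⋙ forget₂ _ AddCommGrpCat.{v})
    (isColimitOfPreserves (HomologicalComplex.eval (ModuleCat.{v} k) (.up ℤ) i ⋙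
      forget₂ _ AddCommGrpCat.{v}) (colimit.isColimit F)) x
  exact ⟨p, y, h⟩

variable {F}

lemma exists_map_eq_of_colimit_X_eq {i : ℤ} {p q : ℕ} (x : (F.obj p).X i) (y : (F.obj q).X i)
    (h : ((colimit.ι F p).f i).hom x = ((colimit.ι F q).f i).hom y) :
    ∃ (r : ℕ) (hp : p ≤ r) (hq : q ≤ r),
      ((F.map (homOfLE hp)).f i).hom x = ((F.map (homOfLE hq)).f i).hom y := by
  obtain ⟨r, f, g, h'⟩ := Concrete.isColimit_exists_of_rep_eq
    (F ⋙ HomologicalComplex.eval (ModuleCat.{v} k) (.up ℤ) i ⋙ forget₂ _ AddCommGrpCat.{v})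
    (isColimitOfPreserves (HomologicalComplex.eval (ModuleCat.{v} k) (.up ℤ) i ⋙
      forget₂ _ AddCommGrpCat.{v}) (colimit.isColimit F)) x y h
  exact ⟨r, leOfHom f, leOfHom g, h'⟩

lemma hom_f_d {K L : CochainComplex (ModuleCat.{v} k) ℤ} (φ : K ⟶ L) (i j : ℤ) (x : K.X i) :
    (L.d i j).hom ((φ.f i).hom x) = (φ.f j).hom ((K.d i j).hom x) :=
  LinearMap.congr_fun (congrArg ModuleCat.Hom.hom (φ.comm i j)) x

lemma iCycles_cyclesMap {K L : CochainComplex (ModuleCat.{v} k) ℤ} (φ : K ⟶ L) (i : ℤ)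
    (z : K.cycles i) :
    (L.iCycles i).hom ((HomologicalComplex.cyclesMap φ i).hom z) = (φ.f i).hom ((K.iCycles i).hom z) :=
  LinearMap.congr_fun (congrArg ModuleCat.Hom.hom (HomologicalComplex.cyclesMap_i φ i)) z

lemma homologyMap_homologyπ {K L : CochainComplex (ModuleCat.{v} k) ℤ} (φ : K ⟶ L) (i : ℤ)
    (z : K.cycles i) :
    (HomologicalComplex.homologyMap φ i).hom ((K.homologyπ i).hom z) =
      (L.homologyπ i).hom ((HomologicalComplex.cyclesMap φ i).hom z) :=
  LinearMap.congr_fun (congrArg ModuleCat.Hom.hom (HomologicalComplex.homologyπ_naturality φ i)) z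

lemma map_colimit_ι_f {p q : ℕ} (h : p ≤ q) (i : ℤ) (x : (F.obj p).X i) :
    ((colimit.ι F q).f i).hom (((F.map (homOfLE h)).f i).hom x) = ((colimit.ι F p).f i).hom x :=
  LinearMap.congr_fun (congrArg ModuleCat.Hom.hom
    (congrArg (fun φ ↦ HomologicalComplex.Hom.f φ i) (colimit.w F (homOfLE h)))) x

/-- Any cohomology class of the colimit of a sequence of complexes comes from a finite stage. -/
lemma colimit_homology_exists_rep (i : ℤ) (x : (colimit F).homology i) :
    ∃ (p : ℕ) (y : (F.obj p).homology i),
      (HomologicalComplex.homologyMap (colimit.ι F p) i).hom y = x := by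
  obtain ⟨z, rfl⟩ := homologyπ_surjective _ i x
  obtain ⟨p, y, hy⟩ := colimit_X_exists_rep F i (((colimit F).iCycles i).hom z)
  -- The cochain `y` over the cocycle need not be a cocycle at stage `p`, but its differential
  -- vanishes in the colimit, hence at some later stage.
  have hd : (((colimit.ι F p)).f (i + 1)).hom (((F.obj p).d i (i + 1)).hom y) =
      (((colimit.ι F p)).f (i + 1)).hom 0 := by
    rw [← hom_f_d, hy, map_zero]
    exact LinearMap.congr_fun (congrArg ModuleCat.Hom.hom ((colimit F).iCycles_d i (i + 1))) z
  obtain ⟨q, hq, hq', h⟩ := exists_map_eq_of_colimit_X_eq _ _ hd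
  rw [map_zero, ← hom_f_d] at h
  obtain ⟨w, hw⟩ := exists_iCycles_eq _ i (i + 1) (by simp) _ h
  refine ⟨q, ((F.obj q).homologyπ i).hom w, ?_⟩
  rw [homologyMap_homologyπ]
  congr 1
  refine iCycles_injective _ _ ?_
  rw [iCycles_cyclesMap, hw, map_colimit_ι_f, hy]

/-- A cohomology class which vanishes in the colimit of a sequence of complexes vanishes at a finite
stage. -/
lemma exists_homologyMap_eq_zero {i : ℤ} {p : ℕ} (x : (F.obj p).homology i)
    (hx : (HomologicalComplex.homologyMap (colimit.ι F p) i).hom x = 0) :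
    ∃ (q : ℕ) (h : p ≤ q), (HomologicalComplex.homologyMap (F.map (homOfLE h)) i).hom x = 0 := by
  obtain ⟨z, rfl⟩ := homologyπ_surjective _ i x
  rw [homologyMap_homologyπ, homologyπ_eq_zero_iff _ (i - 1) i (by simp)] at hx
  obtain ⟨w, hw⟩ := hx
  obtain ⟨q, y, rfl⟩ := colimit_X_exists_rep F (i - 1) w
  rw [hom_f_d, iCycles_cyclesMap] at hw
  obtain ⟨r, hq, hp, h⟩ := exists_map_eq_of_colimit_X_eq _ _ hw
  refine ⟨r, hp, ?_⟩
  rw [homologyMap_homologyπ, homologyπ_eq_zero_iff _ (i - 1) i (by simp)]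
  exact ⟨((F.map (homOfLE hq)).f (i - 1)).hom y, by rw [hom_f_d, iCycles_cyclesMap, h]⟩

end
end SingHoch

/-! ### Hochschild cohomology with coefficients in Ω^p as morphisms in the derived category -/

namespace SingHoch

open CategoryTheory Limits Pretriangulated DerivedCategory Abelian TensorProduct MulOpposite

section

lemma smul_extMk {k C : Type*} [Ring k] [Category* C] [Abelian C] [Linear k C] [HasExt C] {X Y : C}
    (R : ProjectiveResolution X) {n : ℕ} (a : k) (f : R.complex.X n ⟶ Y) (m : ℕ) (hm : n + 1 = m)
    (hf : R.complex.d m n ≫ f = 0) :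
    a • R.extMk f m hm hf = R.extMk (a • f) m hm (by rw [Linear.comp_smul, hf, smul_zero]) := by
  rw [Ext.smul_eq_comp_mk₀, R.extMk_comp_mk₀]
  congr 1
  rw [Linear.comp_smul, Category.comp_id]

variable (k : Type u) (A : Type v) [Field k] [Ring A] [Algebra k A]

lemma barResolution_d_barAct (p : ℕ) :
    (barResolution k A).complex.d (p + 1) p ≫ barAct k A p = 0 :=
  (barResolution_d_comp p (barAct k A p)).trans (barD_barAct k A p)

variable {k A}

/-- A cocycle on Bar_0 vanishes on the image of the differential, which is the kernel Ω^1 of the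
augmentation Bar_0 → A. -/
lemma exists_barAct_comp_eq {X : ModuleCat.{v} (Env k A)} (f : Bar k A 0 ⟶ X)
    (hf : (barResolution k A).complex.d 1 0 ≫ f = 0) : ∃ f' : Ω k A 0 ⟶ X, barAct k A 0 ≫ f' = f := by
  have : Epi (barAct k A 1) := (ModuleCat.epi_iff_surjective _).2 (barAct_surjective k A 1)
  have h' : barIncl k A 0 ≫ f = 0 := by
    rw [← cancel_epi (barAct k A 1), comp_zero]
    exact barAct_barIncl_comp f hf
  have hS := barShortComplex_shortExact k A 0
  have := hS.epi_g
  exact ⟨hS.exact.desc f h', hS.exact.g_desc f h'⟩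

variable (k A) in
lemma extMk_barAct_zero : (barResolution k A).extMk (barAct k A 0) 1 rfl
    (barResolution_d_barAct k A 0) = Ext.mk₀ (𝟙 (Ω k A 0)) :=
  extMk_augmentation _ _ _ (ChainComplex.toSingle₀Equiv_symm_apply_f_zero _ _)

/-- In degree 0 there are no coboundaries: the cocycle descends to a bimodule map from A, and such
maps embed into the degree 0 Ext group. -/
lemma extMk_zero_eq_zero_iff {X : ModuleCat.{v} (Env k A)} (f : Bar k A 0 ⟶ X)
    (hf : (barResolution k A).complex.d 1 0 ≫ f = 0) :
    (barResolution k A).extMk f 1 rfl hf = 0 ↔ f = 0 := by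
  refine ⟨fun h ↦ ?_, ?_⟩
  · obtain ⟨g, rfl⟩ := exists_barAct_comp_eq f hf
    have h' := (barResolution k A).extMk_comp_mk₀ (barAct k A 0) 1 rfl
      (barResolution_d_barAct k A 0) g
    rw [extMk_barAct_zero, Ext.mk₀_comp_mk₀, Category.id_comp] at h'
    rw [(Ext.mk₀_eq_zero_iff g).1 (h'.trans h), comp_zero]
  · rintro rfl
    exact (barResolution k A).extMk_zero _ _

end

section

variable {k : Type u} {A : Type v} [Field k] [Ring A] [Algebra k A]

/-- The index type of `Cochains` has at most one element. -/
lemma cochains_ext {p : ℕ} {m : ℤ} {c c' : Cochains k A p m} (n : ℕ) (hn : (n : ℤ) = m + p)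
    (h : c ⟨n, hn⟩ = c' ⟨n, hn⟩) : c = c' := by
  funext ⟨n', hn'⟩
  obtain rfl : n' = n := by lia
  exact h

lemma exists_cochain {p : ℕ} {m : ℤ} (n : ℕ) (hn : (n : ℤ) = m + p) (f : BarHom k A n p) :
    ∃ c : Cochains k A p m, c ⟨n, hn⟩ = f := by
  classical
  exact ⟨Pi.single ⟨n, hn⟩ f, Pi.single_eq_same _ _⟩

lemma exists_cycle {p : ℕ} {m : ℤ} (n : ℕ) (hn : (n : ℤ) = m + p) (f : BarHom k A n p)
    (hf : (barResolution k A).complex.d (n + 1) n ≫ f.hom = 0) :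
    ∃ z : (hochComplex k A p).cycles m, cocycleHom z n hn = f := by
  obtain ⟨c, hc⟩ := exists_cochain n hn f
  obtain ⟨z, hz⟩ := exists_iCycles_eq (hochComplex k A p) m (m + 1) (by simp) c (by
    rw [hochComplex_d k A p m (m + 1) rfl]
    refine cochains_ext (n + 1) (by push_cast; lia) ?_
    refine (cochainsD_succ k A p m (m + 1) rfl c n hn _).trans ?_
    rw [hc, show barPrecomp k A n p f = 0 from (barResolution_d_comp n f.hom).symm.trans hf, smul_zero]
    rfl)
  exact ⟨z, (congrFun hz ⟨n, hn⟩).trans hc⟩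

lemma homologyπ_eq_zero_iff_of_eq_zero {p : ℕ} {m : ℤ} (z : (hochComplex k A p).cycles m)
    (hn : ((0 : ℕ) : ℤ) = m + p) :
    ((hochComplex k A p).homologyπ m).hom z = 0 ↔ cocycleHom z 0 hn = 0 := by
  rw [homologyπ_eq_zero_iff _ (m - 1) m (by simp), hochComplex_d k A p (m - 1) m (by lia)]
  constructor
  · rintro ⟨y, hy⟩
    exact (congrFun hy ⟨0, hn⟩).symm.trans (cochainsD_zero k A p (m - 1) m (by lia) y hn)
  · intro h
    exact ⟨0, (map_zero _).trans (cochains_ext 0 hn h.symm)⟩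

lemma homologyπ_eq_zero_iff_of_eq_succ {p : ℕ} {m : ℤ} (z : (hochComplex k A p).cycles m) (n : ℕ)
    (hn : ((n + 1 : ℕ) : ℤ) = m + p) :
    ((hochComplex k A p).homologyπ m).hom z = 0 ↔
      ∃ g : BarHom k A n p, (barResolution k A).complex.d (n + 1) n ≫ g.hom =
        (cocycleHom z (n + 1) hn).hom := by
  rw [homologyπ_eq_zero_iff _ (m - 1) m (by simp), hochComplex_d k A p (m - 1) m (by lia)]
  have hn' : (n : ℤ) = m - 1 + p := by push_cast at hn; lia
  constructor
  · rintro ⟨y, hy⟩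
    refine ⟨(m.negOnePow : ℤ) • y ⟨n, hn'⟩, (barResolution_d_comp n _).trans ?_⟩
    refine Eq.trans ?_ ((cochainsD_succ k A p (m - 1) m (by lia) y n hn' hn).symm.trans
      (congrFun hy ⟨n + 1, hn⟩))
    exact map_zsmul (barPrecomp k A n p) _ _
  · rintro ⟨g, hg⟩
    -- The sign `m.negOnePow` in the Hochschild differential squares to 1, so it can be absorbed in
    -- the cochain.
    obtain ⟨c, hc⟩ := exists_cochain (m := m - 1) n hn' ((m.negOnePow : ℤ) • g)
    refine ⟨c, cochains_ext (n + 1) hn ?_⟩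
    refine (cochainsD_succ k A p (m - 1) m (by lia) c n hn' hn).trans ?_
    rw [hc, map_zsmul, smul_smul, ← Units.val_mul, Int.units_mul_self, Units.val_one, one_smul]
    exact (barResolution_d_comp n g.hom).symm.trans hg

end

section

variable {k : Type u} {A : Type v} [Field k] [Ring A] [Algebra k A]
  [HasDerivedCategory.{w} (ModuleCat.{v} (Env k A))]

lemma cocycleClass_eq_zero_iff {p : ℕ} {m : ℤ} (z : (hochComplex k A p).cycles m) (n : ℕ)
    (hn : (n : ℤ) = m + p) :
    cocycleClass k A z n hn = 0 ↔ ((hochComplex k A p).homologyπ m).hom z = 0 := by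
  have h : cocycleClass k A z n hn = 0 ↔ (barResolution k A).extMk (cocycleHom z n hn).hom (n + 1)
      rfl (d_cocycleHom k A z n hn) = 0 := by
    rw [cocycleClass]
    exact (map_eq_zero_iff (Ext.homAddEquiv) (Ext.homAddEquiv).injective)
  rw [h]
  match n, hn with
  | 0, hn =>
    rw [homologyπ_eq_zero_iff_of_eq_zero z hn]
    exact extMk_zero_eq_zero_iff _ _
  | n + 1, hn =>
    rw [homologyπ_eq_zero_iff_of_eq_succ z n hn]
    exact (barResolution k A).extMk_eq_zero_iff _ _ _ _ n rfl

lemma cocycleClass_add {p : ℕ} {m : ℤ} (z z' : (hochComplex k A p).cycles m) (n : ℕ)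
    (hn : (n : ℤ) = m + p) :
    cocycleClass k A (z + z') n hn = cocycleClass k A z n hn + cocycleClass k A z' n hn := by
  have h : cocycleHom (z + z') n hn = cocycleHom z n hn + cocycleHom z' n hn :=
    congrFun (map_add ((hochComplex k A p).iCycles m).hom z z') ⟨n, hn⟩
  have h' := congrArg Ext.hom ((barResolution k A).add_extMk (cocycleHom z n hn).hom
    (cocycleHom z' n hn).hom (n + 1) rfl (d_cocycleHom k A z n hn) (d_cocycleHom k A z' n hn))
  rw [Ext.add_hom] at h'
  refine Eq.trans ?_ h'.symm
  rw [cocycleClass]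
  congr 2

lemma cocycleClass_smul {p : ℕ} {m : ℤ} (a : k) (z : (hochComplex k A p).cycles m) (n : ℕ)
    (hn : (n : ℤ) = m + p) :
    cocycleClass k A (a • z) n hn = a • cocycleClass k A z n hn := by
  have h : cocycleHom (a • z) n hn = a • cocycleHom z n hn :=
    congrFun (map_smul ((hochComplex k A p).iCycles m).hom a z) ⟨n, hn⟩
  have h' := congrArg Ext.hom (smul_extMk (barResolution k A) a (cocycleHom z n hn).hom
    (n + 1) rfl (d_cocycleHom k A z n hn))
  rw [Ext.smul_hom] at h'
  refine Eq.trans ?_ h'.symm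
  rw [cocycleClass]
  congr 2

lemma exists_cocycleClass_eq {p : ℕ} (m : ℤ) (n : ℕ) (hn : (n : ℤ) = m + p)
    (φ : single k A (Ω k A 0) ⟶ (single k A (Ω k A p))⟦(n : ℤ)⟧) :
    ∃ z : (hochComplex k A p).cycles m, cocycleClass k A z n hn = φ := by
  obtain ⟨α, rfl⟩ := (Ext.homEquiv (X := Ω k A 0) (Y := Ω k A p)).surjective φ
  obtain ⟨f, hf, rfl⟩ := (barResolution k A).extMk_surjective α (n + 1) rfl
  obtain ⟨z, hz⟩ := exists_cycle n hn f hf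
  refine ⟨z, ?_⟩
  change (ProjectiveResolution.extMk _ _ _ _ _).hom = (ProjectiveResolution.extMk _ _ _ _ _).hom
  congr 2

lemma subsingleton_hom_of_neg (p : ℕ) (m : ℤ) (h : m + p < 0) :
    Subsingleton (single k A (Ω k A 0) ⟶ (shiftedForms k A p)⟦m⟧) := by
  refine subsingleton_of_forall_eq 0 fun f ↦ ?_
  rw [← cancel_mono ((shiftFunctorAdd' (DerivedCategory (ModuleCat.{v} (Env k A))) (p : ℤ) m _
    rfl).inv.app (single k A (Ω k A p))), zero_comp]
  exact singleFunctor_hom_eq_zero _ _ _ (by lia) _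

end

section

variable (k : Type u) (A : Type v) [Field k] [Ring A] [Algebra k A]

lemma subsingleton_HH_of_neg (p : ℕ) (m : ℤ) (h : m + p < 0) : Subsingleton (HH k A p m) := by
  refine subsingleton_of_forall_eq 0 fun x ↦ ?_
  obtain ⟨z, rfl⟩ := homologyπ_surjective _ _ x
  have : z = 0 := by
    refine iCycles_injective _ _ ?_
    funext ⟨n, hn⟩
    lia
  exact (congrArg _ this).trans (map_zero _)

variable [HasDerivedCategory.{w} (ModuleCat.{v} (Env k A))]

/-- The Hochschild cohomology `HH^m(A, Ω^p)` consists of the morphisms `A → Ω^p[p][m]` in the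
derived category. -/
lemma exists_cohomology_equiv (p : ℕ) (m : ℤ) :
    ∃ E : HH k A p m ≃ₗ[k] (single k A (Ω k A 0) ⟶ (shiftedForms k A p)⟦m⟧),
      ∀ (z : (hochComplex k A p).cycles m) (n : ℕ) (hn : (n : ℤ) = m + p),
        E (((hochComplex k A p).homologyπ m).hom z) = shiftedClass k A z n hn := by
  -- For `m + p < 0` there are no nonzero cochains, and the negative Ext groups of modules vanish as
  -- well.
  rcases lt_or_ge (m + p) 0 with h | h
  · have := subsingleton_hom_of_neg (k := k) (A := A) p m h
    have := subsingleton_HH_of_neg k A p m h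
    exact ⟨⟨0, 0, fun _ ↦ Subsingleton.elim _ _, fun _ ↦ Subsingleton.elim _ _⟩,
      fun z n hn ↦ Subsingleton.elim _ _⟩
  · obtain ⟨n, hn⟩ := Int.eq_ofNat_of_zero_le h
    have hn : (n : ℤ) = m + p := hn.symm
    let i := (shiftFunctorAdd' (DerivedCategory (ModuleCat.{v} (Env k A))) (p : ℤ) m (n : ℤ)
      (by lia)).app (single k A (Ω k A p))
    let c : (hochComplex k A p).cycles m →ₗ[k] (single k A (Ω k A 0) ⟶ (shiftedForms k A p)⟦m⟧) :=
      { toFun z := shiftedClass k A z n hn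
        map_add' z z' := by
          rw [shiftedClass, cocycleClass_add, Preadditive.add_comp]
          rfl
        map_smul' a z := by
          rw [shiftedClass, cocycleClass_smul, Linear.smul_comp]
          rfl }
    have hc : Function.Surjective c := fun φ ↦ by
      obtain ⟨z, hz⟩ := exists_cocycleClass_eq m n hn (φ ≫ i.inv)
      refine ⟨z, ?_⟩
      change cocycleClass k A z n hn ≫ i.hom = φ
      rw [hz, Category.assoc, i.inv_hom_id]
      exact Category.comp_id φ
    -- Both surjections from cocycles have the same kernel, so both targets are the quotient by it.
    have hk : LinearMap.ker ((hochComplex k A p).homologyπ m).hom = LinearMap.ker c := by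
      ext z
      rw [LinearMap.mem_ker, LinearMap.mem_ker, ← cocycleClass_eq_zero_iff z n hn]
      change _ ↔ cocycleClass k A z n hn ≫ i.hom = 0
      rw [← cancel_mono i.hom, zero_comp]
    let E := (LinearMap.quotKerEquivOfSurjective _
      (homologyπ_surjective (hochComplex k A p) m)).symm ≪≫ₗ
        Submodule.quotEquivOfEq _ _ hk ≪≫ₗ LinearMap.quotKerEquivOfSurjective c hc
    refine ⟨E, fun z n' hn' ↦ ?_⟩
    obtain rfl : n' = n := by lia
    have : (LinearMap.quotKerEquivOfSurjective _
      (homologyπ_surjective (hochComplex k A p) m)).symm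
        (((hochComplex k A p).homologyπ m).hom z) = Submodule.Quotient.mk z := by
      rw [LinearEquiv.symm_apply_eq]
      rfl
    change LinearMap.quotKerEquivOfSurjective c hc (Submodule.quotEquivOfEq _ _ hk
      ((LinearMap.quotKerEquivOfSurjective _ (homologyπ_surjective (hochComplex k A p) m)).symm
        (((hochComplex k A p).homologyπ m).hom z))) = _
    rw [this]
    rfl

end

end SingHoch

/-! ### The syzygy tower under A[m] -/

namespace SingHoch

open CategoryTheory Limits Pretriangulated DerivedCategory Abelian TensorProduct MulOpposite

section

universe v' u'

lemma shiftFunctorAdd'_zero_hom_app {C : Type u'} [Category.{v'} C] [HasShift C ℤ] (a : ℤ) (ha : a = 0)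
    (m : ℤ) (X : C) :
    (shiftFunctorAdd' C a m m (by lia)).hom.app X = ((shiftFunctorZero' C a ha).inv.app X)⟦m⟧' := by
  subst ha
  rw [shiftFunctorAdd'_zero_add_hom_app]
  simp [shiftFunctorZero']

variable (k : Type u) (A : Type v) [Field k] [Ring A] [Algebra k A]

variable [HasDerivedCategory.{w} (ModuleCat.{v} (Env k A))]

lemma syzygyClass_zero : syzygyClass k A 0 =
    (shiftFunctorZero' (DerivedCategory (ModuleCat.{v} (Env k A))) ((0 : ℕ) : ℤ) rfl).inv.app
      (single k A (Ω k A 0)) := by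
  refine (congrArg Ext.hom (extMk_barAct_zero k A)).trans ?_
  rw [Ext.mk₀_hom, ShiftedHom.mk₀, CategoryTheory.Functor.map_id]
  exact Category.id_comp _

lemma shift_syzygyClass_zero (m : ℤ) : (syzygyClass k A 0)⟦m⟧' =
    (shiftFunctorAdd' (DerivedCategory (ModuleCat.{v} (Env k A))) ((0 : ℕ) : ℤ) m m
      (by lia)).hom.app (single k A (Ω k A 0)) := by
  rw [syzygyClass_zero, ← shiftFunctorAdd'_zero_hom_app]

instance : IsIso (syzygyClass k A 0) := by
  rw [syzygyClass_zero]
  infer_instance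

instance : (factorProp (perf (Env k A)) (finApprox (Env k A))).IsTriangulated :=
  factorProp_isTriangulated perf_le_finApprox
    (fun T hT h₁ h₂ ↦ finApprox_ext₃ T hT h₁ (perf_le_finApprox _ h₂))

/-- Rotating the triangle of the bar extension exhibits Bar_p as the fibre of Ω^p → Ω^{p+1}[1], and
Bar_p is projective. -/
lemma trW_barExt_hom (p : ℕ) :
    (factorProp (perf (Env k A)) (finApprox (Env k A))).trW (barExt k A p).hom := by
  have : Module.Projective (Env k A) (Bar k A p) :=
    (IsProjective.iff_projective (Bar k A p)).2 inferInstance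
  have h := (barShortComplex_shortExact k A p).extClass_hom
  refine h.symm ▸ ObjectProperty.trW.mk' _
    (rot_of_distTriang _ (barShortComplex_shortExact k A p).singleTriangle_distinguished) ?_
  exact factorProp_single (Bar k A p)

lemma trW_syzygyStep (p : ℕ) :
    (factorProp (perf (Env k A)) (finApprox (Env k A))).trW (syzygyStep k A p) :=
  MorphismProperty.comp_mem _ _ _ ((trW_barExt_hom k A p).shift p)
    (ObjectProperty.trW_of_isIso _ _)

lemma trW_syzygyClass (p : ℕ) :
    (factorProp (perf (Env k A)) (finApprox (Env k A))).trW (syzygyClass k A p) := by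
  induction p with
  | zero => exact ObjectProperty.trW_of_isIso _ _
  | succ p hp =>
    rw [← syzygyClass_comp_syzygyStep]
    exact MorphismProperty.comp_mem _ _ _ hp (trW_syzygyStep k A p)

lemma exists_hom_shiftedForms_eq_zero (m : ℤ) {K : DerivedCategory (ModuleCat.{v} (Env k A))}
    (hK : perf (Env k A) K) :
    ∃ N : ℕ, ∀ p : ℕ, N ≤ p → ∀ f : K ⟶ (shiftedForms k A p)⟦m⟧, f = 0 := by
  obtain ⟨N, hN⟩ := perf_hom_eq_zero hK
  -- The target is Ω^p placed in the shift `p + m`, which has to be at least `N`.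
  refine ⟨(N - m).toNat, fun p hp f ↦ ?_⟩
  let e := (shiftFunctorAdd' (DerivedCategory (ModuleCat.{v} (Env k A))) (p : ℤ) m (p + m) rfl).app
    (single k A (Ω k A p))
  rw [← cancel_mono e.inv, zero_comp]
  exact hN _ (by lia) _ (f ≫ e.inv)

variable [IsNoetherianRing (Env k A)]

/-- The tower `Ω^0[0][m] → Ω^1[1][m] → Ω^2[2][m] → ⋯` under `A[m]`. -/
noncomputable def syzygyTower (m : ℤ) :
    SyzygyTower (perf (Env k A)) (finApprox (Env k A)) (dbProp (Env k A)) (diag k A)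
      ((diag k A)⟦m⟧) where
  G := Functor.ofSequence (X := fun p ↦ (shiftedForms k A p)⟦m⟧) (fun p ↦ (syzygyStep k A p)⟦m⟧')
  σ p := ((dbProp (Env k A)).ι.commShiftIso m).hom.app (diag k A) ≫ (syzygyClass k A p)⟦m⟧'
  σ_map {p q} h := by
    induction q, h using Nat.le_induction with
    | base =>
      refine (congrArg _ (CategoryTheory.Functor.map_id _ _)).trans (Category.comp_id _)
    | succ q h ih =>
      rw [← homOfLE_comp h (Nat.le_add_right q 1), Functor.map_comp, ← Category.assoc, ih,
        Functor.ofSequence_map_homOfLE_succ]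
      refine (Category.assoc _ _ _).trans (congrArg (_ ≫ ·) ?_)
      exact (Functor.map_comp _ _ _).symm.trans
        (congrArg _ (syzygyClass_comp_syzygyStep k A q))
  σ_trW p := MorphismProperty.comp_mem _ _ _ (ObjectProperty.trW_of_isIso _ _)
    ((trW_syzygyClass k A p).shift m)
  hom_eq_zero hK := exists_hom_shiftedForms_eq_zero k A m hK
  mem := by
    have : Module.Finite (Env k A) (Ω k A 0) := finite_self k A
    exact finApprox_single (Ω k A 0)

end
end SingHoch

/-! ### Singular Hochschild cohomology as the colimit along the tower -/

namespace SingHoch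

open CategoryTheory Limits Pretriangulated DerivedCategory Abelian TensorProduct MulOpposite

section

variable (k : Type u) (A : Type v) [Field k] [Ring A] [Algebra k A]
  [HasDerivedCategory.{w} (ModuleCat.{v} (Env k A))]

/-- The isomorphism between `HH^m(A, Ω^p)` and the morphisms `A → Ω^p[p][m]` given by the bar
resolution. -/
noncomputable def cohomologyEquiv (p : ℕ) (m : ℤ) :
    HH k A p m ≃ₗ[k] (single k A (Ω k A 0) ⟶ (shiftedForms k A p)⟦m⟧) :=
  (exists_cohomology_equiv k A p m).choose

lemma cohomologyEquiv_homologyπ {p : ℕ} {m : ℤ} (z : (hochComplex k A p).cycles m) (n : ℕ)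
    (hn : (n : ℤ) = m + p) :
    cohomologyEquiv k A p m (((hochComplex k A p).homologyπ m).hom z) = shiftedClass k A z n hn :=
  (exists_cohomology_equiv k A p m).choose_spec z n hn

lemma cohomologyEquiv_homologyMap_theta {p : ℕ} {m : ℤ} (x : HH k A p m) :
    cohomologyEquiv k A (p + 1) m ((HomologicalComplex.homologyMap (theta k A p) m).hom x) =
      cohomologyEquiv k A p m x ≫ (syzygyStep k A p)⟦m⟧' := by
  -- For `m + p < 0` no index `n = m + p` exists, so `shiftedClass` is not available; but the source
  -- is zero.
  rcases lt_or_ge (m + p) 0 with h | h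
  · have := subsingleton_HH_of_neg k A p m h
    obtain rfl : x = 0 := Subsingleton.elim _ _
    rw [map_zero, map_zero, map_zero, zero_comp]
  · obtain ⟨n, hn⟩ := Int.eq_ofNat_of_zero_le h
    obtain ⟨z, rfl⟩ := homologyπ_surjective _ m x
    rw [homologyMap_homologyπ, cohomologyEquiv_homologyπ k A z n hn.symm]
    refine (cohomologyEquiv_homologyπ k A _ (n + 1) (by push_cast; lia)).trans ?_
    exact (shiftedClass_comp_syzygyStep z n hn.symm).symm

variable [IsNoetherianRing (Env k A)]

lemma cohomologyEquiv_homologyMap {p q : ℕ} (h : p ≤ q) {m : ℤ} (x : HH k A p m) :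
    cohomologyEquiv k A q m ((HomologicalComplex.homologyMap
      ((Functor.ofSequence (theta k A)).map (homOfLE h)) m).hom x) =
      (cohomologyEquiv k A p m x ≫ (syzygyTower k A m).G.map (homOfLE h) :
        single k A (Ω k A 0) ⟶ (shiftedForms k A q)⟦m⟧) := by
  induction q, h using Nat.le_induction with
  | base =>
    have h₁ : (HomologicalComplex.homologyMap
        ((Functor.ofSequence (theta k A)).map (homOfLE le_rfl)) m).hom x = x :=
      LinearMap.congr_fun (g := LinearMap.id) (congrArg ModuleCat.Hom.hom
        ((congrArg (HomologicalComplex.homologyMap · m)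
          ((Functor.ofSequence (theta k A)).map_id p)).trans
          (HomologicalComplex.homologyMap_id (hochComplex k A p) m))) x
    have h₂ : (syzygyTower k A m).G.map (homOfLE le_rfl) = 𝟙 ((shiftedForms k A p)⟦m⟧) :=
      CategoryTheory.Functor.map_id _ _
    rw [h₂]
    exact (congrArg _ h₁).trans (Category.comp_id _).symm
  | succ q h ih =>
    have h₁ : (Functor.ofSequence (theta k A)).map (homOfLE (h.trans (Nat.le_add_right q 1))) =
        (Functor.ofSequence (theta k A)).map (homOfLE h) ≫ theta k A q := by
      rw [← homOfLE_comp h (Nat.le_add_right q 1), Functor.map_comp,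
        Functor.ofSequence_map_homOfLE_succ]
      rfl
    have h₁' : (HomologicalComplex.homologyMap ((Functor.ofSequence (theta k A)).map
          (homOfLE (h.trans (Nat.le_add_right q 1)))) m).hom x =
        (HomologicalComplex.homologyMap (theta k A q) m).hom ((HomologicalComplex.homologyMap
          ((Functor.ofSequence (theta k A)).map (homOfLE h)) m).hom x) :=
      LinearMap.congr_fun (congrArg ModuleCat.Hom.hom
        ((congrArg (HomologicalComplex.homologyMap · m) h₁).trans
          (HomologicalComplex.homologyMap_comp _ _ m))) x
    have h₂ : (syzygyTower k A m).G.map (homOfLE (h.trans (Nat.le_add_right q 1))) =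
        (syzygyTower k A m).G.map (homOfLE h) ≫ (syzygyStep k A q)⟦m⟧' := by
      rw [← homOfLE_comp h (Nat.le_add_right q 1), Functor.map_comp]
      exact congrArg (_ ≫ ·) (Functor.ofSequence_map_homOfLE_succ _ _)
    refine (congrArg _ h₁').trans ((cohomologyEquiv_homologyMap_theta k A _).trans ?_)
    refine (congrArg (· ≫ (syzygyStep k A q)⟦m⟧') ih).trans ?_
    rw [h₂]
    exact Category.assoc _ _ _

/-- The map from the morphisms `A → Ω^p[p][m]` to the singular Hochschild cohomology. -/
noncomputable def homToHHsg (p : ℕ) (m : ℤ) :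
    ((dbProp (Env k A)).ι.obj (diag k A) ⟶ (syzygyTower k A m).G.obj p) →ₗ[k] HHsg k A m :=
  (toHHsg k A p m).hom ∘ₗ (cohomologyEquiv k A p m).symm.toLinearMap

lemma homToHHsg_cohomologyEquiv {p : ℕ} {m : ℤ} (x : HH k A p m) :
    homToHHsg k A p m (cohomologyEquiv k A p m x) = (toHHsg k A p m).hom x :=
  congrArg (toHHsg k A p m).hom ((cohomologyEquiv k A p m).symm_apply_apply x)

lemma exists_cohomologyEquiv_eq {p : ℕ} {m : ℤ}
    (c : (dbProp (Env k A)).ι.obj (diag k A) ⟶ (syzygyTower k A m).G.obj p) :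
    ∃ x : HH k A p m, cohomologyEquiv k A p m x = c :=
  (cohomologyEquiv k A p m).surjective c

lemma homToHHsg_comp_map {p q : ℕ} (h : p ≤ q) {m : ℤ}
    (c : (dbProp (Env k A)).ι.obj (diag k A) ⟶ (syzygyTower k A m).G.obj p) :
    homToHHsg k A q m (c ≫ (syzygyTower k A m).G.map (homOfLE h)) = homToHHsg k A p m c := by
  obtain ⟨x, rfl⟩ := exists_cohomologyEquiv_eq k A c
  refine (congrArg _ (cohomologyEquiv_homologyMap k A h x).symm).trans ?_
  refine (homToHHsg_cohomologyEquiv k A _).trans (Eq.trans ?_ (homToHHsg_cohomologyEquiv k A x).symm)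
  have h' := colimit.w (Functor.ofSequence (theta k A)) (homOfLE h)
  exact LinearMap.congr_fun (congrArg ModuleCat.Hom.hom
    ((HomologicalComplex.homologyMap_comp _ _ m).symm.trans
      (congrArg (HomologicalComplex.homologyMap · m) h'))) x

/-- The morphisms `A → A[m]` in the singularity category are the colimit of the groups of morphisms
`A → Ω^p[p][m]`, and so is the singular Hochschild cohomology. -/
lemma exists_linearEquiv_HHsg (m : ℤ) :
    ∃ Φ : HHsg k A m ≃ₗ[k] ((Qsg (Env k A)).obj (diag k A) ⟶ (Qsg (Env k A)).obj ((diag k A)⟦m⟧)),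
      ∀ (p : ℕ) (x : HH k A p m)
        (ψ : (Qsg (Env k A)).obj (diag k A) ⟶ (Qsg (Env k A)).obj ((diag k A)⟦m⟧)),
        (syzygyTower k A m).Rep p (cohomologyEquiv k A p m x) ψ ↔ Φ ((toHHsg k A p m).hom x) = ψ := by
  obtain ⟨Φ, hΦ⟩ := (syzygyTower k A m).exists_linearEquiv perf_le_finApprox perf_le_dbProp
    (fun T hT h₁ h₂ ↦ finApprox_ext₃ T hT h₁ (perf_le_finApprox _ h₂)) (homToHHsg k A · m)
    (fun h c ↦ homToHHsg_comp_map k A h c)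
    (fun x ↦ by
      obtain ⟨p, y, hy⟩ := colimit_homology_exists_rep (F := Functor.ofSequence (theta k A)) m x
      exact ⟨p, cohomologyEquiv k A p m y, (homToHHsg_cohomologyEquiv k A y).trans hy⟩)
    (fun p c hc ↦ by
      obtain ⟨x, rfl⟩ := exists_cohomologyEquiv_eq k A c
      rw [homToHHsg_cohomologyEquiv] at hc
      obtain ⟨q, h, hq⟩ := exists_homologyMap_eq_zero (F := Functor.ofSequence (theta k A)) x hc
      refine ⟨q, h, (cohomologyEquiv_homologyMap k A h x).symm.trans ?_⟩
      rw [hq]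
      exact map_zero _)
  refine ⟨Φ, fun p x ψ ↦ (hΦ p _ ψ).trans ?_⟩
  rw [homToHHsg_cohomologyEquiv]

/-- The morphisms `A → A[m]` in the bounded derived category, as morphisms `A → Ω^0[0][m]`. -/
noncomputable def extGrpEquiv (m : ℤ) :
    ExtGrp k A m ≃ₗ[k] (single k A (Ω k A 0) ⟶ (shiftedForms k A 0)⟦m⟧) :=
  -- At stage 0 the syzygy class is the canonical isomorphism A → A[0], so composing with `σ 0`
  -- loses nothing.
  have : IsIso ((syzygyTower k A m).σ 0) :=
    have h : IsIso ((syzygyClass k A 0)⟦m⟧') := inferInstance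
    IsIso.comp_isIso' (f := ((dbProp (Env k A)).ι.commShiftIso m).hom.app (diag k A)) inferInstance h
  LinearEquiv.ofBijective
    { toFun φ := (dbProp (Env k A)).ι.map φ ≫ (syzygyTower k A m).σ 0
      map_add' φ ψ := by
        rw [Functor.map_add]
        exact Preadditive.add_comp _ _ _ _ _ _
      map_smul' a φ := by
        rw [Functor.map_smul]
        exact Linear.smul_comp _ _ _ _ _ _ }
    ⟨fun φ ψ h ↦ (dbProp (Env k A)).ι.map_injective ((cancel_mono ((syzygyTower k A m).σ 0)).1 h),
      fun φ ↦ by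
        obtain ⟨ψ, hψ⟩ := (dbProp (Env k A)).ι.map_surjective
          (show (dbProp (Env k A)).ι.obj (diag k A) ⟶ (dbProp (Env k A)).ι.obj ((diag k A)⟦m⟧) from
            φ ≫ inv ((syzygyTower k A m).σ 0))
        refine ⟨ψ, ?_⟩
        change (dbProp (Env k A)).ι.map ψ ≫ (syzygyTower k A m).σ 0 = φ
        rw [hψ]
        exact (Category.assoc _ _ _).trans
          ((congrArg (φ ≫ ·) (IsIso.inv_hom_id _)).trans (Category.comp_id _))⟩

lemma extGrpEquiv_apply {m : ℤ} (φ : ExtGrp k A m) :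
    extGrpEquiv k A m φ = ShiftedHom.map φ (dbProp (Env k A)).ι ≫ (syzygyClass k A 0)⟦m⟧' :=
  (Category.assoc _ _ _).symm

end

end SingHoch

/-! ### The main theorem -/

open SingHoch CategoryTheory

theorem theorem3 (k : Type u) (A : Type v) [Field k] [Ring A] [Algebra k A]
    [IsNoetherianRing (Env k A)] [HasDerivedCategory.{w} (ModuleCat.{v} (Env k A))] :
    ∃ (Ψ : ∀ m : ℤ, HH k A 0 m ≃ₗ[k] ExtGrp k A m)
      (Φ : ∀ m : ℤ, HHsg k A m ≃ₗ[k] TateExt k A m),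
      (∀ (n : ℕ) (z : (hochComplex k A 0).cycles (n : ℤ)),
        ShiftedHom.map (Ψ n ((hochComplex k A 0).homologyπ (n : ℤ) z)) (dbProp (Env k A)).ι =
          cocycleClass k A z n (by simp)) ∧
      (∀ (m : ℤ) (x : HH k A 0 m),
        Φ m (toHHsg k A 0 m x) = ShiftedHom.map (Ψ m x) (Qsg (Env k A))) ∧
      (∀ (p : ℕ) (m : ℤ) (z : (hochComplex k A p).cycles m) (n : ℕ) (hn : (n : ℤ) = m + p),
        Represents k A z n hn
          (Φ m (toHHsg k A p m ((hochComplex k A p).homologyπ m z)))) := by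
  choose Φ hΦ using fun m ↦ exists_linearEquiv_HHsg k A m
  have hΨ (m : ℤ) (x : HH k A 0 m) :
      extGrpEquiv k A m ((extGrpEquiv k A m).symm (cohomologyEquiv k A 0 m x)) =
        cohomologyEquiv k A 0 m x := LinearEquiv.apply_symm_apply _ _
  -- `Φ` takes values in morphisms to the image of A[m]; `N` replaces it by the shift of the image
  -- of A in the singularity category.
  let N (m : ℤ) : ((Qsg (Env k A)).obj (diag k A) ⟶ (Qsg (Env k A)).obj ((diag k A)⟦m⟧)) ≃ₗ[k]
      TateExt k A m :=
    Linear.homCongr k (Iso.refl _) (((Qsg (Env k A)).commShiftIso m).app (diag k A))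
  have hN (m : ℤ) (ψ) : N m ψ = ψ ≫ ((Qsg (Env k A)).commShiftIso m).hom.app (diag k A) :=
    congrArg (· ≫ ((Qsg (Env k A)).commShiftIso m).hom.app (diag k A)) (Category.id_comp ψ)
  refine ⟨fun m ↦ cohomologyEquiv k A 0 m ≪≫ₗ (extGrpEquiv k A m).symm,
    fun m ↦ Φ m ≪≫ₗ N m,
    fun n z ↦ ?_, fun m x ↦ ?_, fun p m z n hn ↦ ?_⟩
  · have h := hΨ n (((hochComplex k A 0).homologyπ n).hom z)
    rw [extGrpEquiv_apply] at h
    -- After composition with this isomorphism both sides become the class A → Ω^0[0][n] of `z`.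
    refine (cancel_mono ((syzygyClass k A 0)⟦(n : ℤ)⟧')).1 ?_
    refine h.trans ((cohomologyEquiv_homologyπ k A z n (by simp)).trans ?_)
    rw [shift_syzygyClass_zero]
    rfl
  -- A morphism of D^b is represented by the roof with Y = A[m] and identity denominator; the
  -- uniqueness half of `hΦ` then determines the value of `Φ`.
  · have h : (syzygyTower k A m).Rep 0 (cohomologyEquiv k A 0 m x)
        ((Qsg (Env k A)).map ((extGrpEquiv k A m).symm (cohomologyEquiv k A 0 m x))) :=
      ⟨_, 𝟙 _, MorphismProperty.id_mem _ _, (extGrpEquiv k A m).symm (cohomologyEquiv k A 0 m x),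
        (syzygyTower k A m).σ 0, by
          rw [CategoryTheory.Functor.map_id]
          exact Category.id_comp _, hΨ m x, by
          rw [CategoryTheory.Functor.map_id]
          exact Category.comp_id _⟩
    rw [hΦ] at h
    exact (congrArg (N m) h).trans (hN m _)
  · obtain ⟨Y, s, hs, g, h, h₁, h₂, h₃⟩ :=
      (hΦ m p (((hochComplex k A p).homologyπ m).hom z) _).2 rfl
    refine ⟨Y, s, hs, g, h, ?_, h₂.trans (cohomologyEquiv_homologyπ k A z n hn), ?_⟩
    · refine (congrArg (_ ≫ ·) h₁).trans ?_
      exact ((dbProp (Env k A)).ι.commShiftIso m).inv_hom_id_app_assoc _ _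
    · refine Eq.trans ?_ h₃
      refine (congrArg (· ≫ ((Qsg (Env k A)).commShiftIso m).inv.app (diag k A) ≫
        (Qsg (Env k A)).map s) (hN m _)).trans ?_
      refine (Category.assoc _ _ _).trans (congrArg (_ ≫ ·) ?_)
      exact ((Qsg (Env k A)).commShiftIso m).hom_inv_id_app_assoc _ _
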